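/- Let $G$ be an abelian group and let $R=\bigoplus_{\gamma\in G}R_\gamma$ be a $G$-graded ring (associative, with $1$, not necessarily commutative). Let $\hbar\in R$ be a homogeneous, regular, normal, non-invertible element, i.e. $\hbar\in R_\varepsilon$ for some $\varepsilon\in G$, $\hbar$ is neither a left nor a right zero divisor, $\hbar R=R\hbar$, and $\hbar$ is not a unit. Put $\bar R=R/\hbar R$ and let $\hat R=R[\hbar^{-1}]$ be the localization of $R$ at the Ore set $\{\hbar^i\}_{i\ge 0}$; both are $G$-graded in the natural way. For a $G$-graded ring $A$, let $\mathrm{Mod}^GA$ be the abelian category of $G$-graded left $A$-modules with degree-preserving $A$-linear maps, let $A^o$ be the opposite graded ring (so graded right $A$-modules are objects of $\mathrm{Mod}^GA^o$), and write $N(\gamma)$ for the shift, $N(\gamma)_{\delta}=N_{\gamma+\delta}$. For $M\in\mathrm{Mod}^GA$ put $$\underline{\mathrm{Ext}}_A^{i,G}(M,A)=\bigoplus_{\gamma\in G}\mathrm{Ext}^i_{\mathrm{Mod}^GA}(M,A(\gamma)),$$ a $G$-graded right $A$-module, and $$\mathrm{grade}_A^GM=\inf\{\,i\ge 0 : \underline{\mathrm{Ext}}_A^{i,G}(M,A)\ne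 0\,\}\in\mathbb N\cup\{+\infty\}.$$ The ring $A$ is left (right) $G$-noetherian if all homogeneous left (right) ideals are finitely generated. It is $G$-Auslander-Gorenstein if it is left and right $G$-noetherian, $A$ has finite injective dimension in both $\mathrm{Mod}^GA$ and $\mathrm{Mod}^GA^o$, and for every finitely generated graded left $A$-module $M$, every $i\ge 0$, every homogeneous submodule $N$ of $\underline{\mathrm{Ext}}_A^{i,G}(M,A)$ and every $j<i$ one has $\underline{\mathrm{Ext}}_{A^o}^{j,G}(N,A)=0$, and the same holds with $A$ and $A^o$ interchanged. Let $J^G(A)$ be the intersection of all maximal homogeneous left ideals of $A$ (maximal among the proper homogeneous left ideals). Suppose that $R$ is left and right $G$-noetherian, and let $M$ be a finitely generated $G$-graded left $R$-module that is $\hbar$-torsionfree, i.e. $\hbar^nx=0$ with $x\in M$, $n\ge 0$ implies $x=0$. Then: 1. If $\hbar\in J^G(R)$, then $\mathrm{grade}_{\hat R}^G(\hat R\otimes_RM)\ \ge\ \mathrm{grade}_R^GM\ \ge\ \mathrm{grade}_{\bar R}^G(\bar R\otimes_RM)$. 2. If $\bar R$ is $G$-Auslander-Gorenstein, then $\mathrm{grade}_{\hat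 R}^G(\hat R\otimes_RM)\ =\ \mathrm{grade}_R^GM\ \le\ \mathrm{grade}_{\bar R}^G(\bar R\otimes_RM)$. -/

import Mathlib

open CategoryTheory CategoryTheory.Limits DirectSum TensorProduct

universe u

noncomputable section

/-! ### Families of subgroups that form a direct sum decomposition -/

/-- A spanning family of subgroups with compatible projections is a direct sum decomposition. -/
theorem isInternal_of_proj {G X : Type*} [DecidableEq G] [AddCommGroup X] (N : G → AddSubgroup X)
    (htop : ∀ x, x ∈ ⨆ γ, N γ) (p : G → X →+ X) (h1 : ∀ γ, ∀ x ∈ N γ, p γ x = x)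
    (h2 : ∀ γ δ, δ ≠ γ → ∀ x ∈ N δ, p γ x = 0) : DirectSum.IsInternal N := by
  have key : ∀ (f : ⨁ γ, N γ) (γ : G), p γ (DirectSum.coeAddMonoidHom N f) = f γ := by
    intro f γ
    induction f using DirectSum.induction_on with
    | zero => simp
    | of δ x =>
      rw [DirectSum.coeAddMonoidHom_of]
      by_cases h : δ = γ
      · subst h
        rw [h1 _ _ x.2, DirectSum.of_eq_same]
      · rw [h2 _ _ h _ x.2, DirectSum.of_eq_of_ne _ _ _ (Ne.symm h)]
        rfl
    | add x y hx hy => rw [map_add, map_add, hx, hy]; rfl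
  refine ⟨fun f g hfg => ?_, fun x => ?_⟩
  · ext γ
    rw [← key f γ, ← key g γ, hfg]
  · have h : ⨆ γ, N γ ≤ (DirectSum.coeAddMonoidHom N).range := iSup_le fun γ y hy =>
      ⟨DirectSum.of (fun γ => N γ) γ ⟨y, hy⟩, DirectSum.coeAddMonoidHom_of _ _ _⟩
    exact h (htop x)

/-- A spanning family of independent subgroups is a direct sum decomposition. -/
theorem isInternal_of_indep {G X : Type*} [DecidableEq G] [AddCommGroup X]
    (N : G → AddSubgroup X) (htop : ∀ x, x ∈ ⨆ γ, N γ)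
    (h : ∀ (s : Finset G) (x : G → X), (∀ γ, x γ ∈ N γ) → ∑ γ ∈ s, x γ = 0 → ∀ γ ∈ s, x γ = 0) :
    DirectSum.IsInternal N := by
  classical
  refine ⟨(injective_iff_map_eq_zero _).2 fun f hf => ?_, fun x => ?_⟩
  · have h0 : ∑ γ ∈ DFinsupp.support f, ((f γ : N γ) : X) = 0 := by
      rw [← hf]
      conv_rhs => rw [← DirectSum.sum_support_of f, map_sum]
      simp only [DirectSum.coeAddMonoidHom_of]
    have h3 := h _ (fun γ => (f γ : X)) (fun γ => (f γ).2) h0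
    ext γ
    by_cases hγ : γ ∈ DFinsupp.support f
    · exact h3 γ hγ
    · rw [DFinsupp.notMem_support_iff.1 hγ]; rfl
  · have h : ⨆ γ, N γ ≤ (DirectSum.coeAddMonoidHom N).range := iSup_le fun γ y hy =>
      ⟨DirectSum.of (fun γ => N γ) γ ⟨y, hy⟩, DirectSum.coeAddMonoidHom_of _ _ _⟩
    exact h (htop x)

/-! ### The category of graded modules -/

section Category

variable {G : Type u} [AddCommGroup G] [DecidableEq G] {A : Type u} [Ring A]

/-- A `G`-graded left module over the ring `A` with grading `𝒜`. -/
structure GrMod (𝒜 : G → AddSubgroup A) where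
  carrier : Type u
  [addCommGroup : AddCommGroup carrier]
  [module : Module A carrier]
  deg : G → AddSubgroup carrier
  isInternal : DirectSum.IsInternal deg
  smul_mem : ∀ {γ δ : G} {a : A} {x : carrier}, a ∈ 𝒜 γ → x ∈ deg δ → a • x ∈ deg (γ + δ)

namespace GrMod

variable {𝒜 : G → AddSubgroup A}

instance : CoeSort (GrMod 𝒜) (Type u) := ⟨GrMod.carrier⟩

attribute [instance] GrMod.addCommGroup GrMod.module

instance (X : GrMod 𝒜) : DirectSum.Decomposition X.deg := X.isInternal.chooseDecomposition

/-- The projection onto the homogeneous component of degree `γ`. -/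
def comp (X : GrMod 𝒜) (γ : G) : X →+ X :=
  (X.deg γ).subtype.comp ((DFinsupp.evalAddMonoidHom γ).comp
    (DirectSum.decomposeAddEquiv X.deg).toAddMonoidHom)

theorem comp_eq (X : GrMod 𝒜) (γ : G) (x : X) : X.comp γ x = DirectSum.decompose X.deg x γ := rfl

theorem comp_mem (X : GrMod 𝒜) (γ : G) (x : X) : X.comp γ x ∈ X.deg γ :=
  (DirectSum.decompose X.deg x γ).2

theorem comp_same (X : GrMod 𝒜) {γ : G} {x : X} (hx : x ∈ X.deg γ) : X.comp γ x = x :=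
  DirectSum.decompose_of_mem_same _ hx

theorem comp_ne (X : GrMod 𝒜) {γ δ : G} {x : X} (hx : x ∈ X.deg δ) (h : δ ≠ γ) :
    X.comp γ x = 0 :=
  DirectSum.decompose_of_mem_ne _ hx h

theorem mem_iSup (X : GrMod 𝒜) (x : X) : x ∈ ⨆ γ, X.deg γ := by
  induction x using DirectSum.Decomposition.inductionOn X.deg with
  | zero => exact zero_mem _
  | homogeneous m => exact AddSubgroup.mem_iSup_of_mem _ m.2
  | add m m' h h' => exact add_mem h h'

theorem mem_of_comp (X : GrMod 𝒜) {P : AddSubgroup X} {x : X} (h : ∀ γ, X.comp γ x ∈ P) :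
    x ∈ P := by
  classical
  rw [← DirectSum.sum_support_decompose X.deg x]
  exact sum_mem fun γ _ => h γ

theorem eq_zero_of_comp (X : GrMod 𝒜) {x : X} (h : ∀ γ, X.comp γ x = 0) : x = 0 := by
  have := X.mem_of_comp (P := ⊥) (x := x) fun γ => by simp [h γ]
  simpa using this

/-- Two elements with the same homogeneous components are equal. -/
theorem ext_comp (X : GrMod 𝒜) {x y : X} (h : ∀ γ, X.comp γ x = X.comp γ y) : x = y :=
  sub_eq_zero.1 (X.eq_zero_of_comp fun γ => by rw [map_sub, h, sub_self])

/-- Morphisms are the linear maps that preserve degrees. -/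
@[ext]
structure Hom (X Y : GrMod 𝒜) where
  lin : X →ₗ[A] Y
  map_mem : ∀ {γ : G} {x : X}, x ∈ X.deg γ → lin x ∈ Y.deg γ

instance : Category (GrMod 𝒜) where
  Hom := Hom
  id X := ⟨LinearMap.id, fun h => h⟩
  comp f g := ⟨g.lin.comp f.lin, fun h => g.map_mem (f.map_mem h)⟩

@[ext]
theorem hom_ext {X Y : GrMod 𝒜} {f g : X ⟶ Y} (h : ∀ x, f.lin x = g.lin x) : f = g :=
  Hom.ext (LinearMap.ext h)

theorem lin_congr {X Y : GrMod 𝒜} {f g : X ⟶ Y} (h : f = g) (x : X) : f.lin x = g.lin x := by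
  rw [h]

@[simp] theorem id_lin (X : GrMod 𝒜) (x : X) : Hom.lin (𝟙 X) x = x := rfl

@[simp] theorem comp_lin {X Y Z : GrMod 𝒜} (f : X ⟶ Y) (g : Y ⟶ Z) (x : X) :
    Hom.lin (f ≫ g) x = g.lin (f.lin x) := rfl

theorem comp_map {X Y : GrMod 𝒜} (f : X ⟶ Y) (γ : G) (x : X) :
    Y.comp γ (f.lin x) = f.lin (X.comp γ x) := by
  induction x using DirectSum.Decomposition.inductionOn X.deg with
  | zero => simp
  | @homogeneous δ m =>
    by_cases h : δ = γ
    · subst h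
      rw [comp_same _ m.2, comp_same _ (f.map_mem m.2)]
    · rw [comp_ne _ m.2 h, comp_ne _ (f.map_mem m.2) h, map_zero]
  | add m m' h h' => simp only [map_add, h, h']

section Preadditive

variable (X Y : GrMod 𝒜)

instance : Zero (X ⟶ Y) := ⟨⟨0, fun _ => zero_mem _⟩⟩
instance : Add (X ⟶ Y) := ⟨fun f g => ⟨f.lin + g.lin, fun h => add_mem (f.map_mem h) (g.map_mem h)⟩⟩
instance : Neg (X ⟶ Y) := ⟨fun f => ⟨-f.lin, fun h => neg_mem (f.map_mem h)⟩⟩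
instance : Sub (X ⟶ Y) := ⟨fun f g => ⟨f.lin - g.lin, fun h => sub_mem (f.map_mem h) (g.map_mem h)⟩⟩
instance : SMul ℕ (X ⟶ Y) := ⟨fun n f => ⟨n • f.lin, fun h => nsmul_mem (f.map_mem h) n⟩⟩
instance : SMul ℤ (X ⟶ Y) := ⟨fun n f => ⟨n • f.lin, fun h => zsmul_mem (f.map_mem h) n⟩⟩

instance : AddCommGroup (X ⟶ Y) :=
  Function.Injective.addCommGroup (fun f : X ⟶ Y => f.lin) (fun _ _ h => Hom.ext h) rfl
    (fun _ _ => rfl) (fun _ => rfl) (fun _ _ => rfl) (fun _ _ => rfl) (fun _ _ => rfl)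

variable {X Y}

@[simp] theorem zero_lin (x : X) : Hom.lin (0 : X ⟶ Y) x = 0 := rfl
@[simp] theorem add_lin (f g : X ⟶ Y) (x : X) : Hom.lin (f + g) x = f.lin x + g.lin x := rfl

end Preadditive

instance : Preadditive (GrMod 𝒜) where
  add_comp _ _ _ f g h := by ext x; simp
  comp_add _ _ _ f g h := by ext x; simp

/-! #### Submodules, quotients, products -/

/-- A homogeneous submodule, as a graded module. -/
def sub (X : GrMod 𝒜) (N : Submodule A X) (hN : N.IsHomogeneous X.deg) : GrMod 𝒜 where
  carrier := N
  deg γ := (X.deg γ).comap N.subtype.toAddMonoidHom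
  isInternal := by
    classical
    refine isInternal_of_proj _ (fun x => ?_)
      (fun γ => ((X.comp γ).comp N.subtype.toAddMonoidHom).codRestrict N.toAddSubgroup
        fun x => hN γ x.2) (fun γ x hx => Subtype.ext (X.comp_same hx))
      (fun γ δ h x hx => Subtype.ext (X.comp_ne hx h))
    have hx : x = ∑ γ ∈ (DirectSum.decompose X.deg x.1).support,
        (⟨X.comp γ x, hN γ x.2⟩ : N) := by
      apply Subtype.ext
      rw [AddSubmonoidClass.coe_finsetSum]
      exact (DirectSum.sum_support_decompose X.deg x.1).symm
    rw [hx]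
    exact sum_mem fun γ _ => AddSubgroup.mem_iSup_of_mem γ (X.comp_mem γ x)
  smul_mem ha hx := X.smul_mem ha hx

/-- The inclusion of a homogeneous submodule. -/
def subι (X : GrMod 𝒜) (N : Submodule A X) (hN : N.IsHomogeneous X.deg) : X.sub N hN ⟶ X :=
  ⟨N.subtype, fun h => h⟩

/-- The quotient by a homogeneous submodule, as a graded module. -/
def quot (X : GrMod 𝒜) (N : Submodule A X) (hN : N.IsHomogeneous X.deg) : GrMod 𝒜 where
  carrier := X ⧸ N
  deg γ := (X.deg γ).map N.mkQ.toAddMonoidHom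
  isInternal := by
    refine isInternal_of_proj _ (fun x => ?_)
      (fun γ => QuotientAddGroup.map N.toAddSubgroup N.toAddSubgroup (X.comp γ)
        fun x hx => hN γ hx) ?_ ?_
    · obtain ⟨x, rfl⟩ := N.mkQ_surjective x
      induction x using DirectSum.Decomposition.inductionOn X.deg with
      | zero => rw [map_zero]; exact zero_mem _
      | homogeneous m => exact AddSubgroup.mem_iSup_of_mem _ ⟨m, m.2, rfl⟩
      | add m m' h h' => rw [map_add]; exact add_mem h h'
    · rintro γ _ ⟨x, hx, rfl⟩
      exact congrArg N.mkQ (X.comp_same hx)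
    · rintro γ δ h _ ⟨x, hx, rfl⟩
      exact (congrArg N.mkQ (X.comp_ne hx h)).trans (map_zero _)
  smul_mem := by
    rintro γ δ a _ ha ⟨x, hx, rfl⟩
    exact ⟨a • x, X.smul_mem ha hx, map_smul N.mkQ a x⟩

/-- The projection onto a quotient. -/
def quotπ (X : GrMod 𝒜) (N : Submodule A X) (hN : N.IsHomogeneous X.deg) : X ⟶ X.quot N hN :=
  ⟨N.mkQ, fun {_ x} h => ⟨x, h, rfl⟩⟩

/-- The product of two graded modules. -/
def prod (X Y : GrMod 𝒜) : GrMod 𝒜 where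
  carrier := X × Y
  deg γ := (X.deg γ).prod (Y.deg γ)
  isInternal := by
    refine isInternal_of_proj _ (fun x => ?_)
      (fun γ => (X.comp γ).prodMap (Y.comp γ)) ?_ ?_
    · obtain ⟨x, y⟩ := x
      have h1 : ∀ x : X, (x, (0 : Y)) ∈ ⨆ γ, (X.deg γ).prod (Y.deg γ) := fun x => by
        induction x using DirectSum.Decomposition.inductionOn X.deg with
        | zero => exact zero_mem _
        | homogeneous m => exact AddSubgroup.mem_iSup_of_mem _ ⟨m.2, zero_mem _⟩
        | add m m' h h' => simpa using add_mem h h'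
      have h2 : ∀ y : Y, ((0 : X), y) ∈ ⨆ γ, (X.deg γ).prod (Y.deg γ) := fun x => by
        induction x using DirectSum.Decomposition.inductionOn Y.deg with
        | zero => exact zero_mem _
        | homogeneous m => exact AddSubgroup.mem_iSup_of_mem _ ⟨zero_mem _, m.2⟩
        | add m m' h h' => simpa using add_mem h h'
      simpa using add_mem (h1 x) (h2 y)
    · rintro γ ⟨x, y⟩ ⟨hx, hy⟩
      exact Prod.ext (X.comp_same hx) (Y.comp_same hy)
    · rintro γ δ h ⟨x, y⟩ ⟨hx, hy⟩
      exact Prod.ext (X.comp_ne hx h) (Y.comp_ne hy h)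
  smul_mem ha hx := ⟨X.smul_mem ha hx.1, Y.smul_mem ha hx.2⟩

/-- The zero graded module. -/
def zeroObj : GrMod 𝒜 where
  carrier := PUnit
  deg _ := ⊥
  isInternal := isInternal_of_proj _ (fun x => by rw [Subsingleton.elim x 0]; exact zero_mem _)
    (fun _ => 0) (fun _ _ _ => rfl) (fun _ _ _ _ _ => rfl)
  smul_mem _ _ := Subsingleton.elim _ _

/-! #### The category is abelian -/

theorem isHomogeneous_ker {X Y : GrMod 𝒜} (f : X ⟶ Y) :
    (LinearMap.ker f.lin).IsHomogeneous X.deg := by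
  intro γ x hx
  have : f.lin (X.comp γ x) = 0 := by rw [← comp_map, LinearMap.mem_ker.1 hx, map_zero]
  exact this

theorem isHomogeneous_range {X Y : GrMod 𝒜} (f : X ⟶ Y) :
    (LinearMap.range f.lin).IsHomogeneous Y.deg := by
  rintro γ _ ⟨x, rfl⟩
  exact ⟨X.comp γ x, (comp_map f γ x).symm⟩

theorem subι_ker_comp {X Y : GrMod 𝒜} (f : X ⟶ Y) :
    X.subι _ (isHomogeneous_ker f) ≫ f = 0 :=
  hom_ext fun x => LinearMap.mem_ker.1 (Subtype.property x)

theorem comp_quotπ_range {X Y : GrMod 𝒜} (f : X ⟶ Y) :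
    f ≫ Y.quotπ _ (isHomogeneous_range f) = 0 :=
  hom_ext fun x => (Submodule.Quotient.mk_eq_zero _).2 ⟨x, rfl⟩

/-- The kernel of linear maps is a kernel in the category of graded modules. -/
def kernelIsLimit {X Y : GrMod 𝒜} (f : X ⟶ Y) :
    IsLimit (KernelFork.ofι (X.subι _ (isHomogeneous_ker f)) (subι_ker_comp f)) :=
  KernelFork.IsLimit.ofι _ _
    (fun g hg => ⟨g.lin.codRestrict _ fun x => lin_congr hg x,
      fun h => g.map_mem h⟩)
    (fun _ _ => rfl)
    (fun _ _ _ hm => hom_ext fun x =>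
      Subtype.ext (lin_congr hm x))

/-- The cokernel of linear maps is a cokernel in the category of graded modules. -/
def cokernelIsColimit {X Y : GrMod 𝒜} (f : X ⟶ Y) :
    IsColimit (CokernelCofork.ofπ (Y.quotπ _ (isHomogeneous_range f)) (comp_quotπ_range f)) :=
  CokernelCofork.IsColimit.ofπ _ _
    (fun {W} g hg => ⟨(LinearMap.range f.lin).liftQ g.lin (by
        rintro _ ⟨x, rfl⟩
        exact lin_congr hg x),
      by rintro γ _ ⟨y, hy, rfl⟩; exact g.map_mem hy⟩)
    (fun _ _ => rfl)
    (fun {W} g hg _ hm => hom_ext fun y => by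
      obtain ⟨y, rfl⟩ := Submodule.mkQ_surjective _ y
      exact lin_congr hm y)

theorem injective_of_mono {X Y : GrMod 𝒜} (f : X ⟶ Y) [Mono f] : Function.Injective f.lin := by
  rw [injective_iff_map_eq_zero]
  intro x hx
  have h : X.subι _ (isHomogeneous_ker f) = 0 := by
    rw [← cancel_mono f, subι_ker_comp, zero_comp]
  exact lin_congr h ⟨x, hx⟩

theorem surjective_of_epi {X Y : GrMod 𝒜} (f : X ⟶ Y) [Epi f] : Function.Surjective f.lin := by
  intro y
  have h : Y.quotπ _ (isHomogeneous_range f) = 0 := by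
    rw [← cancel_epi f, comp_quotπ_range, comp_zero]
  exact (Submodule.Quotient.mk_eq_zero _).1 (lin_congr h y)

theorem epi_of_surjective {X Y : GrMod 𝒜} (f : X ⟶ Y) (h : Function.Surjective f.lin) : Epi f :=
  ⟨fun g k e => hom_ext fun y => by
    obtain ⟨x, rfl⟩ := h y
    exact lin_congr e x⟩

theorem mem_deg_of_injective {X Y : GrMod 𝒜} (f : X ⟶ Y) (h : Function.Injective f.lin) {γ : G}
    {x : X} (hx : f.lin x ∈ Y.deg γ) : x ∈ X.deg γ := by
  have : X.comp γ x = x := h (by rw [← comp_map, comp_same _ hx])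
  rw [← this]
  exact X.comp_mem γ x

theorem exists_deg_of_surjective {X Y : GrMod 𝒜} (f : X ⟶ Y) (h : Function.Surjective f.lin)
    {γ : G} {y : Y} (hy : y ∈ Y.deg γ) : ∃ x ∈ X.deg γ, f.lin x = y := by
  obtain ⟨x, rfl⟩ := h y
  exact ⟨X.comp γ x, X.comp_mem γ x, by rw [← comp_map, comp_same _ hy]⟩

/-- Every monomorphism is a kernel. -/
theorem nonempty_normalMono {X Y : GrMod 𝒜} (f : X ⟶ Y) [Mono f] : Nonempty (NormalMono f) := ⟨{
  Z := Y.quot _ (isHomogeneous_range f)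
  g := Y.quotπ _ (isHomogeneous_range f)
  w := comp_quotπ_range f
  isLimit := KernelFork.IsLimit.ofι _ _
    (fun {W} g hg => ⟨(LinearEquiv.ofInjective f.lin (injective_of_mono f)).symm.toLinearMap.comp
        (g.lin.codRestrict (LinearMap.range f.lin) fun x =>
          (Submodule.Quotient.mk_eq_zero _).1 (lin_congr hg x)),
      fun {γ x} hx => mem_deg_of_injective f (injective_of_mono f) (by
        have : f.lin ((LinearEquiv.ofInjective f.lin (injective_of_mono f)).symm
          (g.lin.codRestrict (LinearMap.range f.lin) (fun x =>
          (Submodule.Quotient.mk_eq_zero _).1 (lin_congr hg x)) x)) =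
            g.lin x :=
          congrArg Subtype.val (LinearEquiv.apply_symm_apply
            (LinearEquiv.ofInjective f.lin (injective_of_mono f)) _)
        exact this ▸ g.map_mem hx)⟩)
    (fun {W} g hg => hom_ext fun x => congrArg Subtype.val (LinearEquiv.apply_symm_apply
            (LinearEquiv.ofInjective f.lin (injective_of_mono f)) _))
    (fun {W} g hg m hm => by
      rw [← cancel_mono f, hm]
      exact (hom_ext fun x => congrArg Subtype.val (LinearEquiv.apply_symm_apply
            (LinearEquiv.ofInjective f.lin (injective_of_mono f)) _)).symm) }⟩

/-- Every epimorphism is a cokernel. -/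
theorem nonempty_normalEpi {X Y : GrMod 𝒜} (f : X ⟶ Y) [Epi f] : Nonempty (NormalEpi f) := ⟨{
  W := X.sub _ (isHomogeneous_ker f)
  g := X.subι _ (isHomogeneous_ker f)
  w := subι_ker_comp f
  isColimit := CokernelCofork.IsColimit.ofπ' _ _ fun {W} g hg => by
    have hk : LinearMap.ker f.lin ≤ LinearMap.ker g.lin := fun x hx =>
      lin_congr hg ⟨x, hx⟩
    let d : Y →ₗ[A] W := ((LinearMap.ker f.lin).liftQ g.lin hk).comp
      (f.lin.quotKerEquivOfSurjective (surjective_of_epi f)).symm.toLinearMap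
    have hd : ∀ x, d (f.lin x) = g.lin x := fun x => by
      have : (f.lin.quotKerEquivOfSurjective (surjective_of_epi f)).symm (f.lin x) =
          (LinearMap.ker f.lin).mkQ x := by
        rw [LinearEquiv.symm_apply_eq]; rfl
      change (LinearMap.ker f.lin).liftQ g.lin hk (_) = _
      rw [LinearEquiv.coe_coe, this]
      rfl
    refine ⟨(⟨d, fun {γ y} hy => ?_⟩ : Hom Y W), hom_ext hd⟩
    obtain ⟨x, hx, rfl⟩ := exists_deg_of_surjective f (surjective_of_epi f) hy
    rw [hd]
    exact g.map_mem hx }⟩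

theorem isZero_zeroObj : IsZero (zeroObj : GrMod 𝒜) := by
  rw [IsZero.iff_id_eq_zero]
  exact hom_ext fun x => rfl

instance : HasZeroObject (GrMod 𝒜) := ⟨⟨_, isZero_zeroObj⟩⟩

instance (X Y : GrMod 𝒜) : HasLimit (pair X Y) :=
  HasLimit.mk ⟨BinaryFan.mk (P := X.prod Y) ⟨LinearMap.fst A X Y, fun h => h.1⟩
      ⟨LinearMap.snd A X Y, fun h => h.2⟩,
    BinaryFan.isLimitMk
      (fun s => ⟨LinearMap.prod (Hom.lin s.fst) (Hom.lin s.snd),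
        fun h => ⟨Hom.map_mem s.fst h, Hom.map_mem s.snd h⟩⟩)
      (fun _ => rfl) (fun _ => rfl)
      (fun _ _ h1 h2 => hom_ext fun x => Prod.ext (lin_congr h1 x)
        (lin_congr h2 x))⟩

instance : HasFiniteProducts (GrMod 𝒜) :=
  haveI : HasBinaryProducts (GrMod 𝒜) := hasBinaryProducts_of_hasLimit_pair _
  haveI : HasTerminal (GrMod 𝒜) := HasZeroObject.hasTerminal
  hasFiniteProducts_of_has_binary_and_terminal

instance : Abelian (GrMod 𝒜) where
  has_kernels := ⟨fun f => ⟨⟨_, kernelIsLimit f⟩⟩⟩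
  has_cokernels := ⟨fun f => ⟨⟨_, cokernelIsColimit f⟩⟩⟩
  normalMonoOfMono f _ := nonempty_normalMono f
  normalEpiOfEpi f _ := nonempty_normalEpi f

end GrMod

end Category

/-! ### The regular module, shifts, and enough projectives -/

section Ext

variable {G : Type u} [AddCommGroup G] [DecidableEq G] {A : Type u} [Ring A]

namespace GrMod

/-- The `γ`-shift `M(γ)`, with `M(γ)_δ = M_{γ + δ}`. -/
def shift {𝒜 : G → AddSubgroup A} (X : GrMod 𝒜) (γ : G) : GrMod 𝒜 where
  carrier := X
  deg δ := X.deg (γ + δ)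
  isInternal := by
    refine isInternal_of_proj _ (fun x => ?_) (fun δ => X.comp (γ + δ))
      (fun δ x hx => X.comp_same hx) (fun δ δ' h x hx => X.comp_ne hx fun e => h (add_left_cancel e))
    have h : ⨆ δ, X.deg δ ≤ ⨆ δ, X.deg (γ + δ) := iSup_le fun δ => by
      have := le_iSup (fun δ => X.deg (γ + δ)) (δ - γ)
      rwa [add_sub_cancel] at this
    exact h (X.mem_iSup x)
  smul_mem {α β} a x ha hx := by
    have := X.smul_mem ha hx
    rwa [add_left_comm] at this

variable (𝒜 : G → AddSubgroup A) [GradedRing 𝒜]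

/-- The graded ring as a graded left module over itself. -/
def self : GrMod 𝒜 where
  carrier := A
  deg := 𝒜
  isInternal := DirectSum.Decomposition.isInternal 𝒜
  smul_mem ha hx := SetLike.mul_mem_graded ha hx

theorem self_comp (γ : G) (a : A) : (self 𝒜).comp γ a = GradedRing.proj 𝒜 γ a := by
  induction a using DirectSum.Decomposition.inductionOn 𝒜 with
  | zero => exact (map_zero ((self 𝒜).comp γ)).trans (map_zero (GradedRing.proj 𝒜 γ)).symm
  | add a b ha hb =>
    rw [map_add, ← ha, ← hb]
    exact map_add ((self 𝒜).comp γ) a b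
  | @homogeneous δ a =>
    by_cases h : δ = γ
    · subst h
      exact ((self 𝒜).comp_same a.2).trans (DirectSum.decompose_of_mem_same 𝒜 a.2).symm
    · exact ((self 𝒜).comp_ne a.2 h).trans (DirectSum.decompose_of_mem_ne 𝒜 a.2 h).symm

theorem self_isHomogeneous (I : Submodule A (self 𝒜))
    (h : Ideal.IsHomogeneous 𝒜 (show Ideal A from I)) : I.IsHomogeneous (self 𝒜).deg := by
  intro γ x hx
  have h1 := h γ hx
  have h2 := self_comp 𝒜 γ x
  exact (congrArg (fun y => y ∈ I) h2).mpr h1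

/-- The free graded module with basis elements `e i` of degree `d i`. -/
def free {ι : Type u} (d : ι → G) : GrMod 𝒜 where
  carrier := ι →₀ A
  deg γ :=
    { carrier := {f | ∀ i, f i ∈ 𝒜 (γ - d i)}
      zero_mem' := fun _ => zero_mem _
      add_mem' := fun h h' i => add_mem (h i) (h' i)
      neg_mem' := fun h i => neg_mem (h i) }
  isInternal := by
    classical
    refine isInternal_of_proj _ (fun x => ?_) (fun γ => Finsupp.liftAddHom fun i =>
      (Finsupp.singleAddHom i).comp ((self 𝒜).comp (γ - d i))) ?_ ?_
    · induction x using Finsupp.induction_linear with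
      | zero => exact zero_mem _
      | add f g hf hg => exact add_mem hf hg
      | single i a =>
        induction a using DirectSum.Decomposition.inductionOn 𝒜 with
        | zero => rw [Finsupp.single_zero]; exact zero_mem _
        | add m m' h h' => rw [Finsupp.single_add]; exact add_mem h h'
        | @homogeneous δ m =>
          refine AddSubgroup.mem_iSup_of_mem (δ + d i) fun j => ?_
          by_cases h : i = j
          · subst h
            rw [Finsupp.single_eq_same, add_sub_cancel_right]
            exact m.2
          · rw [Finsupp.single_eq_of_ne' h]
            exact zero_mem _
    · intro γ f hf
      conv_rhs => rw [← Finsupp.sum_single f]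
      rw [Finsupp.liftAddHom_apply]
      exact Finsupp.sum_congr fun i _ => congrArg (Finsupp.single i) ((self 𝒜).comp_same (hf i))
    · intro γ δ h f hf
      rw [Finsupp.liftAddHom_apply]
      refine Finset.sum_eq_zero fun i _ => ?_
      have : (self 𝒜).comp (γ - d i) (f i) = 0 :=
        (self 𝒜).comp_ne (hf i) fun e => h (sub_left_injective e)
      exact (congrArg (Finsupp.single i) this).trans (Finsupp.single_zero i)
  smul_mem {α β} a f ha hf i := by
    rw [add_sub_assoc]
    exact SetLike.mul_mem_graded ha (hf i)

/-- The morphism out of a free graded module with given values on the basis. -/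
def freeDesc {ι : Type u} (d : ι → G) {X : GrMod 𝒜} (v : ι → X) (hv : ∀ i, v i ∈ X.deg (d i)) :
    free 𝒜 d ⟶ X :=
  ⟨Finsupp.linearCombination A v, fun {γ f} hf => by
    refine sum_mem fun i _ => ?_
    have := X.smul_mem (hf i) (hv i)
    rwa [sub_add_cancel] at this⟩

theorem single_mem_free {ι : Type u} (d : ι → G) (i : ι) :
    Finsupp.single i 1 ∈ (free 𝒜 d).deg (d i) := by
  classical
  intro j
  by_cases h : i = j
  · subst h
    rw [Finsupp.single_eq_same, sub_self]
    exact SetLike.one_mem_graded 𝒜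
  · rw [Finsupp.single_eq_of_ne' h]
    exact zero_mem _

instance projective_free {ι : Type u} (d : ι → G) : Projective (free 𝒜 d) where
  factors {E X} f e _ := by
    have h : ∀ i, ∃ x ∈ E.deg (d i), e.lin x = f.lin (Finsupp.single i (1 : A)) := fun i =>
      exists_deg_of_surjective e (surjective_of_epi e) (f.map_mem (single_mem_free 𝒜 d i))
    choose v hv hev using h
    refine ⟨freeDesc 𝒜 d v hv, Hom.ext (Finsupp.lhom_ext' fun i => LinearMap.ext_ring ?_)⟩
    refine Eq.trans ?_ (hev i)
    exact congrArg e.lin ((Finsupp.linearCombination_single A (1 : A) i).trans (one_smul A _))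

instance : EnoughProjectives (GrMod 𝒜) where
  presentation X := ⟨
    { p := free 𝒜 (fun i : Σ γ, X.deg γ => i.1)
      f := freeDesc 𝒜 _ (fun i => (i.2 : X)) (fun i => i.2.2)
      epi := epi_of_surjective _ fun x => by
        have : ∀ x, x ∈ LinearMap.range (Finsupp.linearCombination A
            (fun i : Σ γ, X.deg γ => (i.2 : X))) := fun x => by
          induction x using DirectSum.Decomposition.inductionOn X.deg with
          | zero => exact zero_mem _
          | @homogeneous γ m =>
            exact ⟨Finsupp.single ⟨γ, m⟩ 1,
              (Finsupp.linearCombination_single A (1 : A) _).trans (one_smul A _)⟩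
          | add m m' h h' => exact add_mem h h'
        exact this x }⟩

instance : HasExt.{u} (GrMod 𝒜) := hasExt_of_enoughProjectives.{u} _

/-! ### The graded Ext groups -/

variable {𝒜}

/-- The graded Ext group, the direct sum over `γ` of the groups `Ext^i(M, N(γ))` in the category of
graded modules. -/
def UExt (M N : GrMod 𝒜) (i : ℕ) : Type u := ⨁ γ : G, Abelian.Ext.{u} M (N.shift γ) i

instance (M N : GrMod 𝒜) (i : ℕ) : AddCommGroup (UExt M N i) :=
  inferInstanceAs (AddCommGroup (⨁ γ : G, Abelian.Ext.{u} M (N.shift γ) i))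

/-- The inclusion of the summand `Ext^i(M, N(γ))`. -/
def UExt.of (M N : GrMod 𝒜) (i : ℕ) (γ : G) : Abelian.Ext.{u} M (N.shift γ) i →+ UExt M N i :=
  DirectSum.of (fun γ => Abelian.Ext.{u} M (N.shift γ) i) γ

/-- Additive maps out of the graded Ext group. -/
def UExt.desc {M N : GrMod 𝒜} {i : ℕ} {B : Type u} [AddCommGroup B]
    (f : ∀ γ, Abelian.Ext.{u} M (N.shift γ) i →+ B) : UExt M N i →+ B :=
  DirectSum.toAddMonoid f

theorem UExt.desc_of {M N : GrMod 𝒜} {i : ℕ} {B : Type u} [AddCommGroup B]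
    (f : ∀ γ, Abelian.Ext.{u} M (N.shift γ) i →+ B) (γ : G)
    (x : Abelian.Ext.{u} M (N.shift γ) i) : UExt.desc f (UExt.of M N i γ x) = f γ x :=
  DirectSum.toAddMonoid_of _ _ _

theorem UExt.addHom_ext {M N : GrMod 𝒜} {i : ℕ} {B : Type u} [AddCommGroup B]
    {f g : UExt M N i →+ B} (h : ∀ γ x, f (UExt.of M N i γ x) = g (UExt.of M N i γ x)) : f = g :=
  DirectSum.addHom_ext h

/-- The projection to the summand `Ext^i(M, N(γ))`. -/
def UExt.proj (M N : GrMod 𝒜) (i : ℕ) (γ : G) : UExt M N i →+ Abelian.Ext.{u} M (N.shift γ) i :=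
  DFinsupp.evalAddMonoidHom (β := fun γ => Abelian.Ext.{u} M (N.shift γ) i) γ

theorem UExt.proj_of_same (M N : GrMod 𝒜) (i : ℕ) (γ : G) (x : Abelian.Ext.{u} M (N.shift γ) i) :
    UExt.proj M N i γ (UExt.of M N i γ x) = x :=
  DirectSum.of_eq_same (β := fun γ => Abelian.Ext.{u} M (N.shift γ) i) γ x

theorem UExt.proj_of_ne (M N : GrMod 𝒜) (i : ℕ) {γ δ : G} (h : δ ≠ γ)
    (x : Abelian.Ext.{u} M (N.shift δ) i) : UExt.proj M N i γ (UExt.of M N i δ x) = 0 :=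
  DirectSum.of_eq_of_ne (β := fun γ => Abelian.Ext.{u} M (N.shift γ) i) δ γ x h.symm

@[elab_as_elim]
theorem UExt.induction {M N : GrMod 𝒜} {i : ℕ} {P : UExt M N i → Prop} (x : UExt M N i)
    (zero : P 0) (of : ∀ γ x, P (UExt.of M N i γ x)) (add : ∀ x y, P x → P y → P (x + y)) : P x :=
  DirectSum.induction_on x zero of add

variable (𝒜)

/-- Right multiplication `x ↦ x * a_{η - γ}`, a morphism of graded left modules `A(γ) ⟶ A(η)`. -/
def rightMul (γ η : G) : A →+ ((self 𝒜).shift γ ⟶ (self 𝒜).shift η) where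
  toFun a := ⟨LinearMap.toSpanSingleton A A (GradedRing.proj 𝒜 (η - γ) a), fun {δ} (x : A) hx => by
    have h : x * GradedRing.proj 𝒜 (η - γ) a ∈ 𝒜 ((γ + δ) + (η - γ)) :=
      SetLike.mul_mem_graded hx (SetLike.coe_mem _)
    rwa [show (γ + δ) + (η - γ) = η + δ by abel] at h⟩
  map_zero' := by
    refine hom_ext fun (x : A) => ?_
    change x * GradedRing.proj 𝒜 (η - γ) 0 = 0
    rw [map_zero, mul_zero]
  map_add' a b := by
    refine hom_ext fun (x : A) => ?_
    change x * GradedRing.proj 𝒜 (η - γ) (a + b) =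
      x * GradedRing.proj 𝒜 (η - γ) a + x * GradedRing.proj 𝒜 (η - γ) b
    rw [map_add, mul_add]

variable {𝒜}

theorem rightMul_one (γ : G) : rightMul 𝒜 γ γ 1 = 𝟙 _ := by
  refine hom_ext fun (x : A) => ?_
  have : GradedRing.proj 𝒜 (γ - γ) (1 : A) = 1 := by
    rw [sub_self]; exact DirectSum.decompose_of_mem_same 𝒜 (SetLike.one_mem_graded 𝒜)
  change x * GradedRing.proj 𝒜 (γ - γ) (1 : A) = x
  rw [this, mul_one]

theorem rightMul_comp {γ η θ : G} {a b : A} (ha : a ∈ 𝒜 (η - γ)) (hb : b ∈ 𝒜 (θ - η)) :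
    rightMul 𝒜 γ η a ≫ rightMul 𝒜 η θ b = rightMul 𝒜 γ θ (a * b) := by
  refine hom_ext fun (x : A) => ?_
  have hab : a * b ∈ 𝒜 (θ - γ) := by
    have := SetLike.mul_mem_graded ha hb
    rwa [show (η - γ) + (θ - η) = θ - γ by abel] at this
  change (x * GradedRing.proj 𝒜 (η - γ) a) * GradedRing.proj 𝒜 (θ - η) b =
    x * GradedRing.proj 𝒜 (θ - γ) (a * b)
  have h1 : GradedRing.proj 𝒜 (η - γ) a = a := DirectSum.decompose_of_mem_same 𝒜 ha
  have h2 : GradedRing.proj 𝒜 (θ - η) b = b := DirectSum.decompose_of_mem_same 𝒜 hb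
  have h3 : GradedRing.proj 𝒜 (θ - γ) (a * b) = a * b := DirectSum.decompose_of_mem_same 𝒜 hab
  rw [h1, h2, h3, mul_assoc]

section RightAction

variable (M : GrMod 𝒜) (i : ℕ)

/-- Composition of Ext classes with right multiplication. -/
def extMul (γ η : G) : A →+ (Abelian.Ext.{u} M ((self 𝒜).shift γ) i →+
    Abelian.Ext.{u} M ((self 𝒜).shift η) i) :=
  ((Abelian.Ext.bilinearComp M ((self 𝒜).shift γ) ((self 𝒜).shift η) i 0 i (add_zero i)).flip.comp
    (Abelian.Ext.addEquiv₀.symm.toAddMonoidHom)).comp (rightMul 𝒜 γ η)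

theorem extMul_apply (γ η : G) (a : A) (x : Abelian.Ext.{u} M ((self 𝒜).shift γ) i) :
    extMul M i γ η a x = x.comp (Abelian.Ext.mk₀ (rightMul 𝒜 γ η a)) (add_zero i) := rfl

/-- The right action of the homogeneous elements of degree `δ`. -/
def extActHom (δ : G) : 𝒜 δ →+ (UExt M (self 𝒜) i →+ UExt M (self 𝒜) i) where
  toFun a := UExt.desc fun γ : G =>
    (UExt.of M (self 𝒜) i (γ + δ)).comp (extMul M i γ (γ + δ) a)
  map_zero' := by
    refine UExt.addHom_ext fun γ x => ?_
    rw [UExt.desc_of]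
    simp
  map_add' a b := by
    refine UExt.addHom_ext fun γ x => ?_
    rw [AddMonoidHom.add_apply, UExt.desc_of, UExt.desc_of, UExt.desc_of]
    simp

/-- The right action of `A` on the graded Ext group: a homogeneous `a` of degree `δ` sends
`Ext^i(M, A(γ))` to `Ext^i(M, A(γ + δ))` by composition with right multiplication by `a`. -/
def extAct : A →+ (UExt M (self 𝒜) i →+ UExt M (self 𝒜) i) :=
  (DirectSum.toAddMonoid (extActHom M i)).comp (DirectSum.decomposeAddEquiv 𝒜).toAddMonoidHom

theorem extAct_of {γ δ η : G} (h : γ + δ = η) {a : A} (ha : a ∈ 𝒜 δ)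
    (x : Abelian.Ext.{u} M ((self 𝒜).shift γ) i) :
    extAct M i a (UExt.of M _ i γ x) = UExt.of M _ i η (extMul M i γ η a x) := by
  subst h
  have : DirectSum.decomposeAddEquiv 𝒜 a = DirectSum.of (fun δ => 𝒜 δ) δ ⟨a, ha⟩ :=
    DirectSum.decompose_of_mem 𝒜 ha
  have h2 := congrArg (fun f => f (UExt.of M _ i γ x)) (congrArg (DirectSum.toAddMonoid
    (extActHom M i)) this)
  refine Eq.trans h2 ?_
  rw [DirectSum.toAddMonoid_of]
  exact UExt.desc_of _ _ _

theorem extAct_one (x : UExt M (self 𝒜) i) : extAct M i 1 x = x := by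
  induction x using UExt.induction with
  | zero => exact map_zero _
  | add x y hx hy => rw [map_add, hx, hy]
  | of γ x =>
    rw [extAct_of M i (add_zero γ) (SetLike.one_mem_graded 𝒜), extMul_apply, rightMul_one,
      Abelian.Ext.comp_mk₀_id]

theorem extAct_mul (a b : A) (x : UExt M (self 𝒜) i) :
    extAct M i (a * b) x = extAct M i b (extAct M i a x) := by
  induction x using UExt.induction with
  | zero => simp
  | add x y hx hy => simp only [map_add, hx, hy]
  | of γ x =>
    induction a using DirectSum.Decomposition.inductionOn 𝒜 with
    | zero => simp
    | add m m' h h' => rw [add_mul, map_add, map_add, AddMonoidHom.add_apply, h, h',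
        AddMonoidHom.add_apply, map_add]
    | @homogeneous δ a =>
      induction b using DirectSum.Decomposition.inductionOn 𝒜 with
      | zero => simp
      | add m m' h h' => rw [mul_add, map_add, map_add, AddMonoidHom.add_apply, h, h',
          AddMonoidHom.add_apply]
      | @homogeneous δ' b =>
        have ha : (a : A) ∈ 𝒜 ((γ + δ) - γ) := by rw [add_sub_cancel_left]; exact a.2
        have hb : (b : A) ∈ 𝒜 ((γ + δ + δ') - (γ + δ)) := by rw [add_sub_cancel_left]; exact b.2
        rw [extAct_of M i (add_assoc γ δ δ').symm (SetLike.mul_mem_graded a.2 b.2),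
          extAct_of M i rfl a.2, extAct_of M i rfl b.2, extMul_apply, extMul_apply, extMul_apply,
          ← rightMul_comp ha hb, ← Abelian.Ext.mk₀_comp_mk₀, Abelian.Ext.comp_assoc]
        rfl

/-- Right `A`-modules are left modules over the opposite ring. -/
instance : Module Aᵐᵒᵖ (UExt M (self 𝒜) i) where
  smul a x := extAct M i a.unop x
  one_smul x := extAct_one M i x
  mul_smul a b x := extAct_mul M i b.unop a.unop x
  smul_zero a := map_zero (extAct M i a.unop)
  smul_add a x y := map_add (extAct M i a.unop) x y
  add_smul a b x := by
    change extAct M i (a.unop + b.unop) x = _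
    rw [map_add]; rfl
  zero_smul x := by
    change extAct M i 0 x = 0
    rw [map_zero]; rfl

end RightAction

end GrMod

/-- The opposite of a graded ring, with the same homogeneous components. -/
def opGrading {G A : Type u} [Ring A] (𝒜 : G → AddSubgroup A) (γ : G) : AddSubgroup Aᵐᵒᵖ :=
  (𝒜 γ).comap (MulOpposite.opAddEquiv (α := A)).symm.toAddMonoidHom

theorem mem_opGrading {G A : Type u} [Ring A] {𝒜 : G → AddSubgroup A} {γ : G} {a : Aᵐᵒᵖ} :
    a ∈ opGrading 𝒜 γ ↔ a.unop ∈ 𝒜 γ := Iff.rfl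

variable (𝒜 : G → AddSubgroup A) [GradedRing 𝒜]

theorem isInternal_opGrading : DirectSum.IsInternal (opGrading 𝒜) := by
  refine isInternal_of_proj _ (fun x => ?_)
    (fun γ => (MulOpposite.opAddEquiv (α := A)).toAddMonoidHom.comp
      (((GrMod.self 𝒜).comp γ).comp (MulOpposite.opAddEquiv (α := A)).symm.toAddMonoidHom))
    (fun γ x hx => MulOpposite.unop_injective ((GrMod.self 𝒜).comp_same hx))
    (fun γ δ h x hx => MulOpposite.unop_injective ((GrMod.self 𝒜).comp_ne hx h))
  obtain ⟨x, rfl⟩ := MulOpposite.op_surjective x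
  induction x using DirectSum.Decomposition.inductionOn 𝒜 with
  | zero => exact zero_mem _
  | homogeneous m => exact AddSubgroup.mem_iSup_of_mem _ (mem_opGrading.2 m.2)
  | add m m' h h' => rw [MulOpposite.op_add]; exact add_mem h h'

instance : GradedRing (opGrading 𝒜) where
  one_mem := SetLike.one_mem_graded 𝒜
  mul_mem {γ δ} a b ha hb := by
    have : b.unop * a.unop ∈ 𝒜 (δ + γ) := SetLike.mul_mem_graded hb ha
    rw [add_comm] at this
    exact this
  toDecomposition := (isInternal_opGrading 𝒜).chooseDecomposition

namespace GrMod

variable {𝒜}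

/-- The graded Ext group from `M` to the ring as a graded right module; its component of degree `γ`
is `Ext^i(M, A(γ))`. -/
def uExt (M : GrMod 𝒜) (i : ℕ) : GrMod (opGrading 𝒜) where
  carrier := UExt M (self 𝒜) i
  deg γ := (UExt.of M (self 𝒜) i γ).range
  isInternal := by
    refine isInternal_of_proj _ (fun x => ?_)
      (fun γ => (UExt.of M (self 𝒜) i γ).comp (UExt.proj M (self 𝒜) i γ)) ?_ ?_
    · induction x using UExt.induction with
      | zero => exact zero_mem _
      | of γ x => exact AddSubgroup.mem_iSup_of_mem γ ⟨x, rfl⟩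
      | add x y hx hy => exact add_mem hx hy
    · rintro γ _ ⟨x, rfl⟩
      exact congrArg (UExt.of M (self 𝒜) i γ) (UExt.proj_of_same M (self 𝒜) i γ x)
    · rintro γ δ h _ ⟨x, rfl⟩
      exact (congrArg (UExt.of M (self 𝒜) i γ) (UExt.proj_of_ne M (self 𝒜) i h x)).trans
        (map_zero _)
  smul_mem := by
    rintro γ δ a _ ha ⟨x, rfl⟩
    exact ⟨_, (extAct_of M i (add_comm δ γ) ha x).symm⟩

/-! ### Grade, the Auslander condition, noetherian rings, radical -/

/-- The grade of a graded module, the least `i` with a nonzero graded Ext group `Ext^i(M, A)`, and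
`⊤` if there is none. -/
def grade (M : GrMod 𝒜) : ℕ∞ := ⨅ (i : ℕ) (_ : Nontrivial (M.uExt i)), (i : ℕ∞)

/-- Every homogeneous submodule of every `Ext^i(M, A)` has no `Ext^j` to `A` for `j < i`. -/
def SatisfiesAuslander (M : GrMod 𝒜) : Prop :=
  ∀ (i : ℕ) (N : Submodule Aᵐᵒᵖ (M.uExt i)) (hN : N.IsHomogeneous (M.uExt i).deg),
    ∀ j < i, Subsingleton (((M.uExt i).sub N hN).uExt j)

/-- All homogeneous submodules are finitely generated. -/
def IsGNoetherian (M : GrMod 𝒜) : Prop :=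
  ∀ N : Submodule A M, N.IsHomogeneous M.deg → N.FG

end GrMod

/-- Left `G`-noetherian graded rings. -/
def IsLeftGNoetherian : Prop := (GrMod.self 𝒜).IsGNoetherian

/-- Right `G`-noetherian graded rings. -/
def IsRightGNoetherian : Prop := (GrMod.self (opGrading 𝒜)).IsGNoetherian

/-- `G`-Gorenstein graded rings. -/
structure IsGGorenstein : Prop where
  left_noetherian : IsLeftGNoetherian 𝒜
  right_noetherian : IsRightGNoetherian 𝒜
  left_auslander : ∀ M : GrMod 𝒜, Module.Finite A M → M.SatisfiesAuslander
  right_auslander : ∀ M : GrMod (opGrading 𝒜), Module.Finite Aᵐᵒᵖ M → M.SatisfiesAuslander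

/-- `G`-Auslander-Gorenstein graded rings: `G`-Gorenstein with finite left and right injective
dimension. -/
structure IsGAuslanderGorenstein : Prop extends IsGGorenstein 𝒜 where
  left_injective_dimension : ∃ d : ℕ, HasInjectiveDimensionLE (GrMod.self 𝒜) d
  right_injective_dimension : ∃ d : ℕ, HasInjectiveDimensionLE (GrMod.self (opGrading 𝒜)) d

/-- Maximal elements among the proper homogeneous left ideals. -/
def IsMaximalHomogeneous (I : Ideal A) : Prop :=
  I.IsHomogeneous 𝒜 ∧ I ≠ ⊤ ∧ ∀ J : Ideal A, J.IsHomogeneous 𝒜 → I < J → J = ⊤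

/-- The Jacobson `G`-radical, the intersection of all maximal homogeneous left ideals. -/
def jacobsonG : Ideal A := sInf {I | IsMaximalHomogeneous 𝒜 I}

end Ext

/-! ### Base change -/

section BaseChange

variable {G : Type u} [AddCommGroup G] [DecidableEq G] {A B : Type u} [Ring A] [Ring B]
  {𝒜 : G → AddSubgroup A} {ℬ : G → AddSubgroup B}

namespace GrMod

variable (φ : 𝒜 →+*ᵍ ℬ) (M : GrMod 𝒜)

/-- The relations `b φ(a) ⊗ m = b ⊗ a m` that cut the tensor product over `A` out of the tensor
product over `ℤ`. -/
def tensorRel : Submodule B (B ⊗[ℤ] M) :=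
  Submodule.span B {t | ∃ (b : B) (a : A) (m : M), t = (b * φ a) ⊗ₜ[ℤ] m - b ⊗ₜ[ℤ] (a • m)}

/-- The class of a pure tensor in `B ⊗_A M`. -/
def tmul : B →+ M →+ ((B ⊗[ℤ] M) ⧸ tensorRel φ M) :=
  AddMonoidHom.mk' (fun b => AddMonoidHom.mk' (fun m => (tensorRel φ M).mkQ (b ⊗ₜ[ℤ] m))
    fun m m' => by rw [TensorProduct.tmul_add, map_add])
    fun b b' => AddMonoidHom.ext fun m => by
      change (tensorRel φ M).mkQ ((b + b') ⊗ₜ[ℤ] m) = _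
      rw [TensorProduct.add_tmul, map_add]; rfl

theorem tmul_mul (b : B) (a : A) (m : M) : tmul φ M (b * φ a) m = tmul φ M b (a • m) := by
  refine (Submodule.Quotient.eq _).2 (Submodule.subset_span ⟨b, a, m, rfl⟩)

theorem smul_tmul (b b' : B) (m : M) : b • tmul φ M b' m = tmul φ M (b * b') m := by
  change b • (tensorRel φ M).mkQ (b' ⊗ₜ[ℤ] m) = (tensorRel φ M).mkQ ((b * b') ⊗ₜ[ℤ] m)
  rw [← map_smul, TensorProduct.smul_tmul', smul_eq_mul]

/-- The degree `γ` part of `B ⊗_A M` is generated by the `b ⊗ m` with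
`deg b + deg m = γ`. -/
def tensorDeg (γ : G) : AddSubgroup ((B ⊗[ℤ] M) ⧸ tensorRel φ M) :=
  AddSubgroup.closure {t | ∃ (δ η : G) (b : B) (m : M),
    b ∈ ℬ δ ∧ m ∈ M.deg η ∧ δ + η = γ ∧ t = tmul φ M b m}

variable {φ M} in
theorem tmul_mem_tensorDeg {δ η γ : G} {b : B} {m : M} (hb : b ∈ ℬ δ) (hm : m ∈ M.deg η)
    (h : δ + η = γ) : tmul φ M b m ∈ tensorDeg φ M γ :=
  AddSubgroup.subset_closure ⟨δ, η, b, m, hb, hm, h, rfl⟩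

theorem tensor_induction {P : ((B ⊗[ℤ] M) ⧸ tensorRel φ M) → Prop} (h0 : P 0)
    (hadd : ∀ x y, P x → P y → P (x + y)) (h : ∀ b m, P (tmul φ M b m)) (x) : P x := by
  obtain ⟨x, rfl⟩ := Submodule.mkQ_surjective _ x
  induction x using TensorProduct.induction_on with
  | zero => rw [map_zero]; exact h0
  | tmul b m => exact h b m
  | add x y hx hy => rw [map_add]; exact hadd _ _ hx hy

variable [GradedRing ℬ]

/-- Auxiliary bilinear map for the projections onto the homogeneous components. -/
def tensorProjAux₂ (γ δ : G) : ℬ δ →+ (M →+ ((B ⊗[ℤ] M) ⧸ tensorRel φ M)) :=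
  AddMonoidHom.mk' (fun b => (tmul φ M b).comp (M.comp (γ - δ))) fun b b' => by
    rw [AddSubgroup.coe_add, map_add]; rfl

/-- Auxiliary bilinear map for the projections onto the homogeneous components. -/
def tensorProjAux₁ (γ : G) : B →+ (M →+ ((B ⊗[ℤ] M) ⧸ tensorRel φ M)) :=
  (DirectSum.toAddMonoid (tensorProjAux₂ φ M γ)).comp
    (DirectSum.decomposeAddEquiv ℬ).toAddMonoidHom

theorem tensorProjAux₁_apply (γ : G) {δ : G} {b : B} (hb : b ∈ ℬ δ) (m : M) :
    tensorProjAux₁ φ M γ b m = tmul φ M b (M.comp (γ - δ) m) := by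
  have : DirectSum.decomposeAddEquiv ℬ b = DirectSum.of (fun δ => ℬ δ) δ ⟨b, hb⟩ :=
    DirectSum.decompose_of_mem ℬ hb
  change DirectSum.toAddMonoid (tensorProjAux₂ φ M γ) (DirectSum.decomposeAddEquiv ℬ b) m = _
  rw [this, DirectSum.toAddMonoid_of]
  rfl

theorem tensorProjAux₁_rel [GradedRing 𝒜] (γ : G) (b : B) (a : A) (m : M) :
    tensorProjAux₁ φ M γ (b * φ a) m = tensorProjAux₁ φ M γ b (a • m) := by
  induction b using DirectSum.Decomposition.inductionOn ℬ with
  | zero => simp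
  | add b b' h h' => rw [add_mul, map_add, map_add, AddMonoidHom.add_apply, AddMonoidHom.add_apply,
      h, h']
  | @homogeneous δ b =>
    induction a using DirectSum.Decomposition.inductionOn 𝒜 with
    | zero => simp
    | add a a' h h' => rw [map_add, mul_add, map_add, AddMonoidHom.add_apply, add_smul, map_add,
        h, h']
    | @homogeneous α a =>
      have hφ : φ (a : A) ∈ ℬ α := φ.map_mem a.2
      rw [tensorProjAux₁_apply φ M γ (SetLike.mul_mem_graded b.2 hφ),
        tensorProjAux₁_apply φ M γ b.2, tmul_mul]
      congr 1
      induction m using DirectSum.Decomposition.inductionOn M.deg with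
      | zero => simp
      | add m m' h h' => simp only [map_add, smul_add, h, h']
      | @homogeneous η m =>
        by_cases h : η = γ - (δ + α)
        · subst h
          rw [comp_same _ m.2, comp_same]
          have := M.smul_mem a.2 m.2
          rwa [show α + (γ - (δ + α)) = γ - δ by abel] at this
        · rw [comp_ne _ m.2 h, smul_zero, comp_ne _ (M.smul_mem a.2 m.2)]
          intro e
          exact h (by rw [← add_left_cancel_iff (a := α), e]; abel)

/-- The projections before passing to the quotient. -/
def tensorProjAux (γ : G) : (B ⊗[ℤ] M) →+ ((B ⊗[ℤ] M) ⧸ tensorRel φ M) :=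
  TensorProduct.liftAddHom (R := ℤ) (tensorProjAux₁ φ M γ) (by
      intro n b m
      rw [map_zsmul, map_zsmul]; rfl)

theorem tensorProjAux_tmul (γ : G) (b : B) (m : M) :
    tensorProjAux φ M γ (b ⊗ₜ[ℤ] m) = tensorProjAux₁ φ M γ b m := rfl

variable [GradedRing 𝒜]

theorem tensorProjAux_rel (γ : G) {t : B ⊗[ℤ] M} (ht : t ∈ tensorRel φ M) (c : B) :
    tensorProjAux φ M γ (c • t) = 0 := by
  induction ht using Submodule.span_induction generalizing c with
  | mem t h =>
    obtain ⟨b, a, m, rfl⟩ := h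
    rw [smul_sub, TensorProduct.smul_tmul', TensorProduct.smul_tmul', map_sub,
      tensorProjAux_tmul, tensorProjAux_tmul, smul_eq_mul, smul_eq_mul, ← mul_assoc,
      tensorProjAux₁_rel, sub_self]
  | zero => rw [smul_zero, map_zero]
  | add x y _ _ hx hy => rw [smul_add, map_add, hx, hy, add_zero]
  | smul b x _ hx => rw [smul_smul, hx]

/-- The projection of `B ⊗_A M` onto the homogeneous component of degree `γ`. -/
def tensorProj (γ : G) :
    ((B ⊗[ℤ] M) ⧸ tensorRel φ M) →+ ((B ⊗[ℤ] M) ⧸ tensorRel φ M) :=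
  QuotientAddGroup.lift (tensorRel φ M).toAddSubgroup (tensorProjAux φ M γ) fun t ht => by
    have := tensorProjAux_rel φ M γ ht 1
    rwa [one_smul] at this

theorem tensorProj_tmul (γ : G) {δ : G} {b : B} (hb : b ∈ ℬ δ) (m : M) :
    tensorProj φ M γ (tmul φ M b m) = tmul φ M b (M.comp (γ - δ) m) :=
  tensorProjAux₁_apply φ M γ hb m

/-- The base change `B ⊗_A M` along a homomorphism of graded rings, graded by
`deg (b ⊗ m) = deg b + deg m`. -/
def baseChange (φ : 𝒜 →+*ᵍ ℬ) (M : GrMod 𝒜) : GrMod ℬ where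
  carrier := (B ⊗[ℤ] M) ⧸ tensorRel φ M
  deg := tensorDeg φ M
  isInternal := by
    refine isInternal_of_proj _ (fun x => ?_) (tensorProj φ M) ?_ ?_
    · induction x using tensor_induction with
      | h0 => exact zero_mem _
      | hadd x y hx hy => exact add_mem hx hy
      | h b m =>
        induction b using DirectSum.Decomposition.inductionOn ℬ with
        | zero => rw [map_zero]; exact zero_mem _
        | add b b' h h' => rw [map_add]; exact add_mem h h'
        | homogeneous b =>
          induction m using DirectSum.Decomposition.inductionOn M.deg with
          | zero => rw [map_zero]; exact zero_mem _
          | add m m' h h' => rw [map_add]; exact add_mem h h'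
          | homogeneous m =>
            exact AddSubgroup.mem_iSup_of_mem _ (tmul_mem_tensorDeg b.2 m.2 rfl)
    · intro γ x hx
      induction hx using AddSubgroup.closure_induction with
      | zero => exact map_zero _
      | add x y _ _ hx hy => rw [map_add, hx, hy]
      | neg x _ hx => rw [map_neg, hx]
      | mem x h =>
        obtain ⟨δ, η, b, m, hb, hm, rfl, rfl⟩ := h
        rw [tensorProj_tmul φ M _ hb, add_sub_cancel_left, comp_same _ hm]
    · intro γ γ' hne x hx
      induction hx using AddSubgroup.closure_induction with
      | zero => exact map_zero _
      | add x y _ _ hx hy => rw [map_add, hx, hy, add_zero]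
      | neg x _ hx => rw [map_neg, hx, neg_zero]
      | mem x h =>
        obtain ⟨δ, η, b, m, hb, hm, rfl, rfl⟩ := h
        rw [tensorProj_tmul φ M _ hb, comp_ne _ hm, map_zero]
        rintro rfl
        exact hne (add_sub_cancel _ _)
  smul_mem {γ γ' c x} hc hx := by
    induction hx using AddSubgroup.closure_induction with
    | zero => rw [smul_zero]; exact zero_mem _
    | add x y _ _ hx hy => rw [smul_add]; exact add_mem hx hy
    | neg x _ hx => rw [smul_neg]; exact neg_mem hx
    | mem x h =>
      obtain ⟨δ, η, b, m, hb, hm, rfl, rfl⟩ := h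
      rw [smul_tmul]
      exact tmul_mem_tensorDeg (SetLike.mul_mem_graded hc hb) hm (add_assoc _ _ _)

end GrMod

end BaseChange

/-! ### The quotient and the localization at a regular normal homogeneous element -/

/-- Regular normal elements: `ħ` is not a zero divisor on either side and `ħ R = R ħ`. -/
class IsRegularNormal {R : Type u} [Ring R] (ħ : R) : Prop where
  regular : IsRegular ħ
  left_mul : ∀ a : R, ∃ b : R, ħ * a = b * ħ
  right_mul : ∀ a : R, ∃ b : R, a * ħ = ħ * b

section Bar

variable {R : Type u} [Ring R]

/-- The ideal `ħ R = R ħ` is two-sided. -/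
instance (ħ : R) [h : IsRegularNormal ħ] : (Ideal.span {ħ}).IsTwoSided where
  mul_mem_of_left {a} b ha := by
    obtain ⟨c, rfl⟩ := Ideal.mem_span_singleton'.1 ha
    obtain ⟨d, hd⟩ := h.left_mul b
    exact Ideal.mem_span_singleton'.2 ⟨c * d, by rw [mul_assoc, mul_assoc, hd]⟩

/-- The quotient ring `R / ħ R`. -/
abbrev RBar (ħ : R) : Type u := R ⧸ Ideal.span {ħ}

variable {G : Type u} [AddCommGroup G] [DecidableEq G] (𝒜 : G → AddSubgroup R) [GradedRing 𝒜]
  (ħ : R) [IsRegularNormal ħ]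

/-- The grading of `R / ħ R` by the images of the homogeneous components of `R`. -/
def barGrading (γ : G) : AddSubgroup (RBar ħ) :=
  (𝒜 γ).map (Ideal.Quotient.mk (Ideal.span {ħ})).toAddMonoidHom

/-- The projection `R → R / ħ R`. -/
def toBar : 𝒜 →+*ᵍ barGrading 𝒜 ħ where
  toRingHom := Ideal.Quotient.mk (Ideal.span {ħ})
  map_mem {_ x} hx := ⟨x, hx, rfl⟩

variable [hħ : Fact (SetLike.IsHomogeneousElem 𝒜 ħ)]

theorem isInternal_barGrading : DirectSum.IsInternal (barGrading 𝒜 ħ) := by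
  exact ((GrMod.self 𝒜).quot (Ideal.span {ħ}) (GrMod.self_isHomogeneous 𝒜 _
    (Ideal.homogeneous_span 𝒜 _ (fun x hx => (Set.mem_singleton_iff.1 hx) ▸ hħ.out)))).isInternal

instance : GradedRing (barGrading 𝒜 ħ) where
  one_mem := ⟨1, SetLike.one_mem_graded 𝒜, map_one (Ideal.Quotient.mk (Ideal.span {ħ}))⟩
  mul_mem := by
    rintro γ δ _ _ ⟨a, ha, rfl⟩ ⟨b, hb, rfl⟩
    exact ⟨a * b, SetLike.mul_mem_graded ha hb,
      map_mul (Ideal.Quotient.mk (Ideal.span {ħ})) a b⟩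
  toDecomposition := (isInternal_barGrading 𝒜 ħ).chooseDecomposition

end Bar

section Hat

open OreLocalization

variable {R : Type u} [Ring R]

theorem pow_left_mul (ħ : R) [h : IsRegularNormal ħ] {s : R} (hs : s ∈ Submonoid.powers ħ) :
    ∀ a : R, ∃ b : R, s * a = b * s := by
  obtain ⟨n, rfl⟩ := hs
  induction n with
  | zero => exact fun a => ⟨a, by simp⟩
  | succ n ih =>
    intro a
    obtain ⟨b, hb⟩ := h.left_mul a
    obtain ⟨c, hc⟩ := ih b
    exact ⟨c, by beta_reduce at hc ⊢; rw [pow_succ, mul_assoc, hb, ← mul_assoc, hc, mul_assoc]⟩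

theorem pow_regular (ħ : R) [h : IsRegularNormal ħ] {s : R} (hs : s ∈ Submonoid.powers ħ) :
    IsRegular s := by
  obtain ⟨n, rfl⟩ := hs
  exact h.regular.pow n

/-- The powers of a regular normal element form an Ore set. -/
instance (ħ : R) [IsRegularNormal ħ] : OreSet (Submonoid.powers ħ) where
  ore_right_cancel r₁ r₂ s h := ⟨1, by rw [(pow_regular ħ s.2).right h]⟩
  oreNum r s := (pow_left_mul ħ s.2 r).choose
  oreDenom _ s := s
  ore_eq r s := (pow_left_mul ħ s.2 r).choose_spec

/-- The localization `R[ħ⁻¹]` at the Ore set of powers of `ħ`. -/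
abbrev RHat (ħ : R) [IsRegularNormal ħ] : Type u := OreLocalization (Submonoid.powers ħ) R

theorem powers_homogeneous {G : Type u} [AddCommGroup G] [DecidableEq G] (𝒜 : G → AddSubgroup R)
    [GradedRing 𝒜] (ħ : R) [hħ : Fact (SetLike.IsHomogeneousElem 𝒜 ħ)]
    (s : Submonoid.powers ħ) : ∃ δ, (s : R) ∈ 𝒜 δ := by
  obtain ⟨δ, hδ⟩ := hħ.out
  obtain ⟨_, n, rfl⟩ := s
  exact ⟨n • δ, SetLike.pow_mem_graded n hδ⟩

theorem powers_mul_comm {ħ : R} (s s' : Submonoid.powers ħ) : s * s' = s' * s := by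
  obtain ⟨_, n, rfl⟩ := s
  obtain ⟨_, m, rfl⟩ := s'
  exact Subtype.ext (pow_mul_comm ħ n m)

theorem eq_zero_of_oreDiv {ħ : R} [IsRegularNormal ħ] {r : R} {s : Submonoid.powers ħ}
    (h : r /ₒ s = 0) : r = 0 := by
  have h1 : ((s : R) /ₒ (1 : Submonoid.powers ħ)) * (r /ₒ s) = r /ₒ 1 := OreLocalization.mul_cancel
  rw [h, mul_zero] at h1
  refine numeratorHom_inj (S := Submonoid.powers ħ) (fun s hs x hx => ?_) ?_
  · exact (pow_regular ħ hs).left (hx.trans (mul_zero s).symm)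
  · exact h1.symm.trans (zero_oreDiv 1).symm

variable {G : Type u} [AddCommGroup G] [DecidableEq G] (𝒜 : G → AddSubgroup R) [GradedRing 𝒜]
  (ħ : R) [IsRegularNormal ħ] 

/-- The grading of `R[ħ⁻¹]`: the fractions `s⁻¹ r` with `s` a power of `ħ` of degree `δ` and
`r` homogeneous of degree `γ + δ` have degree `γ`. -/
def hatGrading (γ : G) : AddSubgroup (RHat ħ) where
  carrier := {x | ∃ (s : Submonoid.powers ħ) (δ : G) (r : R),
    (s : R) ∈ 𝒜 δ ∧ r ∈ 𝒜 (γ + δ) ∧ x = r /ₒ s}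
  zero_mem' := ⟨1, 0, 0, SetLike.one_mem_graded 𝒜, zero_mem _, (zero_oreDiv 1).symm⟩
  add_mem' := by
    rintro _ _ ⟨s, δ, r, hs, hr, rfl⟩ ⟨s', δ', r', hs', hr', rfl⟩
    refine ⟨s' * s, δ' + δ, (s' : R) * r + (s : R) * r', SetLike.mul_mem_graded hs' hs,
      add_mem ?_ ?_, ?_⟩
    · have := SetLike.mul_mem_graded hs' hr
      rwa [add_left_comm] at this
    · have := SetLike.mul_mem_graded hs hr'
      rwa [show δ + (γ + δ') = γ + (δ' + δ) by abel] at this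
    · rw [← add_oreDiv]
      congr 1
      · exact OreLocalization.expand' r s s'
      · rw [powers_mul_comm s' s]
        exact OreLocalization.expand' r' s' s
  neg_mem' := by
    rintro _ ⟨s, δ, r, hs, hr, rfl⟩
    exact ⟨s, δ, -r, hs, neg_mem hr, OreLocalization.neg_def r s⟩

/-- The homomorphism `R → R[ħ⁻¹]`. -/
def toHat : 𝒜 →+*ᵍ hatGrading 𝒜 ħ where
  toRingHom := OreLocalization.numeratorRingHom
  map_mem {γ x} hx := ⟨1, 0, x, SetLike.one_mem_graded 𝒜, by rwa [add_zero], rfl⟩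

theorem exists_common_denom (t : Finset G) (x : G → RHat ħ)
    (hx : ∀ γ, x γ ∈ hatGrading 𝒜 ħ γ) : ∃ (s : Submonoid.powers ħ) (δ : G), (s : R) ∈ 𝒜 δ ∧
      ∀ γ ∈ t, ∃ r ∈ 𝒜 (γ + δ), x γ = r /ₒ s := by
  induction t using Finset.induction_on with
  | empty => exact ⟨1, 0, SetLike.one_mem_graded 𝒜, by simp⟩
  | insert γ t _ ih =>
    obtain ⟨s, δ, hs, h⟩ := ih
    obtain ⟨s', δ', r', hs', hr', h'⟩ := hx γ
    refine ⟨s' * s, δ' + δ, SetLike.mul_mem_graded hs' hs, fun η hη => ?_⟩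
    rcases Finset.mem_insert.1 hη with rfl | hη
    · refine ⟨(s : R) * r', ?_, ?_⟩
      · have := SetLike.mul_mem_graded hs hr'
        rwa [show δ + (η + δ') = η + (δ' + δ) by abel] at this
      · rw [h', powers_mul_comm s' s]
        exact OreLocalization.expand' r' s' s
    · obtain ⟨r, hr, hxr⟩ := h η hη
      refine ⟨(s' : R) * r, ?_, ?_⟩
      · have := SetLike.mul_mem_graded hs' hr
        rwa [add_left_comm] at this
      · rw [hxr]
        exact OreLocalization.expand' r s s'

variable [Fact (SetLike.IsHomogeneousElem 𝒜 ħ)]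

theorem isInternal_hatGrading : DirectSum.IsInternal (hatGrading 𝒜 ħ) := by
  refine isInternal_of_indep _ (fun x => ?_) fun t x hx h0 γ hγ => ?_
  · induction x using OreLocalization.ind with
    | _ r s =>
      obtain ⟨δ, hδ⟩ := powers_homogeneous 𝒜 ħ s
      induction r using DirectSum.Decomposition.inductionOn 𝒜 with
      | zero => rw [zero_oreDiv]; exact zero_mem _
      | add r r' h h' => rw [← add_oreDiv]; exact add_mem h h'
      | @homogeneous α r =>
        exact AddSubgroup.mem_iSup_of_mem (α - δ) ⟨s, δ, r, hδ, by
          rw [sub_add_cancel]; exact r.2, rfl⟩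
  · obtain ⟨s, δ, hs, h⟩ := exists_common_denom 𝒜 ħ t x hx
    have h' : ∀ γ, ∃ r ∈ 𝒜 (γ + δ), γ ∈ t → x γ = r /ₒ s := fun γ => by
      by_cases hγ : γ ∈ t
      · obtain ⟨r, hr, e⟩ := h γ hγ
        exact ⟨r, hr, fun _ => e⟩
      · exact ⟨0, zero_mem _, fun h => absurd h hγ⟩
    choose r hr hxr using h'
    have hsum : ∀ t' : Finset G, ∑ γ ∈ t', (r γ /ₒ s : RHat ħ) = (∑ γ ∈ t', r γ) /ₒ s := by
      intro t'
      induction t' using Finset.induction_on with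
      | empty => rw [Finset.sum_empty, Finset.sum_empty, zero_oreDiv]
      | insert a t' ha ih => rw [Finset.sum_insert ha, Finset.sum_insert ha, ih, add_oreDiv]
    rw [Finset.sum_congr rfl fun γ hγ => hxr γ hγ, hsum] at h0
    have h1 := eq_zero_of_oreDiv h0
    have h2 : GradedRing.proj 𝒜 (γ + δ) (∑ γ ∈ t, r γ) = r γ := by
      rw [map_sum, Finset.sum_eq_single γ]
      · exact DirectSum.decompose_of_mem_same 𝒜 (hr γ)
      · intro η _ hη
        exact DirectSum.decompose_of_mem_ne 𝒜 (hr η) fun e => hη (add_right_cancel e)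
      · exact fun h => absurd hγ h
    rw [hxr γ hγ, ← h2, h1, map_zero, zero_oreDiv]

instance : GradedRing (hatGrading 𝒜 ħ) where
  one_mem := ⟨1, 0, 1, SetLike.one_mem_graded 𝒜, by
    rw [add_zero]; exact SetLike.one_mem_graded 𝒜, OreLocalization.one_def⟩
  mul_mem := by
    rintro γ γ' _ _ ⟨s, δ, r, hs, hr, rfl⟩ ⟨s', δ', r', hs', hr', rfl⟩
    obtain ⟨c, hc⟩ := pow_left_mul ħ s'.2 r
    have hc' : (s' : R) * r = GradedRing.proj 𝒜 (γ + δ) c * s' := by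
      have h1 : (s' : R) * r ∈ 𝒜 (γ + δ + δ') := by
        rw [add_comm]
        exact SetLike.mul_mem_graded hs' hr
      rw [← DirectSum.decompose_of_mem_same 𝒜 h1, hc]
      exact DirectSum.coe_decompose_mul_add_of_right_mem 𝒜 hs'
    refine ⟨s' * s, δ' + δ, GradedRing.proj 𝒜 (γ + δ) c * r', SetLike.mul_mem_graded hs' hs, ?_,
      oreDiv_mul_char r r' s s' _ _ hc'⟩
    have h2 : GradedRing.proj 𝒜 (γ + δ) c ∈ 𝒜 (γ + δ) := SetLike.coe_mem _
    have := SetLike.mul_mem_graded h2 hr'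
    rwa [show γ + δ + (γ' + δ') = γ + γ' + (δ' + δ) by abel] at this
  toDecomposition := (isInternal_hatGrading 𝒜 ħ).chooseDecomposition

end Hat

/-- The `ħ`-torsion part of a module. -/
def torsionPart {R : Type u} [Ring R] (ħ : R) (M : Type u) [AddCommGroup M] [Module R M] : Set M :=
  {x | ∃ n : ℕ, ħ ^ n • x = 0}

/-- A module is `ħ`-torsionfree if its `ħ`-torsion part vanishes. -/
def IsTorsionFree {R : Type u} [Ring R] (ħ : R) (M : Type u) [AddCommGroup M] [Module R M] : Prop :=
  torsionPart ħ M = {0}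

end

/-!
Everything is phrased through the predicate `GrMod.ExtVanish M i`, which says that all groups
`Ext^i(M, A(γ))` are zero; the inequalities between grades are implications between such vanishings.
Write `R̄ = R / ħ R`, `R̂ = R[ħ⁻¹]`, `M̄ = M / ħ M` and `M̂ = M[ħ⁻¹]`.

**Change of rings.** Let `U` be an exact functor and suppose that a class of maps `X ⟶ U X'`, through
which all maps `X ⟶ U N` factor uniquely, is closed under passing to syzygies. Then `Ext^i(X', N)`
agrees with `Ext^i(X, U N)` (`extComparison_bijective`). Restriction of scalars gives in this way
`Ext_{R̄}(M̄, R̄) = Ext_R(M, R̄)`, as `M` is torsionfree (`IsBar.comparison`), and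
`Ext_{R̂}(M̂, R̂) = Ext_R(M, R̂)` (`IsHat.comparison`).

**Localization.** Classes in `Ext_R(M, R̂)` have common denominators, by dimension shifting. Hence
`Ext^i(M, R) = 0` implies `Ext^i(M̂, R̂) = 0` (`extVanish_hat`), which gives the inequality between
the grades of `M` and `M̂` that both parts share; and `Ext^i(M̂, R̂) = 0` implies that
`Ext^i(M, R)` is `ħ`-torsion (`exists_pow_smul_uExt_eq_zero`).

**The radical case.** The sequence `0 → R → R → R̄ → 0` shows that `E = Ext^i(M, R)` satisfies
`E = E ħ` if `Ext^i(M̄, R̄) = 0`. As `E` is finitely generated, the graded Nakayama lemma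
(`subsingleton_of_mul_surjective`) yields `E = 0` (`extVanish_of_bar`).

**The Auslander-Gorenstein case.** Let `Ext^i(M, R) = 0` for all `i ≤ j`. The central claim is that
`Y = Ext^j(M̄, R̄)` vanishes (`extVanish_bar`). Put `E = Ext^{j+1}(M, R)` and
`Z = Ext^{j+1}(M̄, R̄)`. The long exact sequence identifies `Y` with the annihilator of `ħ` in `E` and
embeds `E / E ħ` in `Z` (`barConnecting`). Filter `Y` by divisibility by the powers of `ħ` in `E`.
This filtration is finite because `E` is noetherian, and its subquotients are quotients of submodules
of `Z`, twisted by the automorphism that conjugation with a power of `ħ` induces on `R̄`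
(`Connecting.exists_divide`). By the Auslander condition the submodules of `Z` have no Ext groups in
degrees up to `j`, so `Ext^j(Y, R̄) = 0` (`Connecting.extVanish_of_divisible`). Finally
`Ext^j(Ext^j(M̄, R̄), R̄) = 0` forces `Ext^j(M̄, R̄) = 0`, all lower Ext groups of `M̄` being zero
already (`extVanish_of_uExt_extVanish`). This replaces the spectral sequence of biduality: by means of
transposes of the maps in a free resolution, `M̄` is written as `Ext^{j+1}` of a finitely generated
right module, to which the Auslander condition applies.

Consequently `ħ` acts injectively on the first nonvanishing `Ext^g(M, R)`
(`eq_zero_of_smul_eq_zero`), which therefore is not torsion and survives in the localization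
(`extVanish_of_hat`). This gives the equality of the grades of `M` and `M̂`, and `extVanish_bar` gives
the inequality for `M̄`.
-/

noncomputable section

/-! ### Comparison of Ext groups along an exact functor -/

section Comparison

open Abelian

universe w v₁ v₂ u₁ u₂

variable {C : Type u₁} [Category.{v₁} C] [Abelian C] [HasExt.{w} C]
  {D : Type u₂} [Category.{v₂} D] [Abelian D] [HasExt.{w} D]
  (U : D ⥤ C) [U.Additive] [PreservesFiniteLimits U] [PreservesFiniteColimits U]

/-- Given `u : X ⟶ U X'`, apply the exact functor `U` to an extension class of `X'` by `N` and
pull the result back along `u`. -/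
def extComparison {X : C} {X' : D} (u : X ⟶ U.obj X') (N : D) (i : ℕ) :
    Ext.{w} X' N i →+ Ext.{w} X (U.obj N) i :=
  ((Ext.mk₀ u).precomp (U.obj N) (zero_add i)).comp (U.mapExtAddHom X' N i)

variable {U} in
theorem extComparison_apply {X : C} {X' : D} (u : X ⟶ U.obj X') {N : D} {i : ℕ}
    (x : Ext.{w} X' N i) :
    extComparison U u N i x = (Ext.mk₀ u).comp (x.mapExactFunctor U) (zero_add i) := rfl

theorem extComparison_comp_mk₀ {X : C} {X' : D} (u : X ⟶ U.obj X') {N N' : D} (g : N ⟶ N')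
    {i : ℕ} (x : Ext.{w} X' N i) :
    extComparison U u N' i (x.comp (Ext.mk₀ g) (add_zero i)) =
      (extComparison U u N i x).comp (Ext.mk₀ (U.map g)) (add_zero i) := by
  simp only [extComparison_apply]
  rw [Ext.mapExactFunctor_comp, Ext.mapExactFunctor_mk₀, Ext.comp_assoc _ _ _ _ _ (by lia)]

/-- Compatible short exact sequences `0 → K → P → X → 0` and `0 → K' → P' → X' → 0` with projective
middle terms, over which the relation `Rel` lifts. -/
structure SyzygyLift (Rel : ∀ (X : C) (X' : D), (X ⟶ U.obj X') → Prop) {X : C} {X' : D}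
    (u : X ⟶ U.obj X') where
  {K : C}
  {P : C}
  {K' : D}
  {P' : D}
  (i : K ⟶ P)
  (p : P ⟶ X)
  (i' : K' ⟶ P')
  (p' : P' ⟶ X')
  (w : i ≫ p = 0)
  (w' : i' ≫ p' = 0)
  exact : (ShortComplex.mk i p w).ShortExact
  exact' : (ShortComplex.mk i' p' w').ShortExact
  proj : Projective P
  proj' : Projective P'
  (v : K ⟶ U.obj K')
  (q : P ⟶ U.obj P')
  comm₁ : v ≫ U.map i' = i ≫ q
  comm₂ : q ≫ U.map p' = p ≫ u
  rel_left : Rel K K' v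
  rel_mid : Rel P P' q

/-- If composition with `u` identifies the maps `X' ⟶ N` with the maps `X ⟶ U N` whenever `u`
satisfies `Rel`, and if `Rel` is inherited by syzygies, then the Ext groups agree as well. The proof
is by dimension shifting; surjectivity one degree lower on the middle terms of the syzygy sequences
gives injectivity. -/
theorem extComparison_bijective (Rel : ∀ (X : C) (X' : D), (X ⟶ U.obj X') → Prop)
    (h0 : ∀ {X X' u}, Rel X X' u → ∀ N, Function.Bijective fun f : X' ⟶ N => u ≫ U.map f)
    (h1 : ∀ {X X' u}, Rel X X' u → Nonempty (SyzygyLift U Rel u)) (i : ℕ) {X : C} {X' : D}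
    {u : X ⟶ U.obj X'} (h : Rel X X' u) (N : D) :
    Function.Bijective (extComparison.{w} U u N i) := by
  induction i generalizing X X' with
  | zero =>
    have e : ∀ f : X' ⟶ N, extComparison.{w} U u N 0 (Ext.mk₀ f) = Ext.mk₀ (u ≫ U.map f) := by
      intro f
      rw [extComparison_apply, Ext.mapExactFunctor_mk₀, Ext.mk₀_comp_mk₀]
    constructor
    · intro x y hxy
      obtain ⟨f, rfl⟩ := (Ext.mk₀_bijective X' N).2 x
      obtain ⟨g, rfl⟩ := (Ext.mk₀_bijective X' N).2 y
      rw [e, e] at hxy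
      exact congrArg _ ((h0 h N).1 ((Ext.mk₀_bijective _ _).1 hxy))
    · intro y
      obtain ⟨g, rfl⟩ := (Ext.mk₀_bijective _ _).2 y
      obtain ⟨f, rfl⟩ := (h0 h N).2 g
      exact ⟨Ext.mk₀ f, e f⟩
  | succ i ih =>
    obtain ⟨⟨f, g, f', g', w, w', hS, hS', hP, hP', v, q, c₁, c₂, hK, hM⟩⟩ := h1 h
    have nat : hS.extClass.comp (Ext.mk₀ v) (add_zero 1) =
        (Ext.mk₀ u).comp (hS'.extClass.mapExactFunctor U) (zero_add 1) := by
      rw [Ext.mapExactFunctor_extClass]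
      exact ShortComplex.ShortExact.extClass_naturality hS (hS'.map_of_exact U)
        ⟨v, q, u, c₁, c₂⟩
    have key : ∀ z : Ext.{w} _ N i,
        extComparison U u N (i + 1) (hS'.extClass.comp z (add_comm 1 i)) =
          hS.extClass.comp (extComparison U v N i z) (add_comm 1 i) := by
      intro z
      rw [extComparison_apply, extComparison_apply, Ext.mapExactFunctor_comp]
      rw [← Ext.comp_assoc _ _ _ (zero_add 1) _ (by lia), ← nat,
        Ext.comp_assoc _ _ _ _ (zero_add i) (by lia)]
    constructor
    · rw [injective_iff_map_eq_zero]
      intro x hx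
      obtain ⟨z, rfl⟩ := Ext.contravariant_sequence_exact₃ hS' N x (Ext.eq_zero_of_projective _)
        (add_comm 1 i)
      rw [key] at hx
      obtain ⟨y, hy⟩ := Ext.contravariant_sequence_exact₁ hS _ _ _ hx
      obtain ⟨y, rfl⟩ := (ih hM).2 y
      have : (Ext.mk₀ f').comp y (zero_add i) = z := by
        refine (ih hK).1 (Eq.trans ?_ hy)
        simp only [extComparison_apply]
        rw [Ext.mapExactFunctor_comp, Ext.mapExactFunctor_mk₀, Ext.mk₀_comp_mk₀_assoc,
          Ext.mk₀_comp_mk₀_assoc]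
        congr 2
      rw [← this, ShortComplex.ShortExact.extClass_comp_assoc]
    · intro y
      obtain ⟨z, rfl⟩ := Ext.contravariant_sequence_exact₃ hS _ y (Ext.eq_zero_of_projective _)
        (add_comm 1 i)
      obtain ⟨z, rfl⟩ := (ih hK).2 z
      exact ⟨_, key z⟩

end Comparison

/-! ### Short exact sequences of graded modules -/

namespace GrMod

variable {G : Type u} [AddCommGroup G] [DecidableEq G] {A : Type u} [Ring A]
  {𝒜 : G → AddSubgroup A}

theorem mono_of_injective {X Y : GrMod 𝒜} (f : X ⟶ Y) (h : Function.Injective f.lin) : Mono f :=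
  ⟨fun _ _ e => hom_ext fun x => h (lin_congr e x)⟩

theorem shortExact_mk {S : ShortComplex (GrMod 𝒜)} (hf : Function.Injective S.f.lin)
    (hg : Function.Surjective S.g.lin) (hex : ∀ y, S.g.lin y = 0 → ∃ x, S.f.lin x = y) :
    S.ShortExact := by
  have := mono_of_injective S.f hf
  have := epi_of_surjective S.g hg
  refine ShortComplex.ShortExact.mk
    (S.exact_of_f_is_kernel (KernelFork.IsLimit.ofι' _ _ fun {W} k hk => ?_))
  let l : W →ₗ[A] S.X₁ := (LinearEquiv.ofInjective S.f.lin hf).symm.toLinearMap.comp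
    (k.lin.codRestrict (LinearMap.range S.f.lin) fun x => hex _ (lin_congr hk x))
  have hl : ∀ x, S.f.lin (l x) = k.lin x := fun x =>
    congrArg Subtype.val (LinearEquiv.apply_symm_apply (LinearEquiv.ofInjective S.f.lin hf) _)
  exact ⟨⟨l, fun hx => mem_deg_of_injective S.f hf (by rw [hl]; exact k.map_mem hx)⟩, hom_ext hl⟩

theorem injective_f {S : ShortComplex (GrMod 𝒜)} (hS : S.ShortExact) :
    Function.Injective S.f.lin :=
  have := hS.mono_f
  injective_of_mono _

theorem surjective_g {S : ShortComplex (GrMod 𝒜)} (hS : S.ShortExact) :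
    Function.Surjective S.g.lin :=
  have := hS.epi_g
  surjective_of_epi _

theorem exists_of_g_eq_zero {S : ShortComplex (GrMod 𝒜)} (hS : S.ShortExact) {y : S.X₂}
    (hy : S.g.lin y = 0) : ∃ x, S.f.lin x = y :=
  ⟨(Hom.lin (hS.fIsKernel.lift (KernelFork.ofι _ (subι_ker_comp S.g)))) ⟨y, hy⟩,
    lin_congr (hS.fIsKernel.fac (KernelFork.ofι _ (subι_ker_comp S.g)) .zero) ⟨y, hy⟩⟩

theorem g_f_apply (S : ShortComplex (GrMod 𝒜)) (x : S.X₁) : S.g.lin (S.f.lin x) = 0 :=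
  lin_congr S.zero x

/-- The short exact sequence of the kernel of an epimorphism. -/
abbrev kerComplex {X Y : GrMod 𝒜} (f : X ⟶ Y) : ShortComplex (GrMod 𝒜) :=
  ShortComplex.mk _ _ (subι_ker_comp f)

theorem kerComplex_shortExact {X Y : GrMod 𝒜} (f : X ⟶ Y) (hf : Function.Surjective f.lin) :
    (kerComplex f).ShortExact :=
  shortExact_mk Subtype.val_injective hf fun y hy => ⟨⟨y, hy⟩, rfl⟩

theorem quotComplex_zero (X : GrMod 𝒜) (N : Submodule A X) (hN : N.IsHomogeneous X.deg) :
    X.subι N hN ≫ X.quotπ N hN = 0 :=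
  hom_ext fun x => (Submodule.Quotient.mk_eq_zero _).2 x.2

/-- The short exact sequence of a homogeneous submodule and its quotient. -/
abbrev quotComplex (X : GrMod 𝒜) (N : Submodule A X) (hN : N.IsHomogeneous X.deg) :
    ShortComplex (GrMod 𝒜) :=
  ShortComplex.mk _ _ (quotComplex_zero X N hN)

theorem quotComplex_shortExact (X : GrMod 𝒜) (N : Submodule A X) (hN : N.IsHomogeneous X.deg) :
    (quotComplex X N hN).ShortExact :=
  shortExact_mk Subtype.val_injective (Submodule.mkQ_surjective _) fun y hy =>
    ⟨⟨y, (Submodule.Quotient.mk_eq_zero _).1 hy⟩, rfl⟩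

/-- A bijective morphism is an isomorphism. -/
def isoOfBijective {X Y : GrMod 𝒜} (f : X ⟶ Y) (hf : Function.Bijective f.lin) : X ≅ Y where
  hom := f
  inv := ⟨(LinearEquiv.ofBijective f.lin hf).symm.toLinearMap, fun {γ y} hy =>
    mem_deg_of_injective f hf.1 (by
      have : f.lin ((LinearEquiv.ofBijective f.lin hf).symm y) = y :=
        LinearEquiv.apply_symm_apply (LinearEquiv.ofBijective f.lin hf) y
      rw [LinearEquiv.coe_coe, this]
      exact hy)⟩
  hom_inv_id := hom_ext fun x => LinearEquiv.symm_apply_apply (LinearEquiv.ofBijective f.lin hf) x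
  inv_hom_id := hom_ext fun x => LinearEquiv.apply_symm_apply (LinearEquiv.ofBijective f.lin hf) x

/-- Two quotients of the same graded module with the same kernel are isomorphic. -/
theorem nonempty_iso_of_ker_eq {P X Y : GrMod 𝒜} (f : P ⟶ X) (g : P ⟶ Y)
    (hf : Function.Surjective f.lin) (hg : Function.Surjective g.lin)
    (h : ∀ x, f.lin x = 0 ↔ g.lin x = 0) : Nonempty (X ≅ Y) := by
  have hk : LinearMap.ker f.lin ≤ LinearMap.ker g.lin := fun x hx => (h x).1 hx
  let d : X →ₗ[A] Y := ((LinearMap.ker f.lin).liftQ g.lin hk).comp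
    (f.lin.quotKerEquivOfSurjective hf).symm.toLinearMap
  have hd : ∀ x, d (f.lin x) = g.lin x := fun x => by
    have : (f.lin.quotKerEquivOfSurjective hf).symm (f.lin x) =
        (LinearMap.ker f.lin).mkQ x := by
      rw [LinearEquiv.symm_apply_eq]; rfl
    change (LinearMap.ker f.lin).liftQ g.lin hk (_) = _
    rw [LinearEquiv.coe_coe, this]
    rfl
  let D : X ⟶ Y := ⟨d, fun {γ x} hx => by
    obtain ⟨p, hp, rfl⟩ := exists_deg_of_surjective f hf hx
    rw [hd]; exact g.map_mem hp⟩
  refine ⟨isoOfBijective D ⟨(injective_iff_map_eq_zero _).2 fun x hx => ?_, fun y => ?_⟩⟩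
  · obtain ⟨p, rfl⟩ := hf x
    exact (h p).2 ((hd p).symm.trans hx)
  · obtain ⟨p, rfl⟩ := hg y
    exact ⟨f.lin p, hd p⟩

theorem iso_bijective {X Y : GrMod 𝒜} (e : X ≅ Y) : Function.Bijective e.hom.lin :=
  ⟨fun x y h => by
    have := congrArg e.inv.lin h
    rwa [← comp_lin, ← comp_lin, e.hom_inv_id] at this,
  fun y => ⟨e.inv.lin y, by rw [← comp_lin, e.inv_hom_id]; rfl⟩⟩

/-! ### Maps that shift degrees, and homogeneous submodules -/

/-- An additive map between graded modules, possibly over different rings, that raises degrees by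
`α` commutes with the projections onto homogeneous components. -/
theorem comp_addHom {B : Type u} [Ring B] {ℬ : G → AddSubgroup B} {X : GrMod 𝒜} {Y : GrMod ℬ}
    (f : X →+ Y) (α : G) (hf : ∀ γ, ∀ x ∈ X.deg γ, f x ∈ Y.deg (γ + α)) (γ : G) (x : X) :
    Y.comp (γ + α) (f x) = f (X.comp γ x) := by
  induction x using DirectSum.Decomposition.inductionOn X.deg with
  | zero => simp
  | @homogeneous δ m =>
    by_cases h : δ = γ
    · subst h
      rw [comp_same _ m.2, comp_same _ (hf _ _ m.2)]
    · rw [comp_ne _ m.2 h, comp_ne _ (hf _ _ m.2) fun e => h (add_right_cancel e), map_zero]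
  | add m m' h h' => simp only [map_add, h, h']

theorem isHomogeneous_comap {X Y : GrMod 𝒜} (f : X ⟶ Y) {N : Submodule A Y}
    (hN : N.IsHomogeneous Y.deg) : (N.comap f.lin).IsHomogeneous X.deg := by
  intro γ x hx
  have : f.lin (X.comp γ x) ∈ N := by rw [← comp_map]; exact hN γ hx
  exact this

theorem isHomogeneous_map {X Y : GrMod 𝒜} (f : X ⟶ Y) {N : Submodule A X}
    (hN : N.IsHomogeneous X.deg) : (N.map f.lin).IsHomogeneous Y.deg := by
  rintro γ _ ⟨x, hx, rfl⟩
  exact ⟨X.comp γ x, hN γ hx, (comp_map f γ x).symm⟩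

theorem isHomogeneous_top (X : GrMod 𝒜) : (⊤ : Submodule A X).IsHomogeneous X.deg :=
  fun _ _ _ => trivial

theorem isHomogeneous_iff {X : GrMod 𝒜} {N : Submodule A X} :
    N.IsHomogeneous X.deg ↔ ∀ γ, ∀ x ∈ N, X.comp γ x ∈ N :=
  ⟨fun h γ _ hx => h γ hx, fun h γ _ hx => h γ _ hx⟩

end GrMod

/-! ### Restriction along graded ring homomorphisms and shifts -/

namespace GrMod

variable {G : Type u} [AddCommGroup G] [DecidableEq G] {A B : Type u} [Ring A] [Ring B]
  {𝒜 : G → AddSubgroup A} {ℬ : G → AddSubgroup B}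

theorem preservesFinite_of_map_shortExact (U : GrMod ℬ ⥤ GrMod 𝒜) [U.Additive]
    (h : ∀ S : ShortComplex (GrMod ℬ), S.ShortExact → (S.map U).ShortExact) :
    PreservesFiniteLimits U ∧ PreservesFiniteColimits U :=
  ((Functor.exact_tfae U).out 0 3).mp h

/-- Restriction of scalars along a homomorphism of graded rings. -/
def res (φ : 𝒜 →+*ᵍ ℬ) : GrMod ℬ ⥤ GrMod 𝒜 where
  obj Y :=
    { carrier := Y
      module := Module.compHom Y φ.toRingHom
      deg := Y.deg
      isInternal := Y.isInternal
      smul_mem := fun ha hx => Y.smul_mem (φ.map_mem ha) hx }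
  map {Y Z} f := ⟨
    letI := Module.compHom Y φ.toRingHom
    letI := Module.compHom Z φ.toRingHom
    { toFun := f.lin
      map_add' := f.lin.map_add
      map_smul' := fun a y => f.lin.map_smul (φ a) y }, f.map_mem⟩

instance (φ : 𝒜 →+*ᵍ ℬ) : (res φ).Additive where

theorem res_shortExact (φ : 𝒜 →+*ᵍ ℬ) (S : ShortComplex (GrMod ℬ)) (hS : S.ShortExact) :
    (S.map (res φ)).ShortExact :=
  shortExact_mk (S := S.map (res φ)) (fun _ _ h => injective_f hS h) (fun y => surjective_g hS y)
    fun _ hy => exists_of_g_eq_zero hS hy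

instance (φ : 𝒜 →+*ᵍ ℬ) : PreservesFiniteLimits (res φ) :=
  (preservesFinite_of_map_shortExact _ (res_shortExact φ)).1

instance (φ : 𝒜 →+*ᵍ ℬ) : PreservesFiniteColimits (res φ) :=
  (preservesFinite_of_map_shortExact _ (res_shortExact φ)).2

/-- The shift by `α`, as a functor. -/
def shiftBy (𝒜 : G → AddSubgroup A) (α : G) : GrMod 𝒜 ⥤ GrMod 𝒜 where
  obj Y := Y.shift α
  map f := ⟨f.lin, f.map_mem⟩

instance (α : G) : (shiftBy 𝒜 α).Additive where

theorem shiftBy_shortExact (α : G) (S : ShortComplex (GrMod 𝒜)) (hS : S.ShortExact) :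
    (S.map (shiftBy 𝒜 α)).ShortExact :=
  shortExact_mk (S := S.map (shiftBy 𝒜 α)) (fun _ _ h => injective_f hS h)
    (fun y => surjective_g hS y) fun _ hy => exists_of_g_eq_zero hS hy

instance (α : G) : PreservesFiniteLimits (shiftBy 𝒜 α) :=
  (preservesFinite_of_map_shortExact _ (shiftBy_shortExact α)).1

instance (α : G) : PreservesFiniteColimits (shiftBy 𝒜 α) :=
  (preservesFinite_of_map_shortExact _ (shiftBy_shortExact α)).2

/-! ### Vanishing of graded Ext groups -/

section Vanish

variable [GradedRing 𝒜]

/-- All groups `Ext^i(M, A(γ))` vanish. This is the vanishing of `M.uExt i`, phrased without the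
direct sum over the degrees. -/
def ExtVanish (M : GrMod 𝒜) (i : ℕ) : Prop :=
  ∀ (γ : G) (x : Abelian.Ext.{u} M ((self 𝒜).shift γ) i), x = 0

theorem UExt.of_injective (M N : GrMod 𝒜) (i : ℕ) (γ : G) :
    Function.Injective (UExt.of M N i γ) :=
  Function.LeftInverse.injective (UExt.proj_of_same M N i γ)

theorem UExt.eq_zero_of_proj {M N : GrMod 𝒜} {i : ℕ} {x : UExt M N i}
    (h : ∀ γ, UExt.proj M N i γ x = 0) : x = 0 := by
  refine DFinsupp.ext (β := fun γ => Abelian.Ext.{u} M (N.shift γ) i) fun γ => h γ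

theorem extVanish_iff (M : GrMod 𝒜) (i : ℕ) : M.ExtVanish i ↔ Subsingleton (M.uExt i) := by
  constructor
  · intro h
    refine subsingleton_of_forall_eq 0 fun x => ?_
    exact UExt.eq_zero_of_proj fun γ => h γ _
  · intro h γ x
    exact UExt.of_injective M (self 𝒜) i γ (Subsingleton.elim (α := M.uExt i) _ _)

theorem le_grade_iff (M : GrMod 𝒜) (n : ℕ∞) :
    n ≤ M.grade ↔ ∀ i : ℕ, (i : ℕ∞) < n → M.ExtVanish i := by
  simp only [grade, le_iInf_iff, extVanish_iff]
  constructor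
  · intro h i hi
    rw [← not_nontrivial_iff_subsingleton]
    exact fun hn => absurd (h i hn) (not_le.2 hi)
  · intro h i hn
    by_contra hi
    exact not_nontrivial_iff_subsingleton.2 (h i (not_le.1 hi)) hn

variable {S : ShortComplex (GrMod 𝒜)}

theorem extVanish_mid (hS : S.ShortExact) {i : ℕ} (h₁ : S.X₁.ExtVanish i) (h₃ : S.X₃.ExtVanish i) :
    S.X₂.ExtVanish i := fun γ x => by
  obtain ⟨y, rfl⟩ := Abelian.Ext.contravariant_sequence_exact₂ hS _ x (h₁ γ _)
  rw [h₃ γ y, Abelian.Ext.comp_zero]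

theorem extVanish_right (hS : S.ShortExact) {i : ℕ} (h₁ : S.X₁.ExtVanish i)
    (h₂ : S.X₂.ExtVanish (i + 1)) : S.X₃.ExtVanish (i + 1) := fun γ x => by
  obtain ⟨y, rfl⟩ := Abelian.Ext.contravariant_sequence_exact₃ hS _ x (h₂ γ _) (add_comm 1 i)
  rw [h₁ γ y, Abelian.Ext.comp_zero]

theorem extVanish_right_zero (hS : S.ShortExact) (h₂ : S.X₂.ExtVanish 0) :
    S.X₃.ExtVanish 0 := fun γ x => by
  have := hS.epi_g
  exact Abelian.Ext.precomp_mk₀_injective_of_epi _ S.g ((h₂ γ _).trans (map_zero _).symm)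

theorem extVanish_of_projective (P : GrMod 𝒜) [Projective P] (i : ℕ) : P.ExtVanish (i + 1) :=
  fun _ x => x.eq_zero_of_projective

theorem extVanish_of_iso {X Y : GrMod 𝒜} (e : X ≅ Y) {i : ℕ} (h : X.ExtVanish i) :
    Y.ExtVanish i := fun γ x => by
  have h1 : (Abelian.Ext.mk₀ e.inv).comp ((Abelian.Ext.mk₀ e.hom).comp x (zero_add i))
      (zero_add i) = x := by
    rw [Abelian.Ext.mk₀_comp_mk₀_assoc, e.inv_hom_id, Abelian.Ext.mk₀_id_comp]
  rw [← h1, h γ ((Abelian.Ext.mk₀ e.hom).comp x (zero_add i)), Abelian.Ext.comp_zero]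

end Vanish

/-! ### Morphisms between graded Ext groups -/

section Pre

variable [GradedRing 𝒜]

/-- The inclusion of `Ext^i(M, A(γ))` into the graded right module `M.uExt i`. -/
def uof (M : GrMod 𝒜) (i : ℕ) (γ : G) : Abelian.Ext.{u} M ((self 𝒜).shift γ) i →+ M.uExt i :=
  UExt.of M (self 𝒜) i γ

/-- The additive map out of `M.uExt i` with given components. -/
def udesc {M : GrMod 𝒜} {i : ℕ} {X : Type u} [AddCommGroup X]
    (f : ∀ γ, Abelian.Ext.{u} M ((self 𝒜).shift γ) i →+ X) : M.uExt i →+ X :=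
  UExt.desc f

theorem udesc_uof {M : GrMod 𝒜} {i : ℕ} {X : Type u} [AddCommGroup X]
    (f : ∀ γ, Abelian.Ext.{u} M ((self 𝒜).shift γ) i →+ X) (γ : G)
    (x : Abelian.Ext.{u} M ((self 𝒜).shift γ) i) : udesc f (uof M i γ x) = f γ x :=
  UExt.desc_of f γ x

theorem uof_injective (M : GrMod 𝒜) (i : ℕ) (γ : G) : Function.Injective (uof M i γ) :=
  UExt.of_injective _ _ _ _

theorem uof_eq_zero {M : GrMod 𝒜} {i : ℕ} {γ : G} {x : Abelian.Ext.{u} M ((self 𝒜).shift γ) i} :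
    uof M i γ x = 0 ↔ x = 0 :=
  map_eq_zero_iff _ (uof_injective M i γ)

theorem mem_uExt_deg {M : GrMod 𝒜} {i : ℕ} {γ : G} {x : M.uExt i} :
    x ∈ (M.uExt i).deg γ ↔ ∃ y, uof M i γ y = x := Iff.rfl

theorem uof_mem (M : GrMod 𝒜) (i : ℕ) (γ : G) (y : Abelian.Ext.{u} M ((self 𝒜).shift γ) i) :
    uof M i γ y ∈ (M.uExt i).deg γ := ⟨y, rfl⟩

@[elab_as_elim]
theorem uExt_induction {M : GrMod 𝒜} {i : ℕ} {P : M.uExt i → Prop} (x : M.uExt i)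
    (zero : P 0) (of : ∀ γ x, P (uof M i γ x)) (add : ∀ x y, P x → P y → P (x + y)) : P x :=
  UExt.induction x zero of add

theorem op_smul_uof {M : GrMod 𝒜} {i : ℕ} {γ δ η : G} (h : γ + δ = η) {a : A} (ha : a ∈ 𝒜 δ)
    (x : Abelian.Ext.{u} M ((self 𝒜).shift γ) i) :
    MulOpposite.op a • uof M i γ x =
      uof M i η (x.comp (Abelian.Ext.mk₀ (rightMul 𝒜 γ η a)) (add_zero i)) :=
  extAct_of M i h ha x

/-- An additive map commutes with the ring action (through a map `σ` of rings) if it does so on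
homogeneous elements. -/
theorem map_smul_of_homogeneous {X : GrMod 𝒜} {Y : GrMod ℬ} (f : X →+ Y) (σ : A →+ B)
    (h : ∀ (δ γ : G), ∀ a ∈ 𝒜 δ, ∀ x ∈ X.deg γ, f (a • x) = σ a • f x) (a : A) (x : X) :
    f (a • x) = σ a • f x := by
  induction a using DirectSum.Decomposition.inductionOn 𝒜 with
  | zero => simp
  | add a a' h h' => rw [add_smul, map_add, map_add, add_smul, h, h']
  | @homogeneous δ a =>
    induction x using DirectSum.Decomposition.inductionOn X.deg with
    | zero => simp
    | add m m' h h' => rw [smul_add, map_add, map_add, smul_add, h, h']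
    | @homogeneous γ m => exact h δ γ _ a.2 _ m.2

/-- Precomposition with an extension class, as an additive map. -/
def uExtPreAux {X Y : GrMod 𝒜} {a i j : ℕ} (e : Abelian.Ext.{u} X Y a) (h : a + i = j) :
    Y.uExt i →+ X.uExt j :=
  udesc fun γ => (uof X j γ).comp (e.precomp _ h)

theorem uExtPreAux_uof {X Y : GrMod 𝒜} {a i j : ℕ} (e : Abelian.Ext.{u} X Y a) (h : a + i = j)
    (γ : G) (x : Abelian.Ext.{u} Y ((self 𝒜).shift γ) i) :
    uExtPreAux e h (uof Y i γ x) = uof X j γ (e.comp x h) :=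
  udesc_uof _ γ x

theorem uExtPreAux_smul {X Y : GrMod 𝒜} {a i j : ℕ} (e : Abelian.Ext.{u} X Y a) (h : a + i = j)
    (r : Aᵐᵒᵖ) (x : Y.uExt i) : uExtPreAux e h (r • x) = r • uExtPreAux e h x := by
  refine map_smul_of_homogeneous (uExtPreAux e h) (AddMonoidHom.id _) ?_ r x
  rintro δ γ a ha _ ⟨x, rfl⟩
  obtain ⟨a, rfl⟩ := MulOpposite.op_surjective a
  replace ha : a ∈ 𝒜 δ := ha
  change uExtPreAux e h (MulOpposite.op a • uof Y i γ x) =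
    MulOpposite.op a • uExtPreAux e h (uof Y i γ x)
  rw [op_smul_uof rfl ha, uExtPreAux_uof, uExtPreAux_uof, op_smul_uof rfl ha,
    Abelian.Ext.comp_assoc _ _ _ _ _ (by lia)]

/-- Precomposition with an extension class, as a morphism of graded right modules. -/
def uExtPre {X Y : GrMod 𝒜} {a i j : ℕ} (e : Abelian.Ext.{u} X Y a) (h : a + i = j) :
    Y.uExt i ⟶ X.uExt j :=
  ⟨{ uExtPreAux e h with map_smul' := uExtPreAux_smul e h }, by
    rintro γ _ ⟨x, rfl⟩
    exact ⟨_, (uExtPreAux_uof e h γ x).symm⟩⟩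

theorem uExtPre_uof {X Y : GrMod 𝒜} {a i j : ℕ} (e : Abelian.Ext.{u} X Y a) (h : a + i = j) (γ : G)
    (x : Abelian.Ext.{u} Y ((self 𝒜).shift γ) i) :
    (uExtPre e h).lin (uof Y i γ x) = uof X j γ (e.comp x h) :=
  uExtPreAux_uof e h γ x

/-- Exactness of maps between graded modules that raise degrees by `α` can be checked on
homogeneous elements. -/
theorem mem_range_of_homogeneous {A₁ A₂ A₃ : Type u} [Ring A₁] [Ring A₂] [Ring A₃]
    {𝒜₁ : G → AddSubgroup A₁} {𝒜₂ : G → AddSubgroup A₂} {𝒜₃ : G → AddSubgroup A₃}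
    {X : GrMod 𝒜₁} {Y : GrMod 𝒜₂} {Z : GrMod 𝒜₃} (f : X →+ Y) (g : Y →+ Z) (α : G)
    (hg : ∀ γ, ∀ y ∈ Y.deg γ, g y ∈ Z.deg (γ + α))
    (h : ∀ γ, ∀ y ∈ Y.deg γ, g y = 0 → ∃ x, f x = y) (y : Y) (hy : g y = 0) : ∃ x, f x = y := by
  have : y ∈ f.range := Y.mem_of_comp fun γ => h γ _ (Y.comp_mem γ y) (by
    rw [← comp_addHom g α hg, hy, map_zero])
  exact this

theorem uExtPre_exact {X Y Z : GrMod 𝒜} {a b i j k : ℕ} (e : Abelian.Ext.{u} X Y a)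
    (e' : Abelian.Ext.{u} Y Z b) (h : a + i = j) (h' : b + k = i)
    (hex : ∀ γ (x : Abelian.Ext.{u} Y ((self 𝒜).shift γ) i), e.comp x h = 0 →
      ∃ z, e'.comp z h' = x) (x : Y.uExt i) (hx : (uExtPre e h).lin x = 0) :
    ∃ z, (uExtPre e' h').lin z = x := by
  refine mem_range_of_homogeneous (uExtPre e' h').lin.toAddMonoidHom
    (uExtPre e h).lin.toAddMonoidHom 0 (fun γ y hy => ?_) ?_ x hx
  · rw [add_zero]; exact (uExtPre e h).map_mem hy
  · rintro γ _ ⟨y, rfl⟩ hy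
    have h1 : (uExtPre e h).lin (uof Y i γ y) = 0 := hy
    rw [uExtPre_uof] at h1
    obtain ⟨z, rfl⟩ := hex γ y (uof_eq_zero.1 h1)
    exact ⟨uof Z k γ z, uExtPre_uof _ _ _ _⟩

theorem uExtPre_injective {X Y : GrMod 𝒜} {a i j : ℕ} (e : Abelian.Ext.{u} X Y a)
    (h : a + i = j) (hinj : ∀ γ (x : Abelian.Ext.{u} Y ((self 𝒜).shift γ) i),
      e.comp x h = 0 → x = 0) : Function.Injective (uExtPre e h).lin := by
  rw [injective_iff_map_eq_zero]
  intro x hx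
  obtain ⟨z, hz⟩ := uExtPre_exact e (0 : Abelian.Ext.{u} Y Y 0) h (zero_add i)
    (fun γ x hx => ⟨0, by rw [Abelian.Ext.comp_zero, hinj γ x hx]⟩) x hx
  rw [← hz]
  clear hz hx
  induction z using uExt_induction with
  | zero => exact map_zero _
  | add x y hx hy => rw [map_add, hx, hy, add_zero]
  | of γ x => rw [uExtPre_uof, Abelian.Ext.zero_comp, map_zero]

theorem uExtPre_surjective {X Y : GrMod 𝒜} {a i j : ℕ} (e : Abelian.Ext.{u} X Y a)
    (h : a + i = j) (hsurj : ∀ γ (x : Abelian.Ext.{u} X ((self 𝒜).shift γ) j),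
      ∃ y, e.comp y h = x) : Function.Surjective (uExtPre e h).lin := fun x => by
  have : x ∈ (uExtPre e h).lin.range.toAddSubgroup := by
    induction x using uExt_induction with
    | zero => exact zero_mem _
    | add x y hx hy => exact add_mem hx hy
    | of γ x =>
      obtain ⟨y, rfl⟩ := hsurj γ x
      exact ⟨_, uExtPre_uof e h γ y⟩
  exact this

end Pre

end GrMod

namespace GrMod

variable {G : Type u} [AddCommGroup G] [DecidableEq G] {A : Type u} [Ring A]
  {𝒜 : G → AddSubgroup A}

/-! ### Noetherian graded modules -/

theorem IsGNoetherian.of_injective {X Y : GrMod 𝒜} (f : X ⟶ Y) (hf : Function.Injective f.lin)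
    (hY : Y.IsGNoetherian) : X.IsGNoetherian := fun _ hN =>
  Submodule.fg_of_fg_map_injective f.lin hf (hY _ (isHomogeneous_map f hN))

theorem IsGNoetherian.of_surjective {X Y : GrMod 𝒜} (f : X ⟶ Y) (hf : Function.Surjective f.lin)
    (hX : X.IsGNoetherian) : Y.IsGNoetherian := fun N hN => by
  rw [← Submodule.map_comap_eq_of_surjective hf N]
  exact (hX _ (isHomogeneous_comap f hN)).map _

theorem IsGNoetherian.finite {X : GrMod 𝒜} (hX : X.IsGNoetherian) : Module.Finite A X :=
  ⟨hX ⊤ (isHomogeneous_top X)⟩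

theorem IsGNoetherian.finite_sub {X : GrMod 𝒜} (hX : X.IsGNoetherian) (N : Submodule A X)
    (hN : N.IsHomogeneous X.deg) : Module.Finite A (X.sub N hN) :=
  Module.Finite.iff_fg.2 (hX N hN)

theorem shift_comp (X : GrMod 𝒜) (α γ : G) (x : X) :
    (X.shift α).comp γ x = X.comp (α + γ) x := by
  induction x using DirectSum.Decomposition.inductionOn X.deg with
  | zero => exact (map_zero ((X.shift α).comp γ)).trans (map_zero (X.comp (α + γ))).symm
  | add x y hx hy =>
    exact (map_add ((X.shift α).comp γ) x y).trans
      ((congrArg₂ (· + ·) hx hy).trans (map_add (X.comp (α + γ)) x y).symm)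
  | @homogeneous δ x =>
    have hx : (x : X) ∈ (X.shift α).deg (δ - α) := by
      change (x : X) ∈ X.deg (α + (δ - α))
      rw [add_sub_cancel]; exact x.2
    by_cases h : δ = α + γ
    · subst h
      rw [add_sub_cancel_left] at hx
      exact ((X.shift α).comp_same hx).trans (X.comp_same x.2).symm
    · refine ((X.shift α).comp_ne hx ?_).trans (X.comp_ne x.2 h).symm
      exact fun e => h (by rw [← e, add_sub_cancel])

theorem isHomogeneous_of_shift {X : GrMod 𝒜} {α : G} {N : Submodule A (X.shift α)}
    (hN : N.IsHomogeneous (X.shift α).deg) :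
    Submodule.IsHomogeneous (show Submodule A X from N) X.deg := by
  intro γ x hx
  have h1 : (X.shift α).comp (γ - α) x ∈ N := hN (γ - α) hx
  rw [shift_comp, add_sub_cancel] at h1
  exact h1

theorem exists_finset_homogeneous (X : GrMod 𝒜) [hX : Module.Finite A X] :
    ∃ s : Finset X, (∀ x ∈ s, ∃ δ, x ∈ X.deg δ) ∧ Submodule.span A (s : Set X) = ⊤ := by
  classical
  obtain ⟨t, ht⟩ := hX.fg_top
  refine ⟨t.biUnion fun x => (DirectSum.decompose X.deg x).support.image fun γ => X.comp γ x,
    fun y hy => ?_, ?_⟩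
  · obtain ⟨x, _, h⟩ := Finset.mem_biUnion.1 hy
    obtain ⟨γ, _, rfl⟩ := Finset.mem_image.1 h
    exact ⟨γ, X.comp_mem γ x⟩
  · rw [eq_top_iff, ← ht, Submodule.span_le]
    intro x hx
    rw [SetLike.mem_coe, ← DirectSum.sum_support_decompose X.deg x]
    exact sum_mem fun γ hγ => Submodule.subset_span (Finset.mem_coe.2 (Finset.mem_biUnion.2
      ⟨x, hx, Finset.mem_image.2 ⟨γ, hγ, rfl⟩⟩))

variable [GradedRing 𝒜]

theorem isHomogeneous_span (X : GrMod 𝒜) (s : Set X) (hs : ∀ x ∈ s, ∃ δ, x ∈ X.deg δ) :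
    (Submodule.span A s).IsHomogeneous X.deg := by
  choose d hd using hs
  have := isHomogeneous_range (freeDesc 𝒜 (fun x : s => d x x.2) (fun x => (x : X))
    fun x => hd x x.2)
  have h2 : LinearMap.range (freeDesc 𝒜 (fun x : s => d x x.2) (fun x => (x : X))
    fun x => hd x x.2).lin = Submodule.span A s := by
    refine (Finsupp.range_linearCombination A).trans ?_
    rw [Subtype.range_coe]
  rwa [h2] at this

/-- The morphism `A(-δ) ⟶ X` with `1 ↦ x`, for `x` homogeneous of degree `δ`. -/
def homOfElem {X : GrMod 𝒜} {δ : G} {x : X} (hx : x ∈ X.deg δ) : (self 𝒜).shift (-δ) ⟶ X :=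
  ⟨LinearMap.toSpanSingleton A X x, fun {γ a} ha => by
    have := X.smul_mem (a := a) ha hx
    rwa [neg_add_cancel_comm] at this⟩

/-- Induction on the number of generators, comparing `N` with its image in the cyclic quotient
`span (insert x s) / span s`. -/
theorem fg_of_le_span (hA : IsLeftGNoetherian 𝒜) (X : GrMod 𝒜) (s : Finset X)
    (hs : ∀ x ∈ s, ∃ δ, x ∈ X.deg δ) (N : Submodule A X) (hN : N.IsHomogeneous X.deg)
    (hle : N ≤ Submodule.span A s) : N.FG := by
  classical
  induction s using Finset.induction_on generalizing N with
  | empty =>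
    rw [Finset.coe_empty, Submodule.span_empty, le_bot_iff] at hle
    rw [hle]; exact Submodule.fg_bot
  | insert x s _ ih =>
    obtain ⟨δ, hx⟩ := hs x (Finset.mem_insert_self x s)
    have hs' : ∀ y ∈ s, ∃ δ, y ∈ X.deg δ := fun y hy => hs y (Finset.mem_insert_of_mem hy)
    have hsp := isHomogeneous_span X s hs'
    refine Submodule.fg_of_fg_map_of_fg_inf_ker (Submodule.span A (s : Set X)).mkQ ?_ ?_
    · let g := homOfElem hx ≫ X.quotπ _ hsp
      have hle' : N.map (X.quotπ _ hsp).lin ≤ LinearMap.range g.lin := by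
        rintro _ ⟨n, hn, rfl⟩
        have h1 := hle hn
        rw [Finset.coe_insert, Submodule.mem_span_insert] at h1
        obtain ⟨a, z, hz, rfl⟩ := h1
        refine ⟨a, ?_⟩
        refine (Submodule.Quotient.eq _).2 ?_
        have : (a • x - (a • x + z) : X) = -z := by abel
        exact this ▸ neg_mem hz
      have h2 := hA (show Submodule A (self 𝒜) from
        (N.map (X.quotπ _ hsp).lin).comap g.lin) (isHomogeneous_of_shift (X := self 𝒜)
          (isHomogeneous_comap g (isHomogeneous_map (X.quotπ _ hsp) hN)))
      have h3 : ((Submodule.comap g.lin (N.map (X.quotπ _ hsp).lin)).map g.lin).FG :=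
        Submodule.FG.map g.lin h2
      rwa [Submodule.map_comap_eq, inf_eq_right.2 hle'] at h3
    · rw [Submodule.ker_mkQ]
      refine ih hs' _ (isHomogeneous_iff.2 fun γ y hy => ?_) inf_le_right
      exact ⟨hN γ hy.1, hsp γ hy.2⟩

/-- Finitely generated graded modules over a noetherian graded ring are noetherian. -/
theorem isGNoetherian_of_finite (hA : IsLeftGNoetherian 𝒜) (X : GrMod 𝒜) [Module.Finite A X] :
    X.IsGNoetherian := fun N hN => by
  obtain ⟨s, hs, h⟩ := X.exists_finset_homogeneous
  exact fg_of_le_span hA X s hs N hN (h ▸ le_top)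

instance (ι : Type u) [Finite ι] (d : ι → G) : Module.Finite A (free 𝒜 d) :=
  inferInstanceAs (Module.Finite A (ι →₀ A))

variable (𝒜) in
theorem exists_free_cover (X : GrMod 𝒜) [Module.Finite A X] :
    ∃ (ι : Type u) (_ : Fintype ι) (d : ι → G) (p : free 𝒜 d ⟶ X), Function.Surjective p.lin := by
  obtain ⟨s, hs, h⟩ := X.exists_finset_homogeneous
  choose d hd using hs
  refine ⟨s, inferInstance, fun x => d x x.2, freeDesc 𝒜 _ (fun x => (x : X)) fun x => hd x x.2,
    LinearMap.range_eq_top.1 ?_⟩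
  refine (Finsupp.range_linearCombination A).trans ?_
  have hr : Set.range (fun x : s => (x : X)) = s := Subtype.range_coe
  rw [hr]
  exact h

/-! ### The evaluation pairing -/

/-- The evaluation of elements of `M.uExt 0`, the direct sum of the groups of morphisms
`M ⟶ A(γ)`, at elements of `M`; the degrees are forgotten. -/
def pairing (M : GrMod 𝒜) : M.uExt 0 →+ (M →ₗ[A] A) :=
  udesc fun γ => AddMonoidHom.mk' (fun x => (Abelian.Ext.addEquiv₀ x).lin) fun x y => by
    rw [map_add]; rfl

theorem pairing_mk₀ (M : GrMod 𝒜) {γ : G} (f : M ⟶ (self 𝒜).shift γ) (m : M) :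
    M.pairing (uof M 0 γ (Abelian.Ext.mk₀ f)) m = f.lin m := by
  rw [pairing, udesc_uof]
  have : Abelian.Ext.addEquiv₀ (Abelian.Ext.mk₀ f) = f := Abelian.Ext.addEquiv₀.apply_symm_apply f
  change (Abelian.Ext.addEquiv₀ (Abelian.Ext.mk₀ f)).lin m = f.lin m
  rw [this]

theorem pairing_mem (M : GrMod 𝒜) {γ δ : G} {x : M.uExt 0} (hx : x ∈ (M.uExt 0).deg γ) {m : M}
    (hm : m ∈ M.deg δ) : M.pairing x m ∈ 𝒜 (γ + δ) := by
  obtain ⟨x, rfl⟩ := hx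
  obtain ⟨f, rfl⟩ := (Abelian.Ext.mk₀_bijective _ _).2 x
  have h := M.pairing_mk₀ f m
  exact (congrArg (· ∈ 𝒜 (γ + δ)) h).mpr (f.map_mem hm)

theorem pairing_smul (M : GrMod 𝒜) (a : Aᵐᵒᵖ) (x : M.uExt 0) (m : M) :
    M.pairing (a • x) m = M.pairing x m * a.unop := by
  obtain ⟨a, rfl⟩ := MulOpposite.op_surjective a
  induction a using DirectSum.Decomposition.inductionOn 𝒜 with
  | zero => simp
  | add a a' h h' =>
    rw [MulOpposite.op_add, add_smul, map_add, LinearMap.add_apply, h, h', MulOpposite.unop_add,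
      mul_add]
  | @homogeneous δ a =>
    induction x using uExt_induction with
    | zero => simp
    | add x y hx hy =>
      rw [smul_add, map_add, map_add, LinearMap.add_apply, LinearMap.add_apply, hx, hy, add_mul]
    | of γ x =>
      obtain ⟨f, rfl⟩ := (Abelian.Ext.mk₀_bijective _ _).2 x
      rw [op_smul_uof rfl a.2, Abelian.Ext.mk₀_comp_mk₀, pairing_mk₀, pairing_mk₀, comp_lin]
      have h : GradedRing.proj 𝒜 (γ + δ - γ) (a : A) = a := by
        rw [add_sub_cancel_left]; exact DirectSum.decompose_of_mem_same 𝒜 a.2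
      change (show A from f.lin m) * GradedRing.proj 𝒜 (γ + δ - γ) (a : A) = _
      rw [h]; rfl

theorem pairing_pre {M N : GrMod 𝒜} (f : M ⟶ N) (x : N.uExt 0) (m : M) :
    M.pairing ((uExtPre (Abelian.Ext.mk₀ f) (zero_add 0)).lin x) m = N.pairing x (f.lin m) := by
  induction x using uExt_induction with
  | zero => simp
  | add x y hx hy =>
    rw [map_add, map_add, map_add, LinearMap.add_apply, LinearMap.add_apply, hx, hy]
  | of γ x =>
    obtain ⟨g, rfl⟩ := (Abelian.Ext.mk₀_bijective _ _).2 x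
    rw [uExtPre_uof, Abelian.Ext.mk₀_comp_mk₀, pairing_mk₀, pairing_mk₀, comp_lin]

theorem pairing_injective (M : GrMod 𝒜) : Function.Injective M.pairing := by
  rw [injective_iff_map_eq_zero]
  intro x hx
  refine (M.uExt 0).eq_zero_of_comp fun γ => ?_
  have h1 : ∀ m, M.pairing ((M.uExt 0).comp γ x) m = 0 := by
    intro m
    induction m using DirectSum.Decomposition.inductionOn M.deg with
    | zero => exact map_zero _
    | add m m' h h' => rw [map_add, h, h', add_zero]
    | @homogeneous δ m =>
      have := comp_addHom (X := M.uExt 0) (Y := self 𝒜)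
        (AddMonoidHom.mk' (fun y => M.pairing y (m : M)) fun y y' => by rw [map_add]; rfl) δ
        (fun γ y hy => M.pairing_mem hy m.2) γ x
      refine this.symm.trans ?_
      have h0 : M.pairing x (m : M) = 0 := by rw [hx]; rfl
      exact (congrArg ((self 𝒜).comp (γ + δ)) h0).trans (map_zero _)
  obtain ⟨y, hy⟩ := (M.uExt 0).comp_mem γ x
  obtain ⟨f, rfl⟩ := (Abelian.Ext.mk₀_bijective _ _).2 y
  have : f = 0 := hom_ext fun m => by
    rw [← pairing_mk₀]
    exact (congrArg (fun z => M.pairing z m) hy).trans (h1 m)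
  rw [← hy, this, Abelian.Ext.mk₀_zero]
  exact map_zero _

/-- The evaluation at an element of `M` of degree `δ`, a morphism from the right module
`Ext^0(M, A)` to `A(δ)`. -/
def evalHom (M : GrMod 𝒜) {δ : G} {m : M} (hm : m ∈ M.deg δ) :
    M.uExt 0 ⟶ (self (opGrading 𝒜)).shift δ :=
  ⟨{ toFun := fun x => MulOpposite.op (M.pairing x m)
     map_add' := fun x y => by rw [map_add]; rfl
     map_smul' := fun a x => by
      rw [pairing_smul, MulOpposite.op_mul, MulOpposite.op_unop]; rfl },
  fun {γ x} hx => by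
    have := M.pairing_mem hx hm
    rw [add_comm] at this
    exact this⟩

/-- The evaluations at homogeneous elements of `M` are elements of `Ext^0(Ext^0(M, A), A)` and
separate the elements of `Ext^0(M, A)`. -/
theorem extVanish_zero_of_dual {M : GrMod 𝒜} (h : (M.uExt 0).ExtVanish 0) : M.ExtVanish 0 := by
  rw [extVanish_iff]
  refine subsingleton_of_forall_eq 0 fun x => M.pairing_injective ?_
  rw [map_zero]
  refine LinearMap.ext fun m => ?_
  induction m using DirectSum.Decomposition.inductionOn M.deg with
  | zero => rw [map_zero, map_zero]
  | add m m' h h' => rw [map_add, h, h', map_add]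
  | @homogeneous δ m =>
    have h1 : M.evalHom m.2 = 0 := (Abelian.Ext.mk₀_eq_zero_iff _).1 (h δ _)
    exact MulOpposite.op_injective (lin_congr h1 x)

/-! ### Duals of free modules of finite rank -/

section FreeDual

variable {ι : Type u} (d : ι → G)

/-- The `i`-th coordinate of a free graded module, a morphism of degree `-d i`. -/
def coord (i : ι) : free 𝒜 d ⟶ (self 𝒜).shift (-d i) :=
  ⟨Finsupp.lapply i, fun {γ f} hf => by
    have := hf i
    rwa [sub_eq_neg_add] at this⟩

/-- The dual basis: the coordinates, as elements of the dual. -/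
def dualBasis (i : ι) : (free 𝒜 d).uExt 0 :=
  uof _ 0 (-d i) (Abelian.Ext.mk₀ (coord d i))

theorem pairing_dualBasis (i : ι) (f : free 𝒜 d) :
    (free 𝒜 d).pairing (dualBasis d i) f = (show ι →₀ A from f) i :=
  pairing_mk₀ _ _ _

/-- The basis vectors of a free graded module. -/
def stdBasis (i : ι) : free 𝒜 d := Finsupp.single i (1 : A)

theorem dualBasis_mem (i : ι) : dualBasis (𝒜 := 𝒜) d i ∈ ((free 𝒜 d).uExt 0).deg (-d i) :=
  uof_mem _ _ _ _

theorem pairing_dualBasis_stdBasis [DecidableEq ι] (i j : ι) :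
    (free 𝒜 d).pairing (dualBasis d i) (stdBasis d j) = if j = i then 1 else 0 := by
  rw [pairing_dualBasis]
  exact Finsupp.single_apply

variable [Fintype ι]

theorem free_eq_sum (f : free 𝒜 d) :
    f = ∑ i, (show ι →₀ A from f) i • stdBasis (𝒜 := 𝒜) d i := by
  classical
  refine (Finsupp.univ_sum_single (show ι →₀ A from f)).symm.trans ?_
  refine Finset.sum_congr rfl fun i _ => ?_
  refine Eq.trans ?_ (Finsupp.smul_single _ _ _).symm
  rw [smul_eq_mul, mul_one]

theorem sum_dualBasis (x : (free 𝒜 d).uExt 0) :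
    x = ∑ i, MulOpposite.op ((free 𝒜 d).pairing x (stdBasis d i)) • dualBasis d i := by
  refine pairing_injective _ (LinearMap.ext fun f => ?_)
  rw [map_sum, LinearMap.sum_apply]
  conv_lhs => rw [free_eq_sum d f, map_sum]
  refine Finset.sum_congr rfl fun i _ => ?_
  rw [map_smul, pairing_smul, pairing_dualBasis, MulOpposite.unop_op, smul_eq_mul]

/-- The morphism from the free graded right module on the dual basis to the dual of a free graded
module. It is an isomorphism if the rank is finite. -/
def dualFree : free (opGrading 𝒜) (fun i => -d i) ⟶ (free 𝒜 d).uExt 0 :=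
  freeDesc (opGrading 𝒜) _ (dualBasis d) (dualBasis_mem d)

theorem dualFree_apply (f : free (opGrading 𝒜) (fun i => -d i)) :
    (dualFree d).lin f = ∑ i, (show ι →₀ Aᵐᵒᵖ from f) i • dualBasis (𝒜 := 𝒜) d i :=
  (Finsupp.linearCombination_apply Aᵐᵒᵖ (v := dualBasis (𝒜 := 𝒜) d) f).trans
    (Finsupp.sum_fintype _ _ fun _ => zero_smul _ _)

theorem dualFree_bijective : Function.Bijective (dualFree (𝒜 := 𝒜) d).lin := by
  classical
  constructor
  · rw [injective_iff_map_eq_zero]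
    intro f hf
    rw [dualFree_apply] at hf
    refine Finsupp.ext fun j => MulOpposite.unop_injective ?_
    have := congrArg (fun x => (free 𝒜 d).pairing x (stdBasis d j)) hf
    simp only [map_sum, LinearMap.sum_apply, pairing_smul, pairing_dualBasis_stdBasis, ite_mul,
      one_mul, zero_mul, Finset.sum_ite_eq, Finset.mem_univ, if_true, map_zero] at this
    exact this
  · intro x
    refine ⟨Finsupp.equivFunOnFinite.symm fun i =>
      MulOpposite.op ((free 𝒜 d).pairing x (stdBasis d i)), ?_⟩
    exact (dualFree_apply d _).trans (sum_dualBasis d x).symm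

instance : Projective ((free 𝒜 d).uExt 0) :=
  Projective.of_iso (isoOfBijective _ (dualFree_bijective d)) inferInstance

instance : Module.Finite Aᵐᵒᵖ ((free 𝒜 d).uExt 0) :=
  Module.Finite.of_surjective (dualFree d).lin (dualFree_bijective d).2

end FreeDual

end GrMod

namespace GrMod

variable {G : Type u} [AddCommGroup G] [DecidableEq G] {A : Type u} [Ring A]
  {𝒜 : G → AddSubgroup A}

/-! ### Long exact sequences of graded Ext groups -/

section LES

variable [GradedRing 𝒜]

/-- The map of graded Ext groups induced by a morphism. -/
abbrev uExtMap {X Y : GrMod 𝒜} (f : X ⟶ Y) (i : ℕ) : Y.uExt i ⟶ X.uExt i :=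
  uExtPre (Abelian.Ext.mk₀ f) (zero_add i)

/-- The connecting morphism of graded Ext groups of a short exact sequence. -/
abbrev uExtδ {S : ShortComplex (GrMod 𝒜)} (hS : S.ShortExact) (i : ℕ) :
    S.X₁.uExt i ⟶ S.X₃.uExt (i + 1) :=
  uExtPre hS.extClass (add_comm 1 i)

theorem uExtPre_comp_apply {X Y Z : GrMod 𝒜} {a b c i j k : ℕ} (e : Abelian.Ext.{u} X Y a)
    (e' : Abelian.Ext.{u} Y Z b) (hab : a + b = c) (h : a + i = j) (h' : b + k = i)
    (x : Z.uExt k) :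
    (uExtPre e h).lin ((uExtPre e' h').lin x) =
      (uExtPre (e.comp e' hab) (by omega : c + k = j)).lin x := by
  induction x using uExt_induction with
  | zero => simp
  | add x y hx hy => simp only [map_add, hx, hy]
  | of γ x => rw [uExtPre_uof, uExtPre_uof, uExtPre_uof, Abelian.Ext.comp_assoc _ _ _ _ _ (by lia)]

theorem uExtPre_zero_apply {X Y : GrMod 𝒜} {a i j : ℕ} (h : a + i = j) (x : Y.uExt i) :
    (uExtPre (0 : Abelian.Ext.{u} X Y a) h).lin x = 0 := by
  induction x using uExt_induction with
  | zero => simp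
  | add x y hx hy => rw [map_add, hx, hy, add_zero]
  | of γ x => rw [uExtPre_uof, Abelian.Ext.zero_comp, map_zero]

theorem uExtMap_zero_apply {X Y : GrMod 𝒜} (i : ℕ) (x : Y.uExt i) :
    (uExtMap (0 : X ⟶ Y) i).lin x = 0 := by
  have h : Abelian.Ext.mk₀ (0 : X ⟶ Y) = 0 := Abelian.Ext.mk₀_zero X Y
  rw [uExtMap, h, uExtPre_zero_apply]

theorem uExtMap_comp_apply {X Y Z : GrMod 𝒜} (f : X ⟶ Y) (g : Y ⟶ Z) (i : ℕ) (x : Z.uExt i) :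
    (uExtMap f i).lin ((uExtMap g i).lin x) = (uExtMap (f ≫ g) i).lin x := by
  rw [uExtPre_comp_apply _ _ (zero_add 0)]
  simp only [Abelian.Ext.mk₀_comp_mk₀]

variable {S : ShortComplex (GrMod 𝒜)}

theorem uExtδ_surjective (hS : S.ShortExact) {i : ℕ} (h : S.X₂.ExtVanish (i + 1)) :
    Function.Surjective (uExtδ hS i).lin :=
  uExtPre_surjective _ _ fun γ x =>
    Abelian.Ext.contravariant_sequence_exact₃ hS _ x (h γ _) (add_comm 1 i)

theorem uExtδ_injective (hS : S.ShortExact) {i : ℕ} (h : S.X₂.ExtVanish i) :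
    Function.Injective (uExtδ hS i).lin :=
  uExtPre_injective _ _ fun γ x hx => by
    obtain ⟨y, rfl⟩ := Abelian.Ext.contravariant_sequence_exact₁ hS _ x (add_comm 1 i) hx
    rw [h γ y, Abelian.Ext.comp_zero]

theorem uExtδ_exact (hS : S.ShortExact) (i : ℕ) (x : S.X₁.uExt i) (hx : (uExtδ hS i).lin x = 0) :
    ∃ y, (uExtMap S.f i).lin y = x :=
  uExtPre_exact _ _ _ _ (fun _ x hx => Abelian.Ext.contravariant_sequence_exact₁ hS _ x _ hx) x hx

theorem uExtδ_map (hS : S.ShortExact) (i : ℕ) (x : S.X₂.uExt i) :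
    (uExtδ hS i).lin ((uExtMap S.f i).lin x) = 0 := by
  rw [uExtPre_comp_apply _ _ (add_zero 1), hS.extClass_comp, uExtPre_zero_apply]

theorem uExtMap_exact (hS : S.ShortExact) (i : ℕ) (x : S.X₂.uExt i)
    (hx : (uExtMap S.f i).lin x = 0) : ∃ y, (uExtMap S.g i).lin y = x :=
  uExtPre_exact _ _ _ _ (fun _ x hx => Abelian.Ext.contravariant_sequence_exact₂ hS _ x hx) x hx

theorem uExtMap_zero_injective {X Y : GrMod 𝒜} (f : X ⟶ Y) (hf : Function.Surjective f.lin) :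
    Function.Injective (uExtMap f 0).lin :=
  uExtPre_injective _ _ fun γ x hx => by
    have := epi_of_surjective f hf
    exact Abelian.Ext.precomp_mk₀_injective_of_epi _ f (hx.trans (map_zero _).symm)

/-- Dimension shifting. -/
theorem nonempty_uExt_iso (hS : S.ShortExact) (i : ℕ) (h : S.X₂.ExtVanish i)
    (h' : S.X₂.ExtVanish (i + 1)) : Nonempty (S.X₁.uExt i ≅ S.X₃.uExt (i + 1)) :=
  ⟨isoOfBijective (uExtδ hS i) ⟨uExtδ_injective hS h, uExtδ_surjective hS h'⟩⟩

/-- Over a noetherian graded ring, the graded Ext groups of finitely generated modules are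
noetherian. -/
theorem isGNoetherian_uExt (hl : IsLeftGNoetherian 𝒜) (hr : IsRightGNoetherian 𝒜) (i : ℕ)
    (M : GrMod 𝒜) [Module.Finite A M] : (M.uExt i).IsGNoetherian := by
  induction i generalizing M with
  | zero =>
    obtain ⟨ι, _, d, p, hp⟩ := exists_free_cover 𝒜 M
    exact IsGNoetherian.of_injective _ (uExtMap_zero_injective p hp)
      (isGNoetherian_of_finite hr ((free 𝒜 d).uExt 0))
  | succ i ih =>
    obtain ⟨ι, _, d, p, hp⟩ := exists_free_cover 𝒜 M
    have hK : Module.Finite A (kerComplex p).X₁ :=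
      (isGNoetherian_of_finite hl (free 𝒜 d)).finite_sub _ (isHomogeneous_ker p)
    exact IsGNoetherian.of_surjective _ (uExtδ_surjective (kerComplex_shortExact p hp)
      (extVanish_of_projective (free 𝒜 d) i)) (ih (kerComplex p).X₁)

end LES

/-! ### Transport of Ext groups along isomorphisms of graded rings -/

section Transport

variable {B : Type u} [Ring B] {ℬ : G → AddSubgroup B}

/-- An isomorphism of graded rings, given by mutually inverse homomorphisms. -/
structure GrRingIso (𝒜 : G → AddSubgroup A) (ℬ : G → AddSubgroup B) where
  hom : 𝒜 →+*ᵍ ℬ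
  inv : ℬ →+*ᵍ 𝒜
  hom_inv : ∀ a, inv (hom a) = a
  inv_hom : ∀ b, hom (inv b) = b

/-- The inverse isomorphism. -/
def GrRingIso.symm (φ : GrRingIso 𝒜 ℬ) : GrRingIso ℬ 𝒜 := ⟨φ.inv, φ.hom, φ.inv_hom, φ.hom_inv⟩

/-- Restriction along an isomorphism of graded rings followed by a shift of degrees. -/
abbrev resShift (φ : GrRingIso 𝒜 ℬ) (α : G) : GrMod ℬ ⥤ GrMod 𝒜 := res φ.hom ⋙ shiftBy 𝒜 α

/-- A morphism between restrictions along an isomorphism of graded rings comes from a morphism of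
the original modules. -/
def unresHom (φ : GrRingIso 𝒜 ℬ) (α : G) {X Y : GrMod ℬ}
    (f : (resShift φ α).obj X ⟶ (resShift φ α).obj Y) : X ⟶ Y :=
  ⟨{ toFun := fun x => f.lin x
     map_add' := fun x y => f.lin.map_add x y
     map_smul' := fun b x => by
      have := f.lin.map_smul (φ.inv b) x
      have h : φ.hom (φ.inv b) = b := φ.inv_hom b
      change f.lin (φ.hom (φ.inv b) • (show X from x)) =
        (φ.hom (φ.inv b) • (show Y from f.lin x) : Y) at this
      rw [h] at this
      exact this },
    fun {γ x} hx => by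
      have h := f.map_mem (γ := γ - α) (x := x) (by
        change x ∈ X.deg (α + (γ - α))
        rwa [add_sub_cancel])
      change f.lin x ∈ Y.deg (α + (γ - α)) at h
      rwa [add_sub_cancel] at h⟩

/-- Morphisms out of a restriction are morphisms into the restriction along the inverse. -/
def resShiftAdj (φ : GrRingIso 𝒜 ℬ) (α : G) {P : GrMod ℬ} {X : GrMod 𝒜}
    (f : (resShift φ α).obj P ⟶ X) : P ⟶ (resShift φ.symm (-α)).obj X :=
  ⟨{ toFun := fun x => f.lin x
     map_add' := fun x y => f.lin.map_add x y
     map_smul' := fun b x => by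
      have := f.lin.map_smul (φ.inv b) x
      have h : φ.hom (φ.inv b) = b := φ.inv_hom b
      change f.lin (φ.hom (φ.inv b) • (show P from x)) = φ.inv b • f.lin x at this
      rw [h] at this
      exact this },
    fun {γ x} hx => by
      have h := f.map_mem (γ := γ - α) (x := x) (by
        change x ∈ P.deg (α + (γ - α))
        rwa [add_sub_cancel])
      rwa [sub_eq_neg_add] at h⟩

/-- The inverse of `resShiftAdj`. -/
def resShiftAdjInv (φ : GrRingIso 𝒜 ℬ) (α : G) {P : GrMod ℬ} {X : GrMod 𝒜}
    (f : P ⟶ (resShift φ.symm (-α)).obj X) : (resShift φ α).obj P ⟶ X :=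
  ⟨{ toFun := fun x => f.lin x
     map_add' := fun x y => f.lin.map_add x y
     map_smul' := fun a x => by
      have := f.lin.map_smul (φ.hom a) x
      have h : φ.inv (φ.hom a) = a := φ.hom_inv a
      change f.lin (φ.hom a • (show P from x)) = φ.inv (φ.hom a) • (show X from f.lin x) at this
      rw [h] at this
      exact this },
    fun {γ x} hx => by
      have h := f.map_mem (γ := α + γ) (x := x) hx
      change f.lin x ∈ X.deg (-α + (α + γ)) at h
      rwa [neg_add_cancel_left] at h⟩

instance (φ : GrRingIso 𝒜 ℬ) (α : G) {P : GrMod ℬ} [Projective P] :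
    Projective ((resShift φ α).obj P) where
  factors {E X} f e _ := by
    have : Epi ((resShift φ.symm (-α)).map e) :=
      epi_of_surjective _ fun x => surjective_of_epi e x
    refine ⟨resShiftAdjInv φ α (Projective.factorThru (resShiftAdj φ α f)
      ((resShift φ.symm (-α)).map e)), hom_ext fun x => ?_⟩
    exact lin_congr (Projective.factorThru_comp (resShiftAdj φ α f)
      ((resShift φ.symm (-α)).map e)) x

variable [GradedRing 𝒜] [GradedRing ℬ]

/-- Ext groups are invariant under restriction along an isomorphism of graded rings and shifts of
degrees, which transport projective modules to projective modules. -/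
theorem resShift_comparison (φ : GrRingIso 𝒜 ℬ) (α : G) (i : ℕ) {X : GrMod 𝒜} {X' : GrMod ℬ}
    (u : X ⟶ (resShift φ α).obj X') (hu : Function.Bijective u.lin) (N : GrMod ℬ) :
    Function.Bijective (extComparison.{u} (resShift φ α) u N i) := by
  refine extComparison_bijective (resShift φ α) (fun X X' u => Function.Bijective u.lin)
    (fun {X X' u} hu N => ⟨fun f g h => hom_ext fun x => ?_, fun g => ?_⟩) ?_ i hu N
  · obtain ⟨x, rfl⟩ := hu.2 x
    exact lin_congr h x
  · refine ⟨unresHom φ α ((isoOfBijective u hu).inv ≫ g), hom_ext fun x => ?_⟩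
    exact lin_congr (Iso.hom_inv_id_assoc (isoOfBijective u hu) g) x
  · intro X X' u hu
    have hS' := kerComplex_shortExact (Projective.π X') (surjective_of_epi _)
    let e := isoOfBijective u hu
    have he := iso_bijective e.symm
    refine ⟨{
      i := (resShift φ α).map (kerComplex (Projective.π X')).f
      p := (resShift φ α).map (Projective.π X') ≫ e.inv
      i' := (kerComplex (Projective.π X')).f
      p' := Projective.π X'
      w := ?_
      w' := (kerComplex (Projective.π X')).zero
      exact := ?_
      exact' := hS'
      proj := (inferInstance : Projective ((resShift φ α).obj (Projective.over X')))
      proj' := (inferInstance : Projective (Projective.over X'))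
      v := 𝟙 _
      q := 𝟙 _
      comm₁ := ?_
      comm₂ := ?_
      rel_left := Function.bijective_id
      rel_mid := Function.bijective_id }⟩
    · exact hom_ext fun x => (congrArg e.inv.lin
        (g_f_apply (kerComplex (Projective.π X')) x)).trans (map_zero _)
    · refine shortExact_mk (fun x y h => injective_f hS' h)
        (fun x => ?_) (fun y hy => exists_of_g_eq_zero hS' (he.1 (hy.trans (map_zero _).symm)))
      obtain ⟨x, rfl⟩ := he.2 x
      obtain ⟨y, rfl⟩ := surjective_of_epi (Projective.π X') x
      exact ⟨y, rfl⟩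
    · rw [Category.id_comp, Category.comp_id]
    · rw [Category.id_comp, Category.assoc]
      exact (Category.comp_id _).symm.trans (congrArg _ e.inv_hom_id.symm)

/-- The regular module transports along isomorphisms of graded rings. -/
def selfIso (φ : GrRingIso 𝒜 ℬ) (α γ : G) :
    (self 𝒜).shift γ ≅ (resShift φ α).obj ((self ℬ).shift (γ - α)) :=
  isoOfBijective ⟨{
    toFun := fun a => φ.hom a
    map_add' := fun a b => map_add φ.hom a b
    map_smul' := fun a b => map_mul φ.hom a b }, fun {η a} ha => by
      have : φ.hom a ∈ ℬ (γ + η) := φ.hom.map_mem ha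
      change φ.hom a ∈ ℬ (γ - α + (α + η))
      rwa [show γ - α + (α + η) = γ + η by abel]⟩
    ⟨Function.LeftInverse.injective φ.hom_inv, Function.RightInverse.surjective φ.inv_hom⟩

/-- A bijection `X → X'` that is semilinear for an isomorphism of graded rings and shifts degrees
by `α` transports the vanishing of graded Ext groups. -/
theorem extVanish_of_semilinear (φ : GrRingIso 𝒜 ℬ) (α : G) {i : ℕ} {X : GrMod 𝒜} {X' : GrMod ℬ}
    (u : X ⟶ (resShift φ α).obj X') (hu : Function.Bijective u.lin) (h : X'.ExtVanish i) :
    X.ExtVanish i := fun γ x => by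
  let e := selfIso φ α γ
  have h1 : (x.comp (Abelian.Ext.mk₀ e.hom) (add_zero i)).comp (Abelian.Ext.mk₀ e.inv)
      (add_zero i) = x := by
    rw [Abelian.Ext.comp_assoc_of_third_deg_zero, Abelian.Ext.mk₀_comp_mk₀, e.hom_inv_id,
      Abelian.Ext.comp_mk₀_id]
  obtain ⟨y, hy⟩ := (resShift_comparison φ α i u hu ((self ℬ).shift (γ - α))).2
    (x.comp (Abelian.Ext.mk₀ e.hom) (add_zero i))
  rw [h _ y, map_zero] at hy
  rw [← h1, ← hy, Abelian.Ext.zero_comp]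

end Transport

end GrMod

namespace GrMod

variable {G : Type u} [AddCommGroup G] [DecidableEq G] {A : Type u} [Ring A]
  {𝒜 : G → AddSubgroup A}

/-! ### Biduality -/

/-- The isomorphism of a graded ring with its double opposite. -/
def opOpIso (𝒜 : G → AddSubgroup A) : GrRingIso 𝒜 (opGrading (opGrading 𝒜)) where
  hom :=
    { toFun := fun a => MulOpposite.op (MulOpposite.op a)
      map_one' := rfl
      map_mul' := fun _ _ => rfl
      map_zero' := rfl
      map_add' := fun _ _ => rfl
      map_mem := fun h => h }
  inv :=
    { toFun := fun a => a.unop.unop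
      map_one' := rfl
      map_mul' := fun _ _ => rfl
      map_zero' := rfl
      map_add' := fun _ _ => rfl
      map_mem := fun h => h }
  hom_inv _ := rfl
  inv_hom _ := rfl

/-- Graded modules over the double opposite, as graded modules over the original ring. -/
abbrev unopop (𝒜 : G → AddSubgroup A) : GrMod (opGrading (opGrading 𝒜)) ⥤ GrMod 𝒜 :=
  resShift (opOpIso 𝒜) 0

variable [GradedRing 𝒜]

section Bidual

variable {ι : Type u} (d : ι → G)

theorem stdBasis_mem (i : ι) : stdBasis (𝒜 := 𝒜) d i ∈ (free 𝒜 d).deg (d i) :=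
  single_mem_free 𝒜 d i

/-- The evaluation map of a free graded module into its double dual. -/
def bidual : free 𝒜 d ⟶ (unopop 𝒜).obj (((free 𝒜 d).uExt 0).uExt 0) :=
  freeDesc 𝒜 d (X := (unopop 𝒜).obj (((free 𝒜 d).uExt 0).uExt 0))
    (fun i => uof ((free 𝒜 d).uExt 0) 0 (d i)
      (Abelian.Ext.mk₀ (evalHom (free 𝒜 d) (stdBasis_mem d i))))
    (fun i => by
      change _ ∈ (((free 𝒜 d).uExt 0).uExt 0).deg (0 + d i)
      rw [zero_add]
      exact uof_mem _ _ _ _)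

variable [Fintype ι]

theorem pairing_bidual (p : free 𝒜 d) (x : (free 𝒜 d).uExt 0) :
    ((free 𝒜 d).uExt 0).pairing ((bidual d).lin p) x =
      MulOpposite.op ((free 𝒜 d).pairing x p) := by
  have h1 : (bidual d).lin p = ∑ i, (MulOpposite.op (MulOpposite.op ((show ι →₀ A from p) i)) •
      uof ((free 𝒜 d).uExt 0) 0 (d i)
        (Abelian.Ext.mk₀ (evalHom (free 𝒜 d) (stdBasis_mem d i))) :
        ((free 𝒜 d).uExt 0).uExt 0) :=
    (Finsupp.linearCombination_apply A p).trans (Finsupp.sum_fintype _ _ fun _ => zero_smul A _)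
  rw [h1, map_sum, LinearMap.sum_apply]
  conv_rhs => rw [free_eq_sum d p, map_sum, Finset.op_sum]
  refine Finset.sum_congr rfl fun i _ => ?_
  rw [pairing_smul, pairing_mk₀, map_smul, smul_eq_mul, MulOpposite.op_mul, MulOpposite.unop_op]
  rfl

theorem bidual_bijective : Function.Bijective (bidual (𝒜 := 𝒜) d).lin := by
  constructor
  · rw [injective_iff_map_eq_zero]
    intro p hp
    refine Finsupp.ext fun i => ?_
    have h1 := pairing_bidual d p (dualBasis d i)
    have h2 : ((free 𝒜 d).uExt 0).pairing ((bidual d).lin p) (dualBasis d i) = 0 := by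
      have : ((free 𝒜 d).uExt 0).pairing ((bidual d).lin p) = 0 :=
        (congrArg ((free 𝒜 d).uExt 0).pairing hp).trans (map_zero _)
      rw [this]; rfl
    rw [h2, pairing_dualBasis] at h1
    exact MulOpposite.op_injective h1.symm
  · intro y
    let y' : ((free 𝒜 d).uExt 0).uExt 0 := y
    let p : free 𝒜 d := (Finsupp.equivFunOnFinite.symm fun i =>
      (((free 𝒜 d).uExt 0).pairing y' (dualBasis d i)).unop : ι →₀ A)
    have hp : ∀ i, (show ι →₀ A from p) i =
      (((free 𝒜 d).uExt 0).pairing y' (dualBasis d i)).unop := fun i => rfl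
    refine ⟨p, ((free 𝒜 d).uExt 0).pairing_injective (LinearMap.ext fun x => ?_)⟩
    rw [pairing_bidual]
    change _ = ((free 𝒜 d).uExt 0).pairing y' x
    conv_lhs => rw [free_eq_sum d p, map_sum, Finset.op_sum]
    conv_rhs => rw [sum_dualBasis d x, map_sum]
    refine Finset.sum_congr rfl fun i _ => ?_
    rw [map_smul, map_smul, hp, smul_eq_mul, smul_eq_mul, MulOpposite.op_mul, MulOpposite.op_unop]

theorem bidual_naturality {κ : Type u} [Fintype κ] {e : κ → G} (f : free 𝒜 e ⟶ free 𝒜 d)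
    (p : free 𝒜 e) : (uExtMap (uExtMap f 0) 0).lin ((bidual e).lin p) =
      (bidual d).lin (f.lin p) := by
  refine ((free 𝒜 d).uExt 0).pairing_injective (LinearMap.ext fun x => ?_)
  refine (pairing_pre (uExtMap f 0) ((bidual e).lin p) x).trans ?_
  refine (pairing_bidual e p _).trans ?_
  refine Eq.trans ?_ (pairing_bidual d (f.lin p) x).symm
  exact congrArg MulOpposite.op (pairing_pre f x p)

end Bidual

/-! ### Transposes -/

/-- The transpose of a morphism `f : P₁ ⟶ P₀`, the cokernel of its dual
`Ext^0(P₀, A) ⟶ Ext^0(P₁, A)`. -/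
def tr {P₁ P₀ : GrMod 𝒜} (f : P₁ ⟶ P₀) : GrMod (opGrading 𝒜) :=
  (P₁.uExt 0).quot _ (isHomogeneous_range (uExtMap f 0))

/-- A presentation of a graded module by free modules of finite rank. The second generating family
is that of the kernel of `p₀`, so that it also starts a presentation of this syzygy. -/
structure Presentation (K : GrMod 𝒜) where
  {ι₀ : Type u}
  {ι₁ : Type u}
  [fin₀ : Fintype ι₀]
  [fin₁ : Fintype ι₁]
  {d₀ : ι₀ → G}
  {d₁ : ι₁ → G}
  (p₀ : free 𝒜 d₀ ⟶ K)
  (p₁ : free 𝒜 d₁ ⟶ (kerComplex p₀).X₁)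
  surj₀ : Function.Surjective p₀.lin
  surj₁ : Function.Surjective p₁.lin

namespace Presentation

attribute [instance] fin₀ fin₁

variable {K : GrMod 𝒜} (p : Presentation K)

/-- The morphism between free modules of which `K` is the cokernel. -/
abbrev map : free 𝒜 p.d₁ ⟶ free 𝒜 p.d₀ := p.p₁ ≫ (kerComplex p.p₀).f

theorem ker_eq (x : free 𝒜 p.d₀) : p.p₀.lin x = 0 ↔ ∃ y, p.map.lin y = x := by
  constructor
  · intro h
    obtain ⟨y, hy⟩ := p.surj₁ ⟨x, h⟩
    exact ⟨y, congrArg Subtype.val hy⟩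
  · rintro ⟨y, rfl⟩
    exact (p.p₁.lin y).2

/-- The dual of the presentation, with the transpose as cokernel. It is short exact if
`Ext^0(K, A) = 0`. -/
abbrev trComplex : ShortComplex (GrMod (opGrading 𝒜)) :=
  ShortComplex.mk (uExtMap p.map 0) ((uExt _ 0).quotπ _ (isHomogeneous_range (uExtMap p.map 0)))
    (comp_quotπ_range _)

theorem trComplex_shortExact (hK : K.ExtVanish 0) : p.trComplex.ShortExact := by
  refine shortExact_mk ?_ (Submodule.mkQ_surjective _) fun y hy =>
    (Submodule.Quotient.mk_eq_zero _).1 hy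
  refine (injective_iff_map_eq_zero (uExtMap p.map 0).lin).2 fun x hx => ?_
  obtain ⟨y, rfl⟩ := uExtMap_exact (kerComplex_shortExact p.p₀ p.surj₀) 0 x (by
    refine uExtMap_zero_injective p.p₁ p.surj₁
      ((uExtMap_comp_apply p.p₁ (kerComplex p.p₀).f 0 x).trans (hx.trans (map_zero _).symm)))
  have := (extVanish_iff K 0).1 hK
  rw [Subsingleton.elim (α := K.uExt 0) y 0]
  exact map_zero _

/-- A module `K` with `Ext^0(K, A) = 0` is `Ext^1` of its transpose: the dual of a presentation of
`K` is then a free resolution of the transpose, and dualizing it again returns the presentation. -/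
theorem nonempty_iso_tr (hK : K.ExtVanish 0) :
    Nonempty (K ≅ (unopop 𝒜).obj ((tr p.map).uExt 1)) := by
  have hS := p.trComplex_shortExact hK
  refine nonempty_iso_of_ker_eq p.p₀ (bidual p.d₀ ≫ (unopop 𝒜).map (uExtδ hS 0)) p.surj₀ ?_
    fun x => ?_
  · intro y
    obtain ⟨z, rfl⟩ := uExtδ_surjective hS
      (extVanish_of_projective ((free 𝒜 p.d₁).uExt 0) 0) y
    obtain ⟨w, rfl⟩ := (bidual_bijective p.d₀).2 z
    exact ⟨w, rfl⟩
  · rw [p.ker_eq]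
    constructor
    · rintro ⟨y, rfl⟩
      refine Eq.trans ?_ (uExtδ_map hS 0 ((bidual p.d₁).lin y))
      exact congrArg (uExtδ hS 0).lin (bidual_naturality p.d₀ p.map y).symm
    · intro h
      obtain ⟨y, hy⟩ := uExtδ_exact hS 0 _ h
      obtain ⟨z, rfl⟩ := (bidual_bijective p.d₁).2 y
      refine ⟨z, (bidual_bijective p.d₀).1 (Eq.trans ?_ hy)⟩
      exact (bidual_naturality p.d₀ p.map z).symm

theorem _root_.GrMod.nonempty_presentation (hA : IsLeftGNoetherian 𝒜) (K : GrMod 𝒜)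
    [Module.Finite A K] : Nonempty (Presentation K) := by
  obtain ⟨ι₀, _, d₀, p₀, hp₀⟩ := exists_free_cover 𝒜 K
  have : Module.Finite A (kerComplex p₀).X₁ :=
    (isGNoetherian_of_finite hA (free 𝒜 d₀)).finite_sub _ (isHomogeneous_ker p₀)
  obtain ⟨ι₁, _, d₁, p₁, hp₁⟩ := exists_free_cover 𝒜 (kerComplex p₀).X₁
  exact ⟨⟨p₀, p₁, hp₀, hp₁⟩⟩

instance : Module.Finite Aᵐᵒᵖ (tr p.map) :=
  Module.Finite.of_surjective
    (((free 𝒜 p.d₁).uExt 0).quotπ _ (isHomogeneous_range (uExtMap p.map 0))).lin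
    (Submodule.mkQ_surjective _)

end Presentation

/-! ### The Ext groups of the transpose -/

/-- If the Ext groups of the left term vanish in two adjacent degrees, the map `S.g` induces an
isomorphism in the upper one. -/
theorem nonempty_uExt_iso_of_left {S : ShortComplex (GrMod 𝒜)} (hS : S.ShortExact) {i : ℕ}
    (h : S.X₁.ExtVanish i) (h' : S.X₁.ExtVanish (i + 1)) :
    Nonempty (S.X₃.uExt (i + 1) ≅ S.X₂.uExt (i + 1)) := by
  refine ⟨isoOfBijective (uExtMap S.g (i + 1)) ⟨uExtPre_injective _ _ fun γ x hx => ?_,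
    uExtPre_surjective _ _ fun γ x => ?_⟩⟩
  · obtain ⟨y, rfl⟩ := Abelian.Ext.contravariant_sequence_exact₃ hS _ x hx (add_comm 1 i)
    rw [h γ y, Abelian.Ext.comp_zero]
  · exact Abelian.Ext.contravariant_sequence_exact₂ hS _ x (h' γ _)

section TransposeStep

variable {K : GrMod 𝒜} (p : Presentation K) {ι₂ : Type u} {d₂ : ι₂ → G}
  (p₂ : free 𝒜 d₂ ⟶ (kerComplex p.p₁).X₁)

/-- For a free resolution `F₂ ⟶ F₁ ⟶ F₀ ⟶ K`, the morphism from the transpose of `F₁ ⟶ F₀` to the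
dual of `F₂` induced by the dual of `F₂ ⟶ F₁`. -/
def trHom : tr p.map ⟶ (free 𝒜 d₂).uExt 0 :=
  ⟨(LinearMap.range (uExtMap p.map 0).lin).liftQ (uExtMap (p₂ ≫ (kerComplex p.p₁).f) 0).lin (by
      rintro _ ⟨x, rfl⟩
      have h : (p₂ ≫ (kerComplex p.p₁).f) ≫ p.map = 0 := hom_ext fun y =>
        congrArg Subtype.val (g_f_apply (kerComplex p.p₁) (p₂.lin y))
      refine (uExtMap_comp_apply (p₂ ≫ (kerComplex p.p₁).f) p.map 0 x).trans ?_
      rw [h]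
      exact uExtMap_zero_apply 0 x),
    by rintro γ _ ⟨y, hy, rfl⟩; exact (uExtMap _ 0).map_mem hy⟩

theorem trHom_mk (y : (free 𝒜 p.d₁).uExt 0) :
    (trHom p p₂).lin (((free 𝒜 p.d₁).uExt 0).quotπ _ (isHomogeneous_range (uExtMap p.map 0))
      |>.lin y) = (uExtMap (p₂ ≫ (kerComplex p.p₁).f) 0).lin y := rfl

/-- `Ext^1(K, A)` is the cohomology at the dual of `F₁` of the dual of a free resolution
`F₂ ⟶ F₁ ⟶ F₀ ⟶ K`, that is, the kernel of `trHom`. -/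
theorem nonempty_iso_ker_trHom (hp₂ : Function.Surjective p₂.lin) :
    Nonempty (K.uExt 1 ≅ (kerComplex (trHom p p₂)).X₁) := by
  have hS₀ := kerComplex_shortExact p.p₀ p.surj₀
  have hS₁ := kerComplex_shortExact p.p₁ p.surj₁
  let π := ((free 𝒜 p.d₁).uExt 0).quotπ _ (isHomogeneous_range (uExtMap p.map 0))
  have hker : ∀ w : (kerComplex p.p₀).X₁.uExt 0,
      (trHom p p₂).lin (π.lin ((uExtMap p.p₁ 0).lin w)) = 0 := by
    intro w
    refine (trHom_mk p p₂ _).trans ((uExtMap_comp_apply _ _ 0 _).trans ?_)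
    have h : (p₂ ≫ (kerComplex p.p₁).f) ≫ p.p₁ = 0 := hom_ext fun y =>
      g_f_apply (kerComplex p.p₁) (p₂.lin y)
    rw [h]
    exact uExtMap_zero_apply 0 _
  let f : (kerComplex p.p₀).X₁.uExt 0 ⟶ (kerComplex (trHom p p₂)).X₁ :=
    ⟨(π.lin.comp (uExtMap p.p₁ 0).lin).codRestrict _ hker,
      fun hx => π.map_mem ((uExtMap p.p₁ 0).map_mem hx)⟩
  refine nonempty_iso_of_ker_eq (uExtδ hS₀ 0) f (uExtδ_surjective hS₀
    (extVanish_of_projective (free 𝒜 p.d₀) 0)) ?_ fun w => ?_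
  · rintro ⟨z, hz⟩
    obtain ⟨y, rfl⟩ := Submodule.mkQ_surjective _ z
    obtain ⟨w, rfl⟩ := uExtMap_exact hS₁ 0 y (uExtMap_zero_injective p₂ hp₂
      ((uExtMap_comp_apply p₂ (kerComplex p.p₁).f 0 y).trans (hz.trans (map_zero _).symm)))
    exact ⟨w, rfl⟩
  · constructor
    · intro h
      obtain ⟨y, rfl⟩ := uExtδ_exact hS₀ 0 w h
      refine Subtype.ext ((Submodule.Quotient.mk_eq_zero _).2 ⟨y, ?_⟩)
      exact (uExtMap_comp_apply p.p₁ (kerComplex p.p₀).f 0 y).symm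
    · intro h
      obtain ⟨y, hy⟩ := (Submodule.Quotient.mk_eq_zero _).1 (congrArg Subtype.val h)
      have : w = (uExtMap (kerComplex p.p₀).f 0).lin y :=
        uExtMap_zero_injective p.p₁ p.surj₁
          (hy.symm.trans (uExtMap_comp_apply p.p₁ (kerComplex p.p₀).f 0 y).symm)
      rw [this]
      exact uExtδ_map hS₀ 0 y

/-- If `Ext^1(K, A)` has no Ext groups in the degrees `k` and `k + 1`, then the Ext groups of the
transposes of `K` and of its syzygy agree up to a shift of the degree. The image of `trHom` links
the two: its kernel is `Ext^1(K, A)`, and its cokernel is the transpose of the syzygy. -/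
theorem nonempty_uExt_tr_iso [Fintype ι₂] (hp₂ : Function.Surjective p₂.lin) {k : ℕ}
    (h : (K.uExt 1).ExtVanish k) (h' : (K.uExt 1).ExtVanish (k + 1)) :
    Nonempty ((tr (p₂ ≫ (kerComplex p.p₁).f)).uExt (k + 2) ≅ (tr p.map).uExt (k + 1)) := by
  obtain ⟨e⟩ := nonempty_iso_ker_trHom p p₂ hp₂
  let f := uExtMap (p₂ ≫ (kerComplex p.p₁).f) 0
  let t : tr p.map ⟶ ((free 𝒜 d₂).uExt 0).sub _ (isHomogeneous_range f) :=
    ⟨(trHom p p₂).lin.codRestrict _ (by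
      intro z
      obtain ⟨y, rfl⟩ := Submodule.mkQ_surjective _ z
      exact ⟨y, rfl⟩), fun hx => (trHom p p₂).map_mem hx⟩
  have hS : (ShortComplex.mk (kerComplex (trHom p p₂)).f t (hom_ext fun x =>
      Subtype.ext (g_f_apply (kerComplex (trHom p p₂)) x))).ShortExact := by
    refine shortExact_mk Subtype.val_injective ?_ fun y hy =>
      ⟨⟨y, congrArg Subtype.val hy⟩, rfl⟩
    rintro ⟨_, y, rfl⟩
    exact ⟨Submodule.mkQ _ y, rfl⟩
  obtain ⟨e₁⟩ := nonempty_uExt_iso_of_left hS (extVanish_of_iso e h) (extVanish_of_iso e h')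
  obtain ⟨e₂⟩ := nonempty_uExt_iso (quotComplex_shortExact ((free 𝒜 d₂).uExt 0) _
    (isHomogeneous_range f)) (k + 1) (extVanish_of_projective ((free 𝒜 d₂).uExt 0) k)
    (extVanish_of_projective ((free 𝒜 d₂).uExt 0) (k + 1))
  exact ⟨e₂.symm ≪≫ e₁⟩

end TransposeStep

/-- Iteration of `nonempty_uExt_tr_iso` along a free resolution of `K`: an Ext group of the
transpose of `K` is an Ext group of higher degree of the transpose `T` of the `n`-th syzygy. -/
theorem exists_uExt_tr_iso (hA : IsLeftGNoetherian 𝒜) (n : ℕ) {K : GrMod 𝒜} (p : Presentation K)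
    (k : ℕ) (h : ∀ i < n, (K.uExt (i + 1)).ExtVanish (k + i) ∧
      (K.uExt (i + 1)).ExtVanish (k + i + 1)) :
    ∃ T : GrMod (opGrading 𝒜), Module.Finite Aᵐᵒᵖ T ∧
      Nonempty (T.uExt (k + 1 + n) ≅ (tr p.map).uExt (k + 1)) := by
  induction n generalizing K k with
  | zero => exact ⟨tr p.map, inferInstance, ⟨Iso.refl _⟩⟩
  | succ n ih =>
    have : Module.Finite A (kerComplex p.p₁).X₁ :=
      (isGNoetherian_of_finite hA (free 𝒜 p.d₁)).finite_sub _ (isHomogeneous_ker p.p₁)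
    obtain ⟨ι₂, _, d₂, p₂, hp₂⟩ := exists_free_cover 𝒜 (kerComplex p.p₁).X₁
    obtain ⟨e⟩ := nonempty_uExt_tr_iso p p₂ hp₂ (h 0 n.succ_pos).1 (h 0 n.succ_pos).2
    obtain ⟨T, hT, ⟨e'⟩⟩ := ih (⟨p.p₁, p₂, p.surj₁, hp₂⟩ : Presentation (kerComplex p.p₀).X₁)
      (k + 1) fun i hi => by
        obtain ⟨e⟩ := nonempty_uExt_iso (kerComplex_shortExact p.p₀ p.surj₀) (i + 1)
          (extVanish_of_projective (free 𝒜 p.d₀) i)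
          (extVanish_of_projective (free 𝒜 p.d₀) (i + 1))
        have h1 := h (i + 1) (by omega)
        rw [show k + (i + 1) = k + 1 + i by omega] at h1
        exact ⟨extVanish_of_iso e.symm h1.1, extVanish_of_iso e.symm h1.2⟩
    refine ⟨T, hT, ?_⟩
    rw [show k + 1 + (n + 1) = k + 1 + 1 + n by omega]
    exact ⟨e' ≪≫ e⟩

/-! ### The Auslander condition and biduality -/

theorem extVanish_of_subsingleton {X : GrMod 𝒜} (h : Subsingleton X) (i : ℕ) : X.ExtVanish i := by
  have : 𝟙 X = 0 := hom_ext fun x => Subsingleton.elim _ _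
  intro γ x
  rw [← Abelian.Ext.mk₀_id_comp x, this, Abelian.Ext.mk₀_zero, Abelian.Ext.zero_comp]

theorem SatisfiesAuslander.extVanish_sub {M : GrMod 𝒜} (h : M.SatisfiesAuslander) {i j : ℕ}
    (hj : j < i) (N : Submodule Aᵐᵒᵖ (M.uExt i)) (hN : N.IsHomogeneous (M.uExt i).deg) :
    ((M.uExt i).sub N hN).ExtVanish j :=
  (extVanish_iff _ _).2 (h i N hN j hj)

theorem SatisfiesAuslander.extVanish {M : GrMod 𝒜} (h : M.SatisfiesAuslander) {i j : ℕ}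
    (hj : j < i) : (M.uExt i).ExtVanish j :=
  extVanish_of_iso (isoOfBijective ((M.uExt i).subι ⊤ (isHomogeneous_top _))
    ⟨Subtype.val_injective, fun x => ⟨⟨x, trivial⟩, rfl⟩⟩) (h.extVanish_sub hj ⊤ _)

/-- For a module over a ring with the Auslander condition, if `j` is the smallest degree in which
the Ext groups of `M` can be nonzero, then `Ext^j(M, A)` is detected by `Ext^j(Ext^j(M, A), A)`. For
`j > 0` the vanishing of the latter makes `M` itself of the form `Ext^{j+1}(T, A)` with `T` finitely
generated, and the Auslander condition for `T` gives `Ext^j(M, A) = 0`. -/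
theorem extVanish_of_uExt_extVanish (hA : IsGGorenstein 𝒜) (M : GrMod 𝒜) [Module.Finite A M]
    {j : ℕ} (hM : ∀ i < j, M.ExtVanish i) (h : (M.uExt j).ExtVanish j) : M.ExtVanish j := by
  cases j with
  | zero => exact extVanish_zero_of_dual h
  | succ j =>
    obtain ⟨p⟩ := nonempty_presentation hA.left_noetherian M
    -- In the first `j` steps the Ext group of `M` that obstructs the shift is zero; in the last one
    -- it is `Ext^{j+1}(M, A)`, which has no Ext groups in degree `j` by the Auslander condition and
    -- none in degree `j + 1` by assumption.
    obtain ⟨T, hT, ⟨e⟩⟩ := exists_uExt_tr_iso hA.left_noetherian (j + 1) p 0 fun i hi => by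
      rw [zero_add]
      rcases Nat.lt_succ_iff_lt_or_eq.1 hi with hi | rfl
      · have := (extVanish_iff _ _).1 (hM (i + 1) (by omega))
        exact ⟨extVanish_of_subsingleton this _, extVanish_of_subsingleton this _⟩
      · exact ⟨(hA.left_auslander M inferInstance).extVanish (Nat.lt_succ_self i), h⟩
    -- Hence `M = Ext^1(tr p.map, A) = Ext^{j+2}(T, A)`.
    obtain ⟨e'⟩ := p.nonempty_iso_tr (hM 0 j.succ_pos)
    refine extVanish_of_semilinear (opOpIso 𝒜) 0 e'.hom (iso_bijective e') ?_
    exact extVanish_of_iso e ((hA.right_auslander T hT).extVanish (by omega))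

end GrMod

namespace GrMod

variable {G : Type u} [AddCommGroup G] [DecidableEq G] {A B : Type u} [Ring A] [Ring B]
  {𝒜 : G → AddSubgroup A} {ℬ : G → AddSubgroup B}

/-! ### Syzygies under change of rings -/

section FreeMap

variable [GradedRing 𝒜] [GradedRing ℬ] (φ : 𝒜 →+*ᵍ ℬ) {ι : Type u} (d : ι → G)

/-- The map `A^ι ⟶ B^ι` of free graded modules that applies `φ` to each coordinate. -/
def freeMap : free 𝒜 d ⟶ (res φ).obj (free ℬ d) :=
  ⟨{ toFun := fun f => Finsupp.mapRange φ (map_zero φ) f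
     map_add' := fun f g => Finsupp.mapRange_add (map_add φ) f g
     map_smul' := fun a f => Finsupp.ext fun i => map_mul φ a ((show ι →₀ A from f) i) },
    fun hf i => φ.map_mem (hf i)⟩

theorem freeMap_single (i : ι) (a : A) :
    (freeMap φ d).lin (Finsupp.single i a) = Finsupp.single i (φ a) :=
  Finsupp.mapRange_single (hf := map_zero φ)

theorem free_hom_ext {X : GrMod 𝒜} {f g : free 𝒜 d ⟶ X}
    (h : ∀ i, f.lin (stdBasis d i) = g.lin (stdBasis d i)) : f = g :=
  Hom.ext (Finsupp.lhom_ext' fun i => LinearMap.ext_ring (h i))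

theorem freeDesc_stdBasis {X : GrMod 𝒜} (v : ι → X) (hv : ∀ i, v i ∈ X.deg (d i)) (i : ι) :
    (freeDesc 𝒜 d v hv).lin (stdBasis d i) = v i :=
  (Finsupp.linearCombination_single A (1 : A) i).trans (one_smul A _)

variable {φ}

/-- The map on kernels induced by a commutative square over a change of rings. -/
def kerMap {P X : GrMod 𝒜} {P' X' : GrMod ℬ} {q : P ⟶ (res φ).obj P'} {u : X ⟶ (res φ).obj X'}
    (p : P ⟶ X) (p' : P' ⟶ X') (h : q ≫ (res φ).map p' = p ≫ u) :
    (kerComplex p).X₁ ⟶ (res φ).obj (kerComplex p').X₁ :=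
  have hk : ∀ x : (kerComplex p).X₁, p'.lin (q.lin x.1) = 0 := fun x => by
    refine (lin_congr h x.1).trans ?_
    exact (congrArg u.lin x.2).trans (map_zero _)
  ⟨{ toFun := fun x => ⟨q.lin x.1, hk x⟩
     map_add' := fun x y => Subtype.ext (q.lin.map_add x.1 y.1)
     map_smul' := fun a x => Subtype.ext (q.lin.map_smul a x.1) },
    fun hx => q.map_mem hx⟩

/-- A relation between modules over two rings that holds for free modules and passes to kernels
lifts to syzygies, provided that `u X` generates `X'`: a free cover of `X` by all homogeneous
elements then yields one of `X'`. -/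
theorem nonempty_syzygyLift (Rel : ∀ (X : GrMod 𝒜) (X' : GrMod ℬ), (X ⟶ (res φ).obj X') → Prop)
    (hfree : ∀ (ι : Type u) (d : ι → G), Rel _ _ (freeMap φ d))
    (hker : ∀ {P X : GrMod 𝒜} {P' X' : GrMod ℬ} {q : P ⟶ (res φ).obj P'}
      {u : X ⟶ (res φ).obj X'} (p : P ⟶ X) (p' : P' ⟶ X') (h : q ≫ (res φ).map p' = p ≫ u),
      Function.Surjective p.lin → Rel P P' q → Rel X X' u → Rel _ _ (kerMap p p' h))
    {X : GrMod 𝒜} {X' : GrMod ℬ} {u : X ⟶ (res φ).obj X'} (hu : Rel X X' u)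
    (hspan : ∀ N : Submodule B X', (∀ x, (show X' from u.lin x) ∈ N) → N = ⊤) :
    Nonempty (SyzygyLift (res φ) Rel u) := by
  let ι := Σ γ, X.deg γ
  let d : ι → G := fun i => i.1
  let p : free 𝒜 d ⟶ X := freeDesc 𝒜 d (fun i => (i.2 : X)) fun i => i.2.2
  have hp : Function.Surjective p.lin := by
    intro x
    have : x ∈ LinearMap.range p.lin := by
      induction x using DirectSum.Decomposition.inductionOn X.deg with
      | zero => exact zero_mem _
      | @homogeneous γ m => exact ⟨stdBasis d ⟨γ, m⟩, freeDesc_stdBasis d _ _ _⟩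
      | add m m' h h' => exact add_mem h h'
    exact this
  let p' : free ℬ d ⟶ X' := freeDesc ℬ d (fun i => u.lin (i.2 : X)) fun i => u.map_mem i.2.2
  have h : freeMap φ d ≫ (res φ).map p' = p ≫ u := by
    refine free_hom_ext d fun i => ?_
    rw [comp_lin, comp_lin, freeDesc_stdBasis]
    have h1 : (freeMap φ d).lin (stdBasis d i) = stdBasis (𝒜 := ℬ) d i := by
      refine (freeMap_single φ d i 1).trans ?_
      rw [map_one]; rfl
    rw [h1]
    exact freeDesc_stdBasis (𝒜 := ℬ) d (fun i => (show X' from u.lin (i.2 : X)))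
      (fun i => u.map_mem i.2.2) i
  have hp' : Function.Surjective p'.lin := by
    refine LinearMap.range_eq_top.1 (hspan _ fun x => ?_)
    obtain ⟨y, rfl⟩ := hp x
    exact ⟨(freeMap φ d).lin y, lin_congr h y⟩
  exact ⟨{
    i := (kerComplex p).f
    p := p
    i' := (kerComplex p').f
    p' := p'
    w := (kerComplex p).zero
    w' := (kerComplex p').zero
    exact := kerComplex_shortExact p hp
    exact' := kerComplex_shortExact p' hp'
    proj := (inferInstance : Projective (free 𝒜 d))
    proj' := (inferInstance : Projective (free ℬ d))
    v := kerMap p p' h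
    q := freeMap φ d
    comm₁ := rfl
    comm₂ := h
    rel_left := hker p p' h hp (hfree ι d) hu
    rel_mid := hfree ι d }⟩

end FreeMap

/-! ### Base change -/

section BaseChangeUnit

variable [GradedRing 𝒜] [GradedRing ℬ] (φ : 𝒜 →+*ᵍ ℬ) (M : GrMod 𝒜)

/-- The unit `m ↦ 1 ⊗ m` of base change. -/
def baseChangeUnit : M ⟶ (res φ).obj (M.baseChange φ) :=
  ⟨{ toFun := fun m => tmul φ M 1 m
     map_add' := fun m m' => map_add (tmul φ M 1) m m'
     map_smul' := fun a m => by
      have h1 : tmul φ M 1 (a • m) = φ a • tmul φ M 1 m := by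
        rw [smul_tmul, ← tmul_mul, one_mul, mul_one]
      exact h1 },
    fun {γ m} hm => tmul_mem_tensorDeg (SetLike.one_mem_graded ℬ) hm (zero_add γ)⟩

theorem baseChange_induction {P : M.baseChange φ → Prop} (x : M.baseChange φ) (h0 : P 0)
    (hadd : ∀ x y, P x → P y → P (x + y))
    (h : ∀ (b : B) m, P (b • (show M.baseChange φ from (baseChangeUnit φ M).lin m))) : P x := by
  refine tensor_induction φ M (P := P) h0 hadd (fun b m => ?_) x
  have := h b m
  have h1 : (b • (show M.baseChange φ from (baseChangeUnit φ M).lin m)) = tmul φ M b m := by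
    refine (smul_tmul φ M b 1 m).trans ?_
    rw [mul_one]
  rwa [h1] at this

theorem baseChange_span (N : Submodule B (M.baseChange φ))
    (h : ∀ x, (show M.baseChange φ from (baseChangeUnit φ M).lin x) ∈ N) : N = ⊤ := by
  rw [eq_top_iff]
  intro x _
  induction x using baseChange_induction with
  | h0 => exact zero_mem _
  | hadd x y hx hy => exact add_mem (hx trivial) (hy trivial)
  | h b m => exact N.smul_mem b (h m)

variable {M}

/-- A semilinear map to a module over the target ring vanishes on the kernel of `m ↦ 1 ⊗ m`. -/
theorem eq_zero_of_baseChangeUnit {Y : Type u} [AddCommGroup Y] [Module B Y] (g : M →+ Y)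
    (hg : ∀ a m, g (a • m) = φ a • g m) {m : M} (hm : (baseChangeUnit φ M).lin m = 0) :
    g m = 0 := by
  let L : B ⊗[ℤ] M →+ Y := TensorProduct.liftAddHom (R := ℤ)
    (AddMonoidHom.mk' (fun b => AddMonoidHom.mk' (fun m => b • g m) fun m m' => by
      rw [map_add, smul_add]) fun b b' => AddMonoidHom.ext fun m => add_smul b b' (g m))
    fun n b m => by
      change (n • b) • g m = b • g (n • m)
      rw [map_zsmul, smul_assoc, smul_comm]
  have hL : ∀ (b : B) m, L (b ⊗ₜ[ℤ] m) = b • g m := fun b m => rfl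
  have hL' : ∀ (c : B) t, L (c • t) = c • L t := by
    intro c t
    induction t using TensorProduct.induction_on with
    | zero => rw [smul_zero, map_zero, smul_zero]
    | tmul b m => rw [TensorProduct.smul_tmul', hL, hL, smul_eq_mul, mul_smul]
    | add x y hx hy => rw [smul_add, map_add, map_add, smul_add, hx, hy]
  have hrel : ∀ t ∈ tensorRel φ M, L t = 0 := by
    intro t ht
    induction ht using Submodule.span_induction with
    | mem t h =>
      obtain ⟨b, a, m, rfl⟩ := h
      rw [map_sub, hL, hL, hg, smul_smul, sub_self]
    | zero => exact map_zero _
    | add x y _ _ hx hy => rw [map_add, hx, hy, add_zero]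
    | smul b x _ hx => rw [hL', hx, smul_zero]
  have h1 := hrel _ ((Submodule.Quotient.mk_eq_zero _).1 hm)
  rwa [hL, one_smul] at h1

end BaseChangeUnit

end GrMod

/-! ### Change of rings to the quotient by a regular normal element -/

namespace GrMod

variable {G : Type u} {R : Type u} [Ring R] {𝒜 : G → AddSubgroup R} {ħ : R}
  [hn : IsRegularNormal ħ]

theorem mem_span_iff {a : R} : a ∈ Ideal.span {ħ} ↔ ∃ b, a = ħ * b := by
  rw [Ideal.mem_span_singleton']
  constructor
  · rintro ⟨b, rfl⟩; exact hn.right_mul b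
  · rintro ⟨b, rfl⟩
    obtain ⟨c, hc⟩ := hn.left_mul b
    exact ⟨c, hc.symm⟩

theorem toBar_eq_zero {a : R} : toBar 𝒜 ħ a = 0 ↔ ∃ b, a = ħ * b :=
  Ideal.Quotient.eq_zero_iff_mem.trans mem_span_iff

theorem toBar_self : toBar 𝒜 ħ ħ = 0 := toBar_eq_zero.2 ⟨1, (mul_one ħ).symm⟩

theorem toBar_surjective : Function.Surjective (toBar 𝒜 ħ) := Ideal.Quotient.mk_surjective

variable [AddCommGroup G] [DecidableEq G]

theorem bar_smul_eq_zero (X' : GrMod (barGrading 𝒜 ħ)) (x : (res (toBar 𝒜 ħ)).obj X') :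
    ħ • x = 0 := by
  change (toBar 𝒜 ħ ħ • (show X' from x)) = 0
  rw [toBar_self, zero_smul]

/-- The map `u` exhibits `X'` as the quotient of the `ħ`-torsionfree module `X` by `ħ X`. -/
structure IsBar (X : GrMod 𝒜) (X' : GrMod (barGrading 𝒜 ħ))
    (u : X ⟶ (res (toBar 𝒜 ħ)).obj X') : Prop where
  torsionfree : ∀ x : X, ħ • x = 0 → x = 0
  surjective : Function.Surjective u.lin
  ker : ∀ x, u.lin x = 0 → ∃ y : X, x = ħ • y

/-- A morphism from `X` to a module annihilated by `ħ` factors uniquely through `X / ħ X`. -/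
theorem IsBar.bijective {X : GrMod 𝒜} {X' : GrMod (barGrading 𝒜 ħ)}
    {u : X ⟶ (res (toBar 𝒜 ħ)).obj X'} (h : IsBar X X' u) (N : GrMod (barGrading 𝒜 ħ)) :
    Function.Bijective fun f : X' ⟶ N => u ≫ (res (toBar 𝒜 ħ)).map f := by
  constructor
  · intro f g hfg
    refine hom_ext fun x => ?_
    obtain ⟨x, rfl⟩ := h.surjective x
    exact lin_congr hfg x
  · intro g
    have hk : ∀ x, u.lin x = 0 → g.lin x = 0 := by
      intro x hx
      obtain ⟨y, rfl⟩ := h.ker x hx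
      rw [map_smul]
      exact bar_smul_eq_zero N _
    have hk' : ∀ x y, u.lin x = u.lin y → g.lin x = g.lin y := by
      intro x y hxy
      rw [← sub_eq_zero, ← map_sub]
      exact hk _ (by rw [map_sub, hxy, sub_self])
    choose s hs using h.surjective
    have hs' : ∀ x, g.lin (s (u.lin x)) = g.lin x := fun x => hk' _ _ (hs _)
    refine ⟨⟨{ toFun := fun x => g.lin (s x), map_add' := fun x y => ?_, map_smul' := ?_ },
      fun {γ x} hx => ?_⟩, hom_ext hs'⟩
    · refine Eq.trans ?_ (g.lin.map_add (s x) (s y))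
      exact hk' _ _ ((hs (x + y)).trans ((congrArg₂ (· + ·) (hs x) (hs y)).symm.trans
        (map_add u.lin (s x) (s y)).symm))
    · intro a x
      obtain ⟨a, rfl⟩ := toBar_surjective (𝒜 := 𝒜) a
      refine Eq.trans ?_ (g.lin.map_smul a (s x))
      exact hk' _ _ ((hs _).trans ((congrArg (fun z : (res (toBar 𝒜 ħ)).obj X' => a • z)
        (hs x)).symm.trans (map_smul u.lin a (s x)).symm))
    · obtain ⟨y, hy, rfl⟩ := exists_deg_of_surjective u h.surjective (γ := γ) hx
      change g.lin (s (u.lin y)) ∈ N.deg γ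
      rw [hs']
      exact g.map_mem hy

/-- As `X` is torsionfree, reduction modulo `ħ` is exact on `0 → K → P → X → 0`. -/
theorem isBar_ker {P X : GrMod 𝒜} {P' X' : GrMod (barGrading 𝒜 ħ)}
    {q : P ⟶ (res (toBar 𝒜 ħ)).obj P'} {u : X ⟶ (res (toBar 𝒜 ħ)).obj X'} (p : P ⟶ X)
    (p' : P' ⟶ X') (h : q ≫ (res (toBar 𝒜 ħ)).map p' = p ≫ u) (hp : Function.Surjective p.lin)
    (hq : IsBar P P' q) (hu : IsBar X X' u) : IsBar _ _ (kerMap p p' h) where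
  torsionfree x hx := Subtype.ext (hq.torsionfree _ (congrArg Subtype.val hx))
  surjective := by
    rintro ⟨y, hy⟩
    obtain ⟨y, rfl⟩ := hq.surjective y
    have h1 : u.lin (p.lin y) = 0 := (lin_congr h y).symm.trans hy
    obtain ⟨x, hx⟩ := hu.ker _ h1
    obtain ⟨z, rfl⟩ := hp x
    refine ⟨⟨y - ħ • z, ?_⟩, Subtype.ext ?_⟩
    · rw [LinearMap.mem_ker, map_sub, map_smul, hx, sub_self]
    · change q.lin (y - ħ • z) = q.lin y
      rw [map_sub, map_smul, bar_smul_eq_zero, sub_zero]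
  ker := by
    rintro ⟨x, hx⟩ h0
    obtain ⟨y, rfl⟩ := hq.ker x (congrArg Subtype.val h0)
    refine ⟨⟨y, hu.torsionfree _ ?_⟩, rfl⟩
    rw [← map_smul]
    exact hx

variable [GradedRing 𝒜] [hħ : Fact (SetLike.IsHomogeneousElem 𝒜 ħ)]

theorem isBar_free {ι : Type u} (d : ι → G) : IsBar _ _ (freeMap (toBar 𝒜 ħ) d) where
  torsionfree f hf := Finsupp.ext fun i => hn.regular.left (by
    have := DFunLike.congr_fun (show (ħ • (show ι →₀ R from f)) = 0 from hf) i
    exact this.trans (mul_zero ħ).symm)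
  surjective := Finsupp.mapRange_surjective _ (map_zero (toBar 𝒜 ħ)) toBar_surjective
  ker f hf := by
    have h : ∀ i, ∃ b, (show ι →₀ R from f) i = ħ * b := fun i =>
      (toBar_eq_zero (𝒜 := 𝒜)).1 (DFunLike.congr_fun
        (show (Finsupp.mapRange (toBar 𝒜 ħ) (map_zero _) (show ι →₀ R from f)) = 0 from hf) i)
    choose b hb using h
    refine ⟨Finsupp.onFinset (show ι →₀ R from f).support b fun i hi => ?_,
      Finsupp.ext fun i => hb i⟩
    rw [Finsupp.mem_support_iff]
    intro h0
    rw [hb] at h0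
    exact hi (hn.regular.left (h0.trans (mul_zero ħ).symm))

/-- The graded Ext groups over `R / ħ R` of `X / ħ X` agree with those of `X` over `R`. -/
theorem IsBar.comparison {X : GrMod 𝒜} {X' : GrMod (barGrading 𝒜 ħ)}
    {u : X ⟶ (res (toBar 𝒜 ħ)).obj X'} (h : IsBar X X' u) (i : ℕ) (N : GrMod (barGrading 𝒜 ħ)) :
    Function.Bijective (extComparison.{u} (res (toBar 𝒜 ħ)) u N i) :=
  extComparison_bijective (res (toBar 𝒜 ħ)) IsBar (fun h => h.bijective)
    (fun {_ _ u} h => nonempty_syzygyLift IsBar (fun _ => isBar_free) isBar_ker h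
      fun N hN => eq_top_iff.2 fun x _ => by
        obtain ⟨y, rfl⟩ := h.surjective x
        exact hN y) i h N

theorem isBar_baseChange (M : GrMod 𝒜) (hM : ∀ x : M, ħ • x = 0 → x = 0) :
    IsBar M (M.baseChange (toBar 𝒜 ħ)) (baseChangeUnit (toBar 𝒜 ħ) M) where
  torsionfree := hM
  surjective x := by
    have : x ∈ (baseChangeUnit (toBar 𝒜 ħ) M).lin.range := by
      refine baseChange_induction (toBar 𝒜 ħ) M
        (P := fun x => x ∈ (baseChangeUnit (toBar 𝒜 ħ) M).lin.range) x (zero_mem _)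
        (fun _ _ => add_mem) fun b m => ?_
      obtain ⟨a, rfl⟩ := toBar_surjective (𝒜 := 𝒜) b
      exact ⟨a • m, map_smul _ a m⟩
    exact this
  ker m hm := by
    -- The quotient by the ideal times the module is an `R / ħ R`-module by a Mathlib instance.
    have h1 := eq_zero_of_baseChangeUnit (toBar 𝒜 ħ)
      (Y := M ⧸ Ideal.span {ħ} • (⊤ : Submodule R M))
      (Submodule.mkQ (Ideal.span {ħ} • (⊤ : Submodule R M))).toAddMonoidHom
      (fun a m => rfl) hm
    have h2 : m ∈ Ideal.span {ħ} • (⊤ : Submodule R M) := (Submodule.Quotient.mk_eq_zero _).1 h1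
    clear hm h1
    induction h2 using Submodule.smul_induction_on' with
    | smul r hr m _ =>
      obtain ⟨b, rfl⟩ := mem_span_iff.1 hr
      exact ⟨b • m, mul_smul ħ b m⟩
    | add x hx y hy h h' =>
      obtain ⟨a, rfl⟩ := h
      obtain ⟨b, rfl⟩ := h'
      exact ⟨a + b, (smul_add ħ a b).symm⟩

end GrMod

/-! ### Change of rings to the localization at a regular normal element -/

namespace GrMod

variable {G : Type u} {R : Type u} [Ring R] {ħ : R} [hn : IsRegularNormal ħ]

theorem exists_pow_mul_eq (n : ℕ) (a : R) : ∃ b, ħ ^ n * a = b * ħ ^ n :=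
  pow_left_mul ħ ⟨n, rfl⟩ a

theorem exists_mul_pow_eq (n : ℕ) (a : R) : ∃ b, a * ħ ^ n = ħ ^ n * b := by
  induction n generalizing a with
  | zero => exact ⟨a, by rw [pow_zero, mul_one, one_mul]⟩
  | succ n ih =>
    obtain ⟨b, hb⟩ := ih a
    obtain ⟨c, hc⟩ := hn.right_mul b
    exact ⟨c, by rw [pow_succ, ← mul_assoc, hb, mul_assoc, hc, mul_assoc]⟩

/-- The inverse of `ħ ^ n` in `R[ħ⁻¹]`. -/
def hatInv (ħ : R) [IsRegularNormal ħ] (n : ℕ) : RHat ħ :=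
  OreLocalization.oreDiv 1 (⟨ħ ^ n, n, rfl⟩ : Submonoid.powers ħ)

variable [AddCommGroup G] [DecidableEq G] (𝒜 : G → AddSubgroup R) [GradedRing 𝒜]

theorem toHat_injective : Function.Injective (toHat 𝒜 ħ) :=
  (injective_iff_map_eq_zero _).2 fun _ h => eq_zero_of_oreDiv h

theorem toHat_pow_mul_div (n : ℕ) (a : R) :
    toHat 𝒜 ħ (ħ ^ n) * OreLocalization.oreDiv a (⟨ħ ^ n, n, rfl⟩ : Submonoid.powers ħ) =
      toHat 𝒜 ħ a :=
  OreLocalization.mul_cancel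

theorem toHat_mul_hatInv (n : ℕ) : toHat 𝒜 ħ (ħ ^ n) * hatInv ħ n = 1 :=
  (toHat_pow_mul_div 𝒜 n 1).trans (map_one _)

theorem hatInv_mul_toHat (n : ℕ) : hatInv ħ n * toHat 𝒜 ħ (ħ ^ n) = 1 := by
  refine (OreLocalization.oreDiv_mul_char (S := Submonoid.powers ħ) 1 (ħ ^ n) ⟨ħ ^ n, n, rfl⟩ 1 1 1
    ?_).trans ?_
  · simp
  · rw [one_mul, one_mul]
    exact OreLocalization.div_eq_one' (S := Submonoid.powers ħ) (r := ħ ^ n) ⟨n, rfl⟩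

theorem hatInv_mem {ε : G} (hε : ħ ∈ 𝒜 ε) (n : ℕ) : hatInv ħ n ∈ hatGrading 𝒜 ħ (-(n • ε)) :=
  ⟨_, n • ε, 1, SetLike.pow_mem_graded n hε, by
    rw [neg_add_cancel]; exact SetLike.one_mem_graded 𝒜, rfl⟩

theorem exists_toHat_mul (c : RHat ħ) : ∃ (n : ℕ) (a : R), toHat 𝒜 ħ (ħ ^ n) * c = toHat 𝒜 ħ a := by
  induction c using OreLocalization.ind with
  | _ r s =>
    obtain ⟨_, n, rfl⟩ := s
    exact ⟨n, r, toHat_pow_mul_div 𝒜 n r⟩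

variable {𝒜}

theorem hatInv_smul (X' : GrMod (hatGrading 𝒜 ħ)) (n : ℕ) (x : X') :
    hatInv ħ n • toHat 𝒜 ħ (ħ ^ n) • x = x := by
  rw [smul_smul, hatInv_mul_toHat, one_smul]

theorem exists_hat_smul_eq (X' : GrMod (hatGrading 𝒜 ħ)) (n : ℕ) (x : (res (toHat 𝒜 ħ)).obj X') :
    ∃ y : (res (toHat 𝒜 ħ)).obj X', ħ ^ n • y = x := by
  refine ⟨(hatInv ħ n • (show X' from x) : X'), ?_⟩
  change toHat 𝒜 ħ (ħ ^ n) • hatInv ħ n • (show X' from x) = _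
  rw [smul_smul, toHat_mul_hatInv, one_smul]

theorem hat_smul_injective (X' : GrMod (hatGrading 𝒜 ħ)) (n : ℕ) {x y : (res (toHat 𝒜 ħ)).obj X'}
    (h : ħ ^ n • x = ħ ^ n • y) : x = y := by
  exact (hatInv_smul X' n x).symm.trans
    ((congrArg (fun z : X' => hatInv ħ n • z) h).trans (hatInv_smul X' n y))

theorem hat_smul_mem {X' : GrMod (hatGrading 𝒜 ħ)} {ε : G} (hε : ħ ∈ 𝒜 ε) (n : ℕ) {γ : G}
    {x : (res (toHat 𝒜 ħ)).obj X'} (h : ħ ^ n • x ∈ X'.deg (n • ε + γ)) : x ∈ X'.deg γ := by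
  have h1 : toHat 𝒜 ħ (ħ ^ n) • (show X' from x) ∈ X'.deg (n • ε + γ) := h
  have h2 := X'.smul_mem (hatInv_mem 𝒜 hε n) h1
  rwa [smul_smul, hatInv_mul_toHat, one_smul, neg_add_cancel_left] at h2

/-- The map `u` exhibits `X'` as the localization `X[ħ⁻¹]`. -/
structure IsHat (X : GrMod 𝒜) (X' : GrMod (hatGrading 𝒜 ħ))
    (u : X ⟶ (res (toHat 𝒜 ħ)).obj X') : Prop where
  ker : ∀ x, u.lin x = 0 → ∃ n : ℕ, ħ ^ n • x = 0
  surj : ∀ x : (res (toHat 𝒜 ħ)).obj X', ∃ (n : ℕ) (y : X), ħ ^ n • x = u.lin y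

section Bijective

variable {X : GrMod 𝒜} {X' : GrMod (hatGrading 𝒜 ħ)} {u : X ⟶ (res (toHat 𝒜 ħ)).obj X'}

theorem IsHat.exists_deg (h : IsHat X X' u) {ε : G} (hε : ħ ∈ 𝒜 ε) {γ : G}
    {x : (res (toHat 𝒜 ħ)).obj X'} (hx : x ∈ X'.deg γ) :
    ∃ (n : ℕ), ∃ y ∈ X.deg (n • ε + γ), ħ ^ n • x = u.lin y := by
  obtain ⟨n, y, hy⟩ := h.surj x
  refine ⟨n, X.comp (n • ε + γ) y, X.comp_mem _ _, ?_⟩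
  rw [← comp_map, ← hy, comp_same]
  exact GrMod.smul_mem _ (SetLike.pow_mem_graded n hε) hx

/-- For a linear map `g` from `X` to a module over `R[ħ⁻¹]`, the value of `ħ⁻ⁿ g(y)` depends only on
the fraction `x = ħ⁻ⁿ y`. -/
theorem IsHat.unique (h : IsHat X X' u) {N : GrMod (hatGrading 𝒜 ħ)}
    (g : X ⟶ (res (toHat 𝒜 ħ)).obj N) {x : (res (toHat 𝒜 ħ)).obj X'} {n m : ℕ} {y z : X}
    {v w : (res (toHat 𝒜 ħ)).obj N} (hy : ħ ^ n • x = u.lin y) (hv : ħ ^ n • v = g.lin y)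
    (hz : ħ ^ m • x = u.lin z) (hw : ħ ^ m • w = g.lin z) : v = w := by
  have h1 : u.lin (ħ ^ m • y - ħ ^ n • z) = 0 := by
    rw [map_sub, map_smul, map_smul, ← hy, ← hz, smul_smul, smul_smul, pow_mul_comm, sub_self]
  obtain ⟨k, hk⟩ := h.ker _ h1
  refine hat_smul_injective N (k + (m + n)) ?_
  rw [← sub_eq_zero, ← smul_sub, pow_add, mul_smul, smul_sub]
  have h2 : ħ ^ (m + n) • v = g.lin (ħ ^ m • y) := by rw [map_smul, ← hv, pow_add, mul_smul]
  have h3 : ħ ^ (m + n) • w = g.lin (ħ ^ n • z) := by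
    rw [map_smul, ← hw, add_comm, pow_add, mul_smul]
  rw [h2, h3, ← map_sub, ← map_smul, hk, map_zero]

theorem exists_pow_smul_zero :
    ∃ (n : ℕ) (y : X), ħ ^ n • (0 : (res (toHat 𝒜 ħ)).obj X') = u.lin y :=
  ⟨0, 0, by rw [smul_zero, map_zero]⟩

theorem exists_pow_smul_add {x x' : (res (toHat 𝒜 ħ)).obj X'}
    (h : ∃ (n : ℕ) (y : X), ħ ^ n • x = u.lin y) (h' : ∃ (n : ℕ) (y : X), ħ ^ n • x' = u.lin y) :
    ∃ (n : ℕ) (y : X), ħ ^ n • (x + x') = u.lin y := by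
  obtain ⟨n, y, hy⟩ := h
  obtain ⟨m, z, hz⟩ := h'
  refine ⟨n + m, ħ ^ m • y + ħ ^ n • z, ?_⟩
  rw [smul_add, map_add, map_smul, map_smul, ← hy, ← hz, smul_smul, smul_smul, ← pow_add,
    ← pow_add, add_comm m]

theorem IsHat.eq_top (h : IsHat X X' u) (N : Submodule (RHat ħ) X')
    (hN : ∀ x, (show X' from u.lin x) ∈ N) : N = ⊤ := by
  refine eq_top_iff.2 fun x _ => ?_
  obtain ⟨n, y, hy⟩ := h.surj x
  have h1 : toHat 𝒜 ħ (ħ ^ n) • (show X' from x) ∈ N := by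
    have := hN y
    rwa [← hy] at this
  have h2 := N.smul_mem (hatInv ħ n) h1
  rwa [smul_smul, hatInv_mul_toHat, one_smul] at h2

variable [hħ : Fact (SetLike.IsHomogeneousElem 𝒜 ħ)]

/-- A morphism from `X` to a module over `R[ħ⁻¹]` factors uniquely through `X[ħ⁻¹]`. -/
theorem IsHat.bijective (h : IsHat X X' u) (N : GrMod (hatGrading 𝒜 ħ)) :
    Function.Bijective fun f : X' ⟶ N => u ≫ (res (toHat 𝒜 ħ)).map f := by
  obtain ⟨ε, hε⟩ := hħ.out
  constructor
  · intro f g hfg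
    refine hom_ext fun (x : (res (toHat 𝒜 ħ)).obj X') => ?_
    obtain ⟨n, y, hy⟩ := h.surj x
    refine hat_smul_injective N n ?_
    refine (map_smul ((res (toHat 𝒜 ħ)).map f).lin (ħ ^ n) x).symm.trans
      (Eq.trans ?_ (map_smul ((res (toHat 𝒜 ħ)).map g).lin (ħ ^ n) x))
    rw [hy]
    exact lin_congr hfg y
  · intro g
    have hex : ∀ x : (res (toHat 𝒜 ħ)).obj X', ∃ w : (res (toHat 𝒜 ħ)).obj N,
        ∃ (n : ℕ) (y : X), ħ ^ n • x = u.lin y ∧ ħ ^ n • w = g.lin y := by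
      intro x
      obtain ⟨n, y, hy⟩ := h.surj x
      obtain ⟨w, hw⟩ := exists_hat_smul_eq N n (g.lin y)
      exact ⟨w, n, y, hy, hw⟩
    choose f n s hs hf using hex
    have key : ∀ x (m : ℕ) (y : X) (w : (res (toHat 𝒜 ħ)).obj N), ħ ^ m • x = u.lin y →
        ħ ^ m • w = g.lin y → f x = w := fun x m y w h1 h2 => h.unique g (hs x) (hf x) h1 h2
    have hadd : ∀ x y, f (x + y) = f x + f y := by
      intro x y
      refine key _ (n x + n y) (ħ ^ n y • s x + ħ ^ n x • s y) _ ?_ ?_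
      · rw [smul_add, map_add, map_smul, map_smul, ← hs, ← hs, smul_smul, smul_smul, ← pow_add,
          ← pow_add, add_comm (n y)]
      · rw [smul_add, map_add, map_smul, map_smul, ← hf, ← hf, smul_smul, smul_smul, ← pow_add,
          ← pow_add, add_comm (n y)]
    have hsmul : ∀ (a : R) x, f (a • x) = a • f x := by
      intro a x
      obtain ⟨b, hb⟩ := exists_pow_mul_eq (ħ := ħ) (n x) a
      refine key _ (n x) (b • s x) _ ?_ ?_
      · rw [smul_smul, hb, map_smul, ← hs, mul_smul]
      · rw [smul_smul, hb, map_smul, ← hf, mul_smul]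
    refine ⟨⟨{ toFun := f, map_add' := hadd, map_smul' := fun c x => ?_ }, fun {γ x} hx => ?_⟩,
      hom_ext fun x => key _ 0 x _ ?_ ?_⟩
    · obtain ⟨k, a, ha⟩ := exists_toHat_mul 𝒜 c
      refine hat_smul_injective N k ?_
      refine (hsmul (ħ ^ k) _).symm.trans ?_
      have h1 : (ħ ^ k • (show (res (toHat 𝒜 ħ)).obj X' from c • x)) =
          (a • (show (res (toHat 𝒜 ħ)).obj X' from x)) := by
        change toHat 𝒜 ħ (ħ ^ k) • c • (show X' from x) = toHat 𝒜 ħ a • (show X' from x)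
        rw [smul_smul, ha]
      refine (congrArg f h1).trans ((hsmul a x).trans ?_)
      change toHat 𝒜 ħ a • (show N from f x) = toHat 𝒜 ħ (ħ ^ k) • c • (show N from f x)
      rw [smul_smul, ha]
    · obtain ⟨m, y, hy, hxy⟩ := h.exists_deg hε hx
      refine hat_smul_mem hε m ?_
      have h1 : ħ ^ m • f x = g.lin y := by
        obtain ⟨w, hw⟩ := exists_hat_smul_eq N m (g.lin y)
        rw [key x m y w hxy hw, hw]
      have h2 := g.map_mem hy
      rw [← h1] at h2
      exact h2
    · rw [pow_zero, one_smul]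
    · rw [pow_zero, one_smul]

end Bijective

/-- Localization is exact. -/
theorem isHat_ker {P X : GrMod 𝒜} {P' X' : GrMod (hatGrading 𝒜 ħ)}
    {q : P ⟶ (res (toHat 𝒜 ħ)).obj P'} {u : X ⟶ (res (toHat 𝒜 ħ)).obj X'} (p : P ⟶ X)
    (p' : P' ⟶ X') (h : q ≫ (res (toHat 𝒜 ħ)).map p' = p ≫ u)
    (hq : IsHat P P' q) (hu : IsHat X X' u) : IsHat _ _ (kerMap p p' h) where
  ker := by
    rintro ⟨x, hx⟩ h0
    obtain ⟨n, hn⟩ := hq.ker x (congrArg Subtype.val h0)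
    exact ⟨n, Subtype.ext hn⟩
  surj := by
    rintro ⟨(y : (res (toHat 𝒜 ħ)).obj P'), hy⟩
    obtain ⟨n, z, hz⟩ := hq.surj y
    have h1 : u.lin (p.lin z) = 0 := by
      refine (lin_congr h z).symm.trans ?_
      rw [comp_lin, ← hz, map_smul]
      have h2 : ((res (toHat 𝒜 ħ)).map p').lin y = 0 := hy
      rw [h2, smul_zero]
    obtain ⟨m, hm⟩ := hu.ker _ h1
    refine ⟨m + n, ⟨ħ ^ m • z, ?_⟩, Subtype.ext ?_⟩
    · rw [LinearMap.mem_ker, map_smul, hm]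
    · change ħ ^ (m + n) • y = q.lin (ħ ^ m • z)
      rw [map_smul, ← hz, smul_smul, pow_add]

variable [hħ : Fact (SetLike.IsHomogeneousElem 𝒜 ħ)]

theorem isHat_free {ι : Type u} (d : ι → G) : IsHat _ _ (freeMap (toHat 𝒜 ħ) d) where
  ker f hf := ⟨0, by
    rw [pow_zero, one_smul]
    exact Finsupp.mapRange_injective (toHat 𝒜 ħ) (map_zero _) (toHat_injective 𝒜)
      (hf.trans (Finsupp.mapRange_zero (hf := map_zero (toHat 𝒜 ħ))).symm)⟩
  surj f := by
    refine Finsupp.induction_linear (motive := fun f => ∃ (n : ℕ) (y : free 𝒜 d),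
      ħ ^ n • (show (res (toHat 𝒜 ħ)).obj (free (hatGrading 𝒜 ħ) d) from f) =
        (freeMap (toHat 𝒜 ħ) d).lin y) f
        (exists_pow_smul_zero (u := freeMap (toHat 𝒜 ħ) d))
        (fun _ _ => exists_pow_smul_add) fun i c => ?_
    obtain ⟨n, a, ha⟩ := exists_toHat_mul 𝒜 c
    refine ⟨n, Finsupp.single i a, Eq.trans ?_ (freeMap_single _ d i a).symm⟩
    refine (Finsupp.smul_single (toHat 𝒜 ħ (ħ ^ n)) i c).trans ?_
    rw [smul_eq_mul, ha]

/-- The graded Ext groups over `R[ħ⁻¹]` of `X[ħ⁻¹]` agree with those of `X` over `R`. -/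
theorem IsHat.comparison {X : GrMod 𝒜} {X' : GrMod (hatGrading 𝒜 ħ)}
    {u : X ⟶ (res (toHat 𝒜 ħ)).obj X'} (h : IsHat X X' u) (i : ℕ) (N : GrMod (hatGrading 𝒜 ħ)) :
    Function.Bijective (extComparison.{u} (res (toHat 𝒜 ħ)) u N i) :=
  extComparison_bijective (res (toHat 𝒜 ħ)) IsHat (fun h => h.bijective)
    (fun {_ _ _} h => nonempty_syzygyLift IsHat (fun _ => isHat_free)
      (fun p p' h _ hq hu => isHat_ker p p' h hq hu) h h.eq_top) i h N

theorem isHat_baseChange (M : GrMod 𝒜) :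
    IsHat M (M.baseChange (toHat 𝒜 ħ)) (baseChangeUnit (toHat 𝒜 ħ) M) where
  ker m hm := by
    -- The kernel of `m ↦ 1 ⊗ m` is contained in that of the map to the Ore localization of `M`.
    have h1 := eq_zero_of_baseChangeUnit (toHat 𝒜 ħ)
      (Y := OreLocalization (Submonoid.powers ħ) M)
      (AddMonoidHom.mk' (fun m => OreLocalization.oreDiv m 1)
        fun a b => (OreLocalization.add_oreDiv).symm)
      (fun a m => by
        refine Eq.symm ((OreLocalization.oreDiv_smul_char a m 1 1 a 1 ?_).trans ?_)
        · simp
        · rw [mul_one]; rfl) hm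
    have h2 : OreLocalization.oreDiv m (1 : Submonoid.powers ħ) = OreLocalization.oreDiv 0 1 :=
      h1.trans (OreLocalization.zero_oreDiv 1).symm
    obtain ⟨s, t, h3, h4⟩ := OreLocalization.oreDiv_eq_iff.1 h2
    refine ⟨s.2.choose, ?_⟩
    have h5 : (s : R) = t := by simpa using h4
    have h6 : (ħ ^ s.2.choose : R) = s := s.2.choose_spec
    rw [h6, h5, ← h3]
    exact smul_zero s
  surj x := by
    refine baseChange_induction (toHat 𝒜 ħ) M (P := fun x => ∃ (n : ℕ) (y : M),
      ħ ^ n • (show (res (toHat 𝒜 ħ)).obj (M.baseChange (toHat 𝒜 ħ)) from x) =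
        (baseChangeUnit (toHat 𝒜 ħ) M).lin y) x
        (exists_pow_smul_zero (u := baseChangeUnit (toHat 𝒜 ħ) M))
        (fun _ _ => exists_pow_smul_add) fun c m => ?_
    obtain ⟨n, a, ha⟩ := exists_toHat_mul 𝒜 c
    refine ⟨n, a • m, Eq.trans ?_ (map_smul _ a m).symm⟩
    change toHat 𝒜 ħ (ħ ^ n) • c • (show M.baseChange (toHat 𝒜 ħ) from
      (baseChangeUnit (toHat 𝒜 ħ) M).lin m) = _
    rw [smul_smul, ha]
    rfl

end GrMod

/-! ### Graded Ext groups and localization -/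

namespace GrMod

section

variable {G : Type u} [AddCommGroup G] [DecidableEq G] {A : Type u} [Ring A]
  {𝒜 : G → AddSubgroup A}

theorem exists_lift_of_injective {W Y Z : GrMod 𝒜} (g : W ⟶ Z) (f : Y ⟶ Z)
    (hf : Function.Injective f.lin) (h : ∀ w, ∃ y, f.lin y = g.lin w) : ∃ l : W ⟶ Y, l ≫ f = g := by
  choose l hl using h
  refine ⟨⟨{ toFun := l, map_add' := fun x y => hf ?_, map_smul' := fun a x => hf ?_ },
    fun hx => mem_deg_of_injective f hf ?_⟩, hom_ext hl⟩
  · rw [map_add, hl, hl, hl, map_add]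
  · rw [RingHom.id_apply, map_smul, hl, hl, map_smul]
  · exact (hl _).symm ▸ g.map_mem hx

theorem rightMul_apply [GradedRing 𝒜] {γ η δ : G} (h : γ + δ = η) {a : A} (ha : a ∈ 𝒜 δ) (x : A) :
    (show A from (rightMul 𝒜 γ η a).lin x) = x * a := by
  have h1 : GradedRing.proj 𝒜 (η - γ) a = a :=
    DirectSum.decompose_of_mem_same 𝒜 (by rwa [← h, add_sub_cancel_left])
  change x * GradedRing.proj 𝒜 (η - γ) a = _
  rw [h1]

theorem rightMul_comp_of_add [GradedRing 𝒜] {γ η θ δ δ' : G} (h : γ + δ = η)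
    (h' : η + δ' = θ) {a b : A} (ha : a ∈ 𝒜 δ) (hb : b ∈ 𝒜 δ') :
    rightMul 𝒜 γ η a ≫ rightMul 𝒜 η θ b = rightMul 𝒜 γ θ (a * b) :=
  rightMul_comp (by rwa [← h, add_sub_cancel_left]) (by rwa [← h', add_sub_cancel_left])

end

variable {G : Type u} [AddCommGroup G] [DecidableEq G] {R : Type u} [Ring R]
  {𝒜 : G → AddSubgroup R} [GradedRing 𝒜] {ħ : R} [hn : IsRegularNormal ħ]

variable (𝒜) in
theorem exists_mul_toHat (c : RHat ħ) : ∃ (n : ℕ) (a : R), c * toHat 𝒜 ħ (ħ ^ n) = toHat 𝒜 ħ a := by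
  obtain ⟨n, a, ha⟩ := exists_toHat_mul 𝒜 c
  obtain ⟨b, hb⟩ := exists_mul_pow_eq (ħ := ħ) n a
  refine ⟨n, b, ?_⟩
  have h1 : toHat 𝒜 ħ (ħ ^ n) * (c * toHat 𝒜 ħ (ħ ^ n)) = toHat 𝒜 ħ (ħ ^ n) * toHat 𝒜 ħ b := by
    rw [← mul_assoc, ha, ← map_mul, ← map_mul, hb]
  have h2 := congrArg (hatInv ħ n * ·) h1
  simpa only [← mul_assoc, hatInv_mul_toHat, one_mul] using h2

variable [hħ : Fact (SetLike.IsHomogeneousElem 𝒜 ħ)]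

variable (𝒜 ħ) in
/-- The inclusion `R(γ) ⟶ R[ħ⁻¹](γ)`. -/
def hatι (γ : G) : (self 𝒜).shift γ ⟶ (res (toHat 𝒜 ħ)).obj ((self (hatGrading 𝒜 ħ)).shift γ) :=
  ⟨{ toFun := fun a => toHat 𝒜 ħ a
     map_add' := fun a b => map_add (toHat 𝒜 ħ) a b
     map_smul' := fun a b => map_mul (toHat 𝒜 ħ) a b }, fun hx => (toHat 𝒜 ħ).map_mem hx⟩

variable (𝒜 ħ) in
/-- Right multiplication by `ħ ^ n`, a morphism `R[ħ⁻¹](γ) ⟶ R[ħ⁻¹](η)` of graded `R`-modules. -/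
abbrev hatMul (n : ℕ) (γ η : G) :
    (res (toHat 𝒜 ħ)).obj ((self (hatGrading 𝒜 ħ)).shift γ) ⟶
      (res (toHat 𝒜 ħ)).obj ((self (hatGrading 𝒜 ħ)).shift η) :=
  (res (toHat 𝒜 ħ)).map (rightMul (hatGrading 𝒜 ħ) γ η (toHat 𝒜 ħ (ħ ^ n)))

theorem hatι_injective (γ : G) : Function.Injective (hatι 𝒜 ħ γ).lin := toHat_injective 𝒜

theorem hatMul_apply {ε : G} (hε : ħ ∈ 𝒜 ε) {n : ℕ} {γ η : G} (h : γ + n • ε = η)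
    (x : RHat ħ) :
    (show RHat ħ from (hatMul 𝒜 ħ n γ η).lin x) = x * toHat 𝒜 ħ (ħ ^ n) :=
  rightMul_apply h ((toHat 𝒜 ħ).map_mem (SetLike.pow_mem_graded n hε)) x

theorem hatι_comp_hatMul {ε : G} (hε : ħ ∈ 𝒜 ε) {n : ℕ} {γ η : G} (h : γ + n • ε = η) :
    hatι 𝒜 ħ γ ≫ hatMul 𝒜 ħ n γ η = rightMul 𝒜 γ η (ħ ^ n) ≫ hatι 𝒜 ħ η := by
  refine hom_ext fun (x : R) => ?_
  refine (hatMul_apply hε h (toHat 𝒜 ħ x)).trans ?_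
  refine (map_mul (toHat 𝒜 ħ) x (ħ ^ n)).symm.trans (congrArg (toHat 𝒜 ħ) ?_)
  exact (rightMul_apply h (SetLike.pow_mem_graded n hε) x).symm

theorem hatMul_inv {ε : G} (hε : ħ ∈ 𝒜 ε) {n : ℕ} {γ η : G} (h : γ + n • ε = η) :
    hatMul 𝒜 ħ n γ η ≫ (res (toHat 𝒜 ħ)).map
    (rightMul (hatGrading 𝒜 ħ) η γ (hatInv ħ n)) = 𝟙 _ := by
  have h1 := rightMul_comp_of_add (𝒜 := hatGrading 𝒜 ħ) h (δ' := -(n • ε))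
    (by rw [← h, add_neg_cancel_right]) ((toHat 𝒜 ħ).map_mem (SetLike.pow_mem_graded n hε))
    (hatInv_mem 𝒜 hε n)
  have h2 := toHat_mul_hatInv 𝒜 (ħ := ħ) n
  refine ((res (toHat 𝒜 ħ)).map_comp _ _).symm.trans ?_
  refine (congrArg (res (toHat 𝒜 ħ)).map (h1.trans ?_)).trans ((res (toHat 𝒜 ħ)).map_id _)
  exact (congrArg (rightMul (hatGrading 𝒜 ħ) γ γ) h2).trans (rightMul_one γ)

/-- A morphism from a finitely generated module to `R[ħ⁻¹]` has a common denominator. -/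
theorem exists_comp_hatMul_eq {ε : G} (hε : ħ ∈ 𝒜 ε) (M : GrMod 𝒜) [hM : Module.Finite R M] {γ : G}
    (f : M ⟶ (res (toHat 𝒜 ħ)).obj ((self (hatGrading 𝒜 ħ)).shift γ)) :
    ∃ (n : ℕ) (η : G) (_ : γ + n • ε = η) (g : M ⟶ (self 𝒜).shift η),
      f ≫ hatMul 𝒜 ħ n γ η = g ≫ hatι 𝒜 ħ η := by
  have h1 : ∀ m, ∃ (n : ℕ) (a : R), (show RHat ħ from f.lin m) * toHat 𝒜 ħ (ħ ^ n) = toHat 𝒜 ħ a :=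
    fun m => exists_mul_toHat 𝒜 _
  obtain ⟨s, hs⟩ := hM.fg_top
  choose n a ha using h1
  let k := s.sup n
  have h2 : ∀ m, ∃ b : R, (show RHat ħ from f.lin m) * toHat 𝒜 ħ (ħ ^ k) = toHat 𝒜 ħ b := by
    intro m
    have hm : m ∈ Submodule.span R (s : Set M) := hs ▸ Submodule.mem_top
    induction hm using Submodule.span_induction with
    | mem m h =>
      have : ħ ^ k = ħ ^ n m * ħ ^ (k - n m) := by
        rw [← pow_add, Nat.add_sub_cancel' (Finset.le_sup h)]
      refine ⟨a m * ħ ^ (k - n m), ?_⟩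
      rw [this, map_mul, ← mul_assoc, ha, map_mul]
    | zero => exact ⟨0, by rw [map_zero, map_zero]; exact zero_mul _⟩
    | add x y _ _ hx hy =>
      obtain ⟨b, hb⟩ := hx
      obtain ⟨c, hc⟩ := hy
      refine ⟨b + c, ?_⟩
      rw [map_add, map_add, ← hb, ← hc]
      exact add_mul (show RHat ħ from f.lin x) (f.lin y) _
    | smul r x _ hx =>
      obtain ⟨b, hb⟩ := hx
      refine ⟨r * b, ?_⟩
      rw [map_smul, map_mul, ← hb]
      exact mul_assoc (toHat 𝒜 ħ r) (show RHat ħ from f.lin x) _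
  obtain ⟨g, hg⟩ := exists_lift_of_injective (f ≫ hatMul 𝒜 ħ k γ (γ + k • ε)) (hatι 𝒜 ħ (γ + k • ε))
    (hatι_injective _) fun m => by
      obtain ⟨b, hb⟩ := h2 m
      exact ⟨b, hb.symm.trans (hatMul_apply hε rfl _).symm⟩
  exact ⟨k, _, rfl, g, hg.symm⟩

open Abelian

/-- Extension classes of a finitely generated module by `R[ħ⁻¹]` have common denominators. -/
theorem exists_comp_hatMul_ext_eq (hl : IsLeftGNoetherian 𝒜) {ε : G} (hε : ħ ∈ 𝒜 ε) (i : ℕ)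
    (M : GrMod 𝒜) [Module.Finite R M] {γ : G}
    (x : Ext.{u} M ((res (toHat 𝒜 ħ)).obj ((self (hatGrading 𝒜 ħ)).shift γ)) i) :
    ∃ (n : ℕ) (η : G) (_ : γ + n • ε = η) (y : Ext.{u} M ((self 𝒜).shift η) i),
      x.comp (Ext.mk₀ (hatMul 𝒜 ħ n γ η)) (add_zero i) =
        y.comp (Ext.mk₀ (hatι 𝒜 ħ η)) (add_zero i) := by
  induction i generalizing M γ with
  | zero =>
    obtain ⟨f, rfl⟩ := (Ext.mk₀_bijective _ _).2 x
    obtain ⟨n, η, h, g, hg⟩ := exists_comp_hatMul_eq hε M f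
    exact ⟨n, η, h, Ext.mk₀ g, by rw [Ext.mk₀_comp_mk₀, Ext.mk₀_comp_mk₀, hg]⟩
  | succ i ih =>
    obtain ⟨ι, _, d, p, hp⟩ := exists_free_cover 𝒜 M
    have hK : Module.Finite R (kerComplex p).X₁ :=
      (isGNoetherian_of_finite hl (free 𝒜 d)).finite_sub _ (isHomogeneous_ker p)
    have hS := kerComplex_shortExact p hp
    obtain ⟨z, rfl⟩ := Ext.contravariant_sequence_exact₃ hS _ x
      (Ext.eq_zero_of_projective (P := free 𝒜 d) _) (add_comm 1 i)
    obtain ⟨n, η, h, y, hy⟩ := ih (kerComplex p).X₁ z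
    refine ⟨n, η, h, hS.extClass.comp y (add_comm 1 i), ?_⟩
    rw [Ext.comp_assoc_of_third_deg_zero, Ext.comp_assoc_of_third_deg_zero, hy]

/-- The kernel of the map from `Ext^i(M, R)` to `Ext^i(M, R[ħ⁻¹])` is `ħ`-torsion. -/
theorem exists_comp_rightMul_eq_zero (hl : IsLeftGNoetherian 𝒜) {ε : G} (hε : ħ ∈ 𝒜 ε) (i : ℕ)
    (M : GrMod 𝒜) [Module.Finite R M] {γ : G} (y : Ext.{u} M ((self 𝒜).shift γ) i)
    (hy : y.comp (Ext.mk₀ (hatι 𝒜 ħ γ)) (add_zero i) = 0) :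
    ∃ (n : ℕ) (η : G) (_ : γ + n • ε = η),
      y.comp (Ext.mk₀ (rightMul 𝒜 γ η (ħ ^ n))) (add_zero i) = 0 := by
  induction i generalizing M γ with
  | zero =>
    have := mono_of_injective _ (hatι_injective (𝒜 := 𝒜) (ħ := ħ) γ)
    have h0 : y = 0 := Ext.postcomp_mk₀_injective_of_mono M (hatι 𝒜 ħ γ)
      (hy.trans (map_zero _).symm)
    exact ⟨0, γ, by rw [zero_smul, add_zero], by rw [h0, Ext.zero_comp]⟩
  | succ i ih =>
    obtain ⟨ι, _, d, p, hp⟩ := exists_free_cover 𝒜 M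
    have hK : Module.Finite R (kerComplex p).X₁ :=
      (isGNoetherian_of_finite hl (free 𝒜 d)).finite_sub _ (isHomogeneous_ker p)
    have hS := kerComplex_shortExact p hp
    obtain ⟨z, rfl⟩ := Ext.contravariant_sequence_exact₃ hS _ y
      (Ext.eq_zero_of_projective (P := free 𝒜 d) _) (add_comm 1 i)
    rw [Ext.comp_assoc_of_third_deg_zero] at hy
    obtain ⟨w, hw⟩ := Ext.contravariant_sequence_exact₁ hS _ _ (add_comm 1 i) hy
    -- The class `z` of the syzygy becomes zero over `R[ħ⁻¹]` only up to a class `w` that extends to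
    -- the free module; a power of `ħ` clears its denominators, giving `w'` over `R`.
    obtain ⟨n, η, h, w', hw'⟩ := exists_comp_hatMul_ext_eq hl hε i (free 𝒜 d) w
    have h1 : (z.comp (Ext.mk₀ (rightMul 𝒜 γ η (ħ ^ n))) (add_zero i) -
        (Ext.mk₀ (kerComplex p).f).comp w' (zero_add i)).comp (Ext.mk₀ (hatι 𝒜 ħ η))
          (add_zero i) = 0 := by
      rw [sub_eq_add_neg, Ext.add_comp, Ext.neg_comp, ← sub_eq_add_neg,
        Ext.comp_assoc_of_third_deg_zero, Ext.comp_assoc_of_third_deg_zero,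
        Ext.mk₀_comp_mk₀, ← hatι_comp_hatMul hε h, ← Ext.mk₀_comp_mk₀,
        ← Ext.comp_assoc_of_third_deg_zero, ← hw, Ext.comp_assoc_of_third_deg_zero, hw', sub_self]
    obtain ⟨m, θ, h', h2⟩ := ih (kerComplex p).X₁ _ h1
    refine ⟨n + m, θ, by rw [add_smul, ← add_assoc, h, h'], ?_⟩
    rw [pow_add, ← rightMul_comp_of_add h h' (SetLike.pow_mem_graded n hε)
      (SetLike.pow_mem_graded m hε), ← Ext.mk₀_comp_mk₀, ← Ext.comp_assoc_of_third_deg_zero,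
      Ext.comp_assoc_of_third_deg_zero _ z]
    have h3 : hS.extClass.comp (z.comp (Ext.mk₀ (rightMul 𝒜 γ η (ħ ^ n))) (add_zero i))
        (add_comm 1 i) = hS.extClass.comp (z.comp (Ext.mk₀ (rightMul 𝒜 γ η (ħ ^ n))) (add_zero i) -
        (Ext.mk₀ (kerComplex p).f).comp w' (zero_add i)) (add_comm 1 i) := by
      rw [sub_eq_add_neg, Ext.comp_add, Ext.comp_neg, ShortComplex.ShortExact.extClass_comp_assoc,
        neg_zero, add_zero]
    rw [h3, Ext.comp_assoc_of_third_deg_zero, h2, Ext.comp_zero]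

/-- Clearing denominators moves a class of `Ext^i(M[ħ⁻¹], R[ħ⁻¹])` into the image of
`Ext^i(M, R)`. -/
theorem extVanish_hat (hl : IsLeftGNoetherian 𝒜) (M : GrMod 𝒜) [Module.Finite R M] {i : ℕ}
    (hM : M.ExtVanish i) : (M.baseChange (toHat 𝒜 ħ)).ExtVanish i := by
  obtain ⟨ε, hε⟩ := hħ.out
  intro γ x
  refine ((isHat_baseChange M).comparison i _).1 (Eq.trans ?_ (map_zero _).symm)
  generalize extComparison (res (toHat 𝒜 ħ)) (baseChangeUnit (toHat 𝒜 ħ) M) _ i x = z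
  obtain ⟨n, η, h, y, hy⟩ := exists_comp_hatMul_ext_eq hl hε i M z
  rw [hM η y, Ext.zero_comp] at hy
  rw [← Ext.comp_mk₀_id z, ← hatMul_inv hε h, ← Ext.mk₀_comp_mk₀,
    ← Ext.comp_assoc_of_third_deg_zero, hy, Ext.zero_comp]

/-- If `Ext^i(M[ħ⁻¹], R[ħ⁻¹])` vanishes, then `Ext^i(M, R)` is `ħ`-torsion. -/
theorem exists_pow_smul_uExt_eq_zero (hl : IsLeftGNoetherian 𝒜) (M : GrMod 𝒜) [Module.Finite R M]
    {i : ℕ} (hM : (M.baseChange (toHat 𝒜 ħ)).ExtVanish i) (e : M.uExt i) :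
    ∃ n : ℕ, MulOpposite.op (ħ ^ n) • e = 0 := by
  obtain ⟨ε, hε⟩ := hħ.out
  induction e using uExt_induction with
  | zero => exact ⟨0, smul_zero _⟩
  | of γ x =>
    obtain ⟨y, hy⟩ := ((isHat_baseChange M).comparison i ((self (hatGrading 𝒜 ħ)).shift γ)).2
      (x.comp (Ext.mk₀ (hatι 𝒜 ħ γ)) (add_zero i))
    rw [hM γ y, map_zero] at hy
    obtain ⟨n, η, h, hx⟩ := exists_comp_rightMul_eq_zero hl hε i M x hy.symm
    exact ⟨n, by rw [op_smul_uof h (SetLike.pow_mem_graded n hε), hx, map_zero]⟩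
  | add x y hx hy =>
    obtain ⟨n, hx⟩ := hx
    obtain ⟨m, hy⟩ := hy
    refine ⟨n + m, ?_⟩
    rw [smul_add]
    nth_rewrite 2 [add_comm n]
    rw [pow_add, pow_add, MulOpposite.op_mul, MulOpposite.op_mul, mul_smul, mul_smul, hx, hy,
      smul_zero, smul_zero, add_zero]

end GrMod

/-! ### The graded Nakayama lemma -/

namespace GrMod

section

variable {G : Type u} [AddCommGroup G] [DecidableEq G] {A : Type u} [Ring A]
  {𝒜 : G → AddSubgroup A}

theorem comp_smul_of_mem (X : GrMod 𝒜) {δ : G} {a : A} (ha : a ∈ 𝒜 δ) (γ : G) (x : X) :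
    X.comp (γ + δ) (a • x) = a • X.comp γ x :=
  comp_addHom (DistribSMul.toAddMonoidHom X a) δ (fun γ _ hx => add_comm δ γ ▸ X.smul_mem ha hx) γ x

theorem comp_smul_of_mem_deg [GradedRing 𝒜] (X : GrMod 𝒜) {δ : G} {x : X} (hx : x ∈ X.deg δ) (γ : G)
    (a : A) : X.comp (γ + δ) (a • x) = GradedRing.proj 𝒜 γ a • x :=
  (comp_addHom (X := self 𝒜)
    (show self 𝒜 →+ X from (LinearMap.toSpanSingleton A X x).toAddMonoidHom) δ
    (fun _ _ ha => X.smul_mem ha hx) γ a).trans (congrArg (fun b : A => b • x) (self_comp 𝒜 γ a))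

end

variable {G : Type u} [AddCommGroup G] [DecidableEq G] {R : Type u} [Ring R]
  {𝒜 : G → AddSubgroup R} [GradedRing 𝒜]

theorem exists_le_isMaximalHomogeneous {I : Ideal R} (hI : I.IsHomogeneous 𝒜) (h : I ≠ ⊤) :
    ∃ J, I ≤ J ∧ IsMaximalHomogeneous 𝒜 J := by
  have hub : ∀ c ⊆ {I : Ideal R | I.IsHomogeneous 𝒜 ∧ I ≠ ⊤}, IsChain (· ≤ ·) c → ∀ K ∈ c,
      ∃ L ∈ {I : Ideal R | I.IsHomogeneous 𝒜 ∧ I ≠ ⊤}, ∀ z ∈ c, z ≤ L := by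
    intro c hc hchain K hK
    refine ⟨sSup c, ⟨fun γ x hx => ?_, fun htop => ?_⟩, fun L hL => le_sSup hL⟩
    · obtain ⟨L, hL, hx⟩ := (Submodule.mem_sSup_of_directed ⟨K, hK⟩ hchain.directedOn).1 hx
      exact (Submodule.mem_sSup_of_directed ⟨K, hK⟩ hchain.directedOn).2 ⟨L, hL, (hc hL).1 γ hx⟩
    · have h1 : (1 : R) ∈ sSup c := htop ▸ Submodule.mem_top
      obtain ⟨L, hL, h1⟩ := (Submodule.mem_sSup_of_directed ⟨K, hK⟩ hchain.directedOn).1 h1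
      exact (hc hL).2 ((Ideal.eq_top_iff_one L).2 h1)
  obtain ⟨J, hIJ, hJ⟩ := zorn_le_nonempty₀ _ hub I ⟨hI, h⟩
  refine ⟨J, hIJ, hJ.prop.1, hJ.prop.2, fun K hK hJK => ?_⟩
  by_contra hne
  exact absurd (hJ.le_of_ge ⟨hK, hne⟩ hJK.le) (not_le_of_gt hJK)

theorem exists_mul_one_sub_eq_one {b : R} (hb : b ∈ jacobsonG 𝒜) (h0 : b ∈ 𝒜 0) :
    ∃ u ∈ 𝒜 0, u * (1 - b) = 1 := by
  have hmem : 1 - b ∈ 𝒜 0 := sub_mem (SetLike.one_mem_graded 𝒜) h0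
  have h1 : Ideal.span {1 - b} = ⊤ := by
    by_contra hne
    obtain ⟨J, hJ, hmax⟩ := exists_le_isMaximalHomogeneous (𝒜 := 𝒜)
      (Ideal.homogeneous_span 𝒜 _ fun x hx => ⟨0, (Set.mem_singleton_iff.1 hx) ▸ hmem⟩) hne
    have h2 : b ∈ J := (Submodule.mem_sInf.1 hb) J hmax
    have h3 : 1 - b ∈ J := hJ (Ideal.mem_span_singleton_self _)
    exact hmax.2.1 ((Ideal.eq_top_iff_one J).2 (by simpa using add_mem h3 h2))
  obtain ⟨u, hu⟩ := Ideal.mem_span_singleton'.1 ((Ideal.eq_top_iff_one _).1 h1)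
  refine ⟨GradedRing.proj 𝒜 0 u, SetLike.coe_mem _, ?_⟩
  have h4 : GradedRing.proj 𝒜 (0 + 0) (u * (1 - b)) = GradedRing.proj 𝒜 0 u * (1 - b) :=
    DirectSum.coe_decompose_mul_add_of_right_mem 𝒜 hmem
  rw [← h4, hu, add_zero]
  exact DirectSum.decompose_of_mem_same 𝒜 (SetLike.one_mem_graded 𝒜)

/-- Elements `1 - b`, with `b` of degree zero in the Jacobson radical, are right invertible. -/
theorem exists_one_sub_mul_eq_one {b : R} (hb : b ∈ jacobsonG 𝒜) (h0 : b ∈ 𝒜 0) :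
    ∃ u, (1 - b) * u = 1 := by
  obtain ⟨u, hu0, hu⟩ := exists_mul_one_sub_eq_one hb h0
  -- The left inverse `u = 1 + u b` is again of the form `1 - b'`, hence has a left inverse itself.
  have hb' : -(u * b) ∈ jacobsonG 𝒜 := neg_mem (Ideal.mul_mem_left _ u hb)
  have h0' : -(u * b) ∈ 𝒜 0 := neg_mem (by simpa using SetLike.mul_mem_graded hu0 h0)
  obtain ⟨v, _, hv⟩ := exists_mul_one_sub_eq_one hb' h0'
  have h1 : 1 - -(u * b) = u := by
    rw [mul_sub, mul_one] at hu
    rw [sub_neg_eq_add, ← hu, sub_add_cancel]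
  rw [h1] at hv
  have h2 : v = 1 - b := by
    calc v = v * (u * (1 - b)) := by rw [hu, mul_one]
      _ = 1 - b := by rw [← mul_assoc, hv, one_mul]
  exact ⟨u, h2 ▸ hv⟩

/-- The graded Nakayama lemma for right modules and a homogeneous element `ħ` of the radical. If the
homogeneous generator `x` is written as `f ħ`, then the degree zero part of its coefficient in `f ħ`
lies in the radical, so that `x` is redundant. -/
theorem subsingleton_of_mul_surjective (E : GrMod (opGrading 𝒜)) [Module.Finite Rᵐᵒᵖ E] {ħ : R}
    {ε : G} (hε : ħ ∈ 𝒜 ε) (hJ : ħ ∈ jacobsonG 𝒜)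
    (hE : ∀ e : E, ∃ f : E, e = MulOpposite.op ħ • f) : Subsingleton E := by
  classical
  have key : ∀ s : Finset E, (∀ x ∈ s, ∃ δ, x ∈ E.deg δ) →
      Submodule.span Rᵐᵒᵖ (s : Set E) = ⊤ → Subsingleton E := by
    intro s
    induction s using Finset.induction_on with
    | empty =>
      intro _ h
      rw [Finset.coe_empty, Submodule.span_empty] at h
      exact subsingleton_of_forall_eq 0 fun x => (Submodule.mem_bot Rᵐᵒᵖ).1 (h ▸ Submodule.mem_top)
    | insert x t _ ih =>
      intro hs h
      have ht : ∀ x ∈ t, ∃ δ, x ∈ E.deg δ := fun x hx => hs x (Finset.mem_insert_of_mem hx)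
      refine ih ht ?_
      have hx : x ∈ Submodule.span Rᵐᵒᵖ (t : Set E) := by
        obtain ⟨δ, hδ⟩ := hs x (Finset.mem_insert_self x t)
        obtain ⟨f, hf⟩ := hE x
        have hfm : f ∈ Submodule.span Rᵐᵒᵖ (insert x (t : Set E)) := by
          rw [← Finset.coe_insert, h]; trivial
        obtain ⟨c, z, hz, rfl⟩ := Submodule.mem_span_insert.1 hfm
        have h1 : x = GradedRing.proj (opGrading 𝒜) 0 (MulOpposite.op ħ * c) • x +
            E.comp δ (MulOpposite.op ħ • z) := by
          rw [← comp_smul_of_mem_deg E hδ 0, zero_add, mul_smul, ← map_add, ← smul_add, ← hf,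
            comp_same _ hδ]
        have h2 : E.comp δ (MulOpposite.op ħ • z) ∈ Submodule.span Rᵐᵒᵖ (t : Set E) :=
          isHomogeneous_iff.1 (isHomogeneous_span E (t : Set E) ht) δ _ (Submodule.smul_mem _ _ hz)
        let b : R := (GradedRing.proj (opGrading 𝒜) 0 (MulOpposite.op ħ * c)).unop
        have hb0 : b ∈ 𝒜 0 := SetLike.coe_mem
          (DirectSum.decompose (opGrading 𝒜) (MulOpposite.op ħ * c) 0)
        have hb : b = (GradedRing.proj (opGrading 𝒜) (-ε) c).unop * ħ := by
          have h3 : GradedRing.proj (opGrading 𝒜) (ε + -ε) (MulOpposite.op ħ * c) =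
              MulOpposite.op ħ * GradedRing.proj (opGrading 𝒜) (-ε) c :=
            DirectSum.coe_decompose_mul_add_of_left_mem (opGrading 𝒜)
              (show MulOpposite.op ħ ∈ opGrading 𝒜 ε from hε)
          rw [add_neg_cancel] at h3
          exact congrArg MulOpposite.unop h3
        obtain ⟨u, hu⟩ := exists_one_sub_mul_eq_one (hb ▸ Ideal.mul_mem_left _ _ hJ) hb0
        have h4 : MulOpposite.op (1 - b) • x ∈ Submodule.span Rᵐᵒᵖ (t : Set E) := by
          have : MulOpposite.op (1 - b) • x = E.comp δ (MulOpposite.op ħ • z) := by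
            rw [MulOpposite.op_sub, MulOpposite.op_one, sub_smul, one_smul, sub_eq_iff_eq_add']
            exact h1
          rwa [this]
        have h5 := Submodule.smul_mem _ (MulOpposite.op u) h4
        rwa [smul_smul, ← MulOpposite.op_mul, hu, MulOpposite.op_one, one_smul] at h5
      rw [eq_top_iff, ← h, Submodule.span_le, Finset.coe_insert]
      exact Set.insert_subset hx Submodule.subset_span
  obtain ⟨s, hs, h⟩ := E.exists_finset_homogeneous
  exact key s hs h

/-! ### Graded Ext groups and reduction modulo a regular normal element -/

variable {ħ : R} [hn : IsRegularNormal ħ] [hħ : Fact (SetLike.IsHomogeneousElem 𝒜 ħ)]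

variable (𝒜 ħ) in
/-- The projection `R(γ) ⟶ (R / ħ R)(γ)`. -/
def barπ (γ : G) : (self 𝒜).shift γ ⟶ (res (toBar 𝒜 ħ)).obj ((self (barGrading 𝒜 ħ)).shift γ) :=
  ⟨{ toFun := fun a => toBar 𝒜 ħ a
     map_add' := fun a b => map_add (toBar 𝒜 ħ) a b
     map_smul' := fun a b => map_mul (toBar 𝒜 ħ) a b }, fun hx => (toBar 𝒜 ħ).map_mem hx⟩

theorem rightMul_barπ {ε : G} (hε : ħ ∈ 𝒜 ε) {γ η : G} (h : γ + ε = η) :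
    rightMul 𝒜 γ η ħ ≫ barπ 𝒜 ħ η = 0 :=
  hom_ext fun (x : R) => (congrArg (toBar 𝒜 ħ) (rightMul_apply h hε x)).trans (by
    rw [map_mul, toBar_self, mul_zero]; rfl)

/-- The sequence `0 → R(γ) → R(γ + ε) → (R / ħ R)(γ + ε) → 0` given by right multiplication
by `ħ`. -/
abbrev barComplex {ε : G} (hε : ħ ∈ 𝒜 ε) {γ η : G} (h : γ + ε = η) : ShortComplex (GrMod 𝒜) :=
  ShortComplex.mk _ _ (rightMul_barπ hε h)

theorem barComplex_shortExact {ε : G} (hε : ħ ∈ 𝒜 ε) {γ η : G} (h : γ + ε = η) :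
    (barComplex hε h).ShortExact :=
  shortExact_mk
    (fun x y hxy => by
      have h1 : (show R from x) * ħ = (show R from y) * ħ :=
        (rightMul_apply h hε x).symm.trans (Eq.trans hxy (rightMul_apply h hε y))
      exact hn.regular.right h1)
    (show Function.Surjective (toBar 𝒜 ħ) from toBar_surjective)
    fun (x : (self 𝒜).shift η) hx => by
      obtain ⟨b, rfl⟩ := (toBar_eq_zero (𝒜 := 𝒜)).1 hx
      obtain ⟨c, hc⟩ := hn.left_mul b
      exact ⟨(c : R), (rightMul_apply h hε c).trans hc.symm⟩

open Abelian

/-- The isomorphism `Ext^i(M / ħ M, (R / ħ R)(γ)) ≃ Ext^i(M, (R / ħ R)(γ))`. -/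
def barComparison (M : GrMod 𝒜) (hM : ∀ x : M, ħ • x = 0 → x = 0) (i : ℕ) (γ : G) :
    Ext.{u} (M.baseChange (toBar 𝒜 ħ)) ((self (barGrading 𝒜 ħ)).shift γ) i ≃+
      Ext.{u} M ((res (toBar 𝒜 ħ)).obj ((self (barGrading 𝒜 ħ)).shift γ)) i :=
  AddEquiv.ofBijective _ ((isBar_baseChange M hM).comparison i _)

theorem barComparison_comp_mk₀ (M : GrMod 𝒜) (hM : ∀ x : M, ħ • x = 0 → x = 0) {i : ℕ} {γ η : G}
    (x : Ext.{u} (M.baseChange (toBar 𝒜 ħ)) ((self (barGrading 𝒜 ħ)).shift γ) i)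
    (g : (self (barGrading 𝒜 ħ)).shift γ ⟶ (self (barGrading 𝒜 ħ)).shift η) :
    barComparison M hM i η (x.comp (Ext.mk₀ g) (add_zero i)) =
      (barComparison M hM i γ x).comp (Ext.mk₀ ((res (toBar 𝒜 ħ)).map g)) (add_zero i) :=
  extComparison_comp_mk₀ (res (toBar 𝒜 ħ)) (baseChangeUnit (toBar 𝒜 ħ) M) g x

/-- The exactness of `Ext^i(M, R) → Ext^i(M, R) → Ext^i(M, R / ħ R)`, whose first map is
multiplication by `ħ`. -/
theorem exists_uExt_eq_smul (M : GrMod 𝒜) (hM : ∀ x : M, ħ • x = 0 → x = 0) {i : ℕ}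
    (h : (M.baseChange (toBar 𝒜 ħ)).ExtVanish i) (e : M.uExt i) :
    ∃ f : M.uExt i, e = MulOpposite.op ħ • f := by
  obtain ⟨ε, hε⟩ := hħ.out
  induction e using uExt_induction with
  | zero => exact ⟨0, (smul_zero _).symm⟩
  | of γ x =>
    obtain ⟨y, rfl⟩ := Ext.covariant_sequence_exact₂ M
      (barComplex_shortExact hε (sub_add_cancel γ ε)) x (by
        obtain ⟨z, hz⟩ := (barComparison M hM i γ).surjective
          (x.comp (Ext.mk₀ (barπ 𝒜 ħ γ)) (add_zero i))
        exact hz.symm.trans ((congrArg _ (h γ z)).trans (map_zero _)))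
    exact ⟨uof M i (γ - ε) y, (op_smul_uof (sub_add_cancel γ ε) hε y).symm⟩
  | add x y hx hy =>
    obtain ⟨a, rfl⟩ := hx
    obtain ⟨b, rfl⟩ := hy
    exact ⟨a + b, (smul_add _ _ _).symm⟩

/-- If `ħ` lies in the Jacobson radical, the vanishing of graded Ext groups lifts along reduction
modulo `ħ`. -/
theorem extVanish_of_bar (hl : IsLeftGNoetherian 𝒜) (hr : IsRightGNoetherian 𝒜)
    (hJ : ħ ∈ jacobsonG 𝒜) (M : GrMod 𝒜) [Module.Finite R M] (hM : ∀ x : M, ħ • x = 0 → x = 0)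
    {i : ℕ} (h : (M.baseChange (toBar 𝒜 ħ)).ExtVanish i) : M.ExtVanish i := by
  obtain ⟨ε, hε⟩ := hħ.out
  have := (isGNoetherian_uExt hl hr i M).finite
  exact (extVanish_iff M i).2 (subsingleton_of_mul_surjective (M.uExt i) hε hJ
    (exists_uExt_eq_smul M hM h))

end GrMod

/-! ### The automorphism given by conjugation with a power of a regular normal element -/

namespace GrMod

variable {G : Type u} {R : Type u} [Ring R] {𝒜 : G → AddSubgroup R} {ħ : R}
  [hn : IsRegularNormal ħ]

theorem mul_pow_cancel (n : ℕ) {a b : R} (h : a * ħ ^ n = b * ħ ^ n) : a = b :=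
  (hn.regular.pow n).right h

theorem pow_mul_cancel (n : ℕ) {a b : R} (h : ħ ^ n * a = ħ ^ n * b) : a = b :=
  (hn.regular.pow n).left h

/-- An endomorphism of `R` that fixes `ħ` induces one of the opposite of `R / ħ R`. -/
def opBarMap (φ : 𝒜 →+*ᵍ 𝒜) (h : φ ħ = ħ) :
    opGrading (barGrading 𝒜 ħ) →+*ᵍ opGrading (barGrading 𝒜 ħ) where
  toRingHom := RingHom.op (Ideal.Quotient.lift (Ideal.span {ħ})
    ((toBar 𝒜 ħ).toRingHom.comp φ.toRingHom) fun a ha => by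
      obtain ⟨b, rfl⟩ := mem_span_iff.1 ha
      change toBar 𝒜 ħ (φ (ħ * b)) = 0
      rw [map_mul, h, map_mul, toBar_self, zero_mul])
  map_mem := by
    rintro γ x ⟨a, ha, hx⟩
    obtain rfl : MulOpposite.op (toBar 𝒜 ħ a) = x := congrArg MulOpposite.op hx
    exact (toBar 𝒜 ħ).map_mem (φ.map_mem ha)

theorem opBarMap_apply (φ : 𝒜 →+*ᵍ 𝒜) (h : φ ħ = ħ) (a : R) :
    opBarMap φ h (MulOpposite.op (toBar 𝒜 ħ a)) = MulOpposite.op (toBar 𝒜 ħ (φ a)) := rfl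

variable (𝒜) in
theorem exists_op_toBar (a : (RBar ħ)ᵐᵒᵖ) : ∃ b : R, MulOpposite.op (toBar 𝒜 ħ b) = a := by
  obtain ⟨b, hb⟩ := toBar_surjective (𝒜 := 𝒜) a.unop
  exact ⟨b, congrArg MulOpposite.op hb⟩

variable (ħ) in
/-- The element `ħⁿ a ħ⁻ⁿ`. -/
def conjFun (n : ℕ) (a : R) : R := (exists_pow_mul_eq (ħ := ħ) n a).choose

theorem conjFun_mul_pow (n : ℕ) (a : R) : conjFun ħ n a * ħ ^ n = ħ ^ n * a :=
  (exists_pow_mul_eq (ħ := ħ) n a).choose_spec.symm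

variable (ħ) in
/-- The element `ħ⁻ⁿ a ħⁿ`. -/
def conjInvFun (n : ℕ) (a : R) : R := (exists_mul_pow_eq (ħ := ħ) n a).choose

theorem pow_mul_conjInvFun (n : ℕ) (a : R) : ħ ^ n * conjInvFun ħ n a = a * ħ ^ n :=
  (exists_mul_pow_eq (ħ := ħ) n a).choose_spec.symm

variable [AddCommGroup G] [DecidableEq G] [GradedRing 𝒜]

theorem mem_of_mul_pow_mem {ε γ : G} (hε : ħ ∈ 𝒜 ε) (n : ℕ) {a : R}
    (h : a * ħ ^ n ∈ 𝒜 (γ + n • ε)) : a ∈ 𝒜 γ := by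
  have h1 : GradedRing.proj 𝒜 (γ + n • ε) (a * ħ ^ n) = GradedRing.proj 𝒜 γ a * ħ ^ n :=
    DirectSum.coe_decompose_mul_add_of_right_mem 𝒜 (SetLike.pow_mem_graded n hε)
  have h2 : GradedRing.proj 𝒜 (γ + n • ε) (a * ħ ^ n) = a * ħ ^ n :=
    DirectSum.decompose_of_mem_same 𝒜 h
  rw [mul_pow_cancel n (h2.symm.trans h1)]
  exact SetLike.coe_mem _

theorem mem_of_pow_mul_mem {ε γ : G} (hε : ħ ∈ 𝒜 ε) (n : ℕ) {a : R}
    (h : ħ ^ n * a ∈ 𝒜 (n • ε + γ)) : a ∈ 𝒜 γ := by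
  have h1 : GradedRing.proj 𝒜 (n • ε + γ) (ħ ^ n * a) = ħ ^ n * GradedRing.proj 𝒜 γ a :=
    DirectSum.coe_decompose_mul_add_of_left_mem 𝒜 (SetLike.pow_mem_graded n hε)
  have h2 : GradedRing.proj 𝒜 (n • ε + γ) (ħ ^ n * a) = ħ ^ n * a :=
    DirectSum.decompose_of_mem_same 𝒜 h
  rw [pow_mul_cancel n (h2.symm.trans h1)]
  exact SetLike.coe_mem _

variable [hħ : Fact (SetLike.IsHomogeneousElem 𝒜 ħ)]

variable (𝒜 ħ) in
/-- The automorphism `a ↦ ħⁿ a ħ⁻ⁿ` of `R`. -/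
def conj (n : ℕ) : 𝒜 →+*ᵍ 𝒜 :=
  have h := fun a => (conjFun_mul_pow (ħ := ħ) n a).symm
  { toFun := conjFun ħ n
    map_one' := mul_pow_cancel (ħ := ħ) n (by rw [← h, mul_one, one_mul])
    map_zero' := mul_pow_cancel (ħ := ħ) n (by rw [← h, mul_zero, zero_mul])
    map_add' := fun a b => mul_pow_cancel (ħ := ħ) n (by rw [← h, add_mul, ← h, ← h, mul_add])
    map_mul' := fun a b => mul_pow_cancel (ħ := ħ) n (by
      rw [← h, mul_assoc, ← h b, ← mul_assoc (conjFun ħ n a), ← h a, mul_assoc])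
    map_mem := fun {γ a} ha => by
      obtain ⟨ε, hε⟩ := hħ.out
      have h2 : conjFun ħ n a ∈ 𝒜 γ := mem_of_mul_pow_mem hε n (by
        rw [← h, add_comm]
        exact SetLike.mul_mem_graded (SetLike.pow_mem_graded n hε) ha)
      exact h2 }

theorem conj_mul_pow (n : ℕ) (a : R) : conj 𝒜 ħ n a * ħ ^ n = ħ ^ n * a :=
  conjFun_mul_pow n a

variable (𝒜 ħ) in
/-- The automorphism `a ↦ ħ⁻ⁿ a ħⁿ` of `R`. -/
def conjInv (n : ℕ) : 𝒜 →+*ᵍ 𝒜 :=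
  have h := fun a => (pow_mul_conjInvFun (ħ := ħ) n a).symm
  { toFun := conjInvFun ħ n
    map_one' := pow_mul_cancel (ħ := ħ) n (by rw [← h, mul_one, one_mul])
    map_zero' := pow_mul_cancel (ħ := ħ) n (by rw [← h, mul_zero, zero_mul])
    map_add' := fun a b => pow_mul_cancel (ħ := ħ) n (by rw [← h, add_mul, h, h, mul_add])
    map_mul' := fun a b => pow_mul_cancel (ħ := ħ) n (by
      rw [← h, ← mul_assoc, ← h a, mul_assoc, mul_assoc, ← h b])
    map_mem := fun {γ a} ha => by
      obtain ⟨ε, hε⟩ := hħ.out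
      have h2 : conjInvFun ħ n a ∈ 𝒜 γ := mem_of_pow_mul_mem hε n (by
        rw [← h, add_comm]
        exact SetLike.mul_mem_graded ha (SetLike.pow_mem_graded n hε))
      exact h2 }

theorem pow_mul_conjInv (n : ℕ) (a : R) : ħ ^ n * conjInv 𝒜 ħ n a = a * ħ ^ n :=
  pow_mul_conjInvFun n a

variable (𝒜 ħ) in
/-- The automorphism of the opposite of `R / ħ R` induced by `a ↦ ħⁿ a ħ⁻ⁿ`. -/
def barTwist (n : ℕ) : GrRingIso (opGrading (barGrading 𝒜 ħ)) (opGrading (barGrading 𝒜 ħ)) where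
  hom := opBarMap (conj 𝒜 ħ n) (mul_pow_cancel n (by rw [conj_mul_pow, pow_mul_comm']))
  inv := opBarMap (conjInv 𝒜 ħ n) (pow_mul_cancel n (by rw [pow_mul_conjInv, pow_mul_comm']))
  hom_inv a := by
    obtain ⟨a, rfl⟩ := exists_op_toBar 𝒜 a
    rw [opBarMap_apply, opBarMap_apply]
    congr 2
    exact pow_mul_cancel (ħ := ħ) n (by rw [pow_mul_conjInv, conj_mul_pow])
  inv_hom a := by
    obtain ⟨a, rfl⟩ := exists_op_toBar 𝒜 a
    rw [opBarMap_apply, opBarMap_apply]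
    congr 2
    exact mul_pow_cancel (ħ := ħ) n (by rw [conj_mul_pow, pow_mul_conjInv])

theorem barTwist_hom (n : ℕ) {a b : R} (h : b * ħ ^ n = ħ ^ n * a) :
    (barTwist 𝒜 ħ n).hom (MulOpposite.op (toBar 𝒜 ħ a)) = MulOpposite.op (toBar 𝒜 ħ b) := by
  have h1 : conj 𝒜 ħ n a = b := mul_pow_cancel n ((conj_mul_pow (𝒜 := 𝒜) n a).trans h.symm)
  rw [← h1]
  rfl

end GrMod

/-! ### A filtration argument for the connecting map of reduction modulo `ħ` -/

namespace GrMod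

variable {G : Type u} [AddCommGroup G] [DecidableEq G] {R : Type u} [Ring R]
  {𝒜 : G → AddSubgroup R} {ħ : R}

theorem op_pow_succ_smul {E : Type u} [AddCommGroup E] [Module Rᵐᵒᵖ E] (k : ℕ) (e : E) :
    MulOpposite.op (ħ ^ (k + 1)) • e = MulOpposite.op ħ • MulOpposite.op (ħ ^ k) • e := by
  rw [pow_succ, MulOpposite.op_mul, mul_smul]

theorem op_pow_succ_smul' {E : Type u} [AddCommGroup E] [Module Rᵐᵒᵖ E] (k : ℕ) (e : E) :
    MulOpposite.op (ħ ^ (k + 1)) • e = MulOpposite.op (ħ ^ k) • MulOpposite.op ħ • e := by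
  rw [pow_succ', MulOpposite.op_mul, mul_smul]

variable [hn : IsRegularNormal ħ]

/-- A right module `E` over `R` together with semilinear maps `Y → E → Z` from and to modules over
`R / ħ R` that identify `Y`, up to a twist, with the annihilator of `ħ` in `E`, and `E / E ħ` with a
submodule of `Z`. -/
structure Connecting (ε : G) (E : GrMod (opGrading 𝒜))
    (Y Z : GrMod (opGrading (barGrading 𝒜 ħ))) where
  d : Y →+ E
  π : E →+ Z
  d_mem : ∀ γ, ∀ y ∈ Y.deg γ, d y ∈ E.deg (γ + -ε)
  d_smul : ∀ (r r' : R) (y : Y), r' * ħ = ħ * r →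
    d (MulOpposite.op (toBar 𝒜 ħ r) • y) = MulOpposite.op r' • d y
  d_injective : Function.Injective d
  smul_d : ∀ y, MulOpposite.op ħ • d y = 0
  exists_d : ∀ e, MulOpposite.op ħ • e = 0 → ∃ y, d y = e
  π_mem : ∀ γ, ∀ e ∈ E.deg γ, π e ∈ Z.deg γ
  π_smul : ∀ (r : R) (e : E), π (MulOpposite.op r • e) = MulOpposite.op (toBar 𝒜 ħ r) • π e
  π_ker : ∀ e, π e = 0 → ∃ f, e = MulOpposite.op ħ • f

namespace Connecting

variable {ε : G} {E : GrMod (opGrading 𝒜)} {Y Z : GrMod (opGrading (barGrading 𝒜 ħ))}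
  (D : Connecting ε E Y Z)

/-- The elements `y` such that `d y` is divisible by `ħ ^ k`. -/
def Divisible (k : ℕ) (y : Y) : Prop := ∃ e, D.d y = MulOpposite.op (ħ ^ k) • e

theorem annihilated {k : ℕ} {y : Y} {e : E} (h : D.d y = MulOpposite.op (ħ ^ k) • e) :
    MulOpposite.op (ħ ^ (k + 1)) • e = 0 := by
  rw [op_pow_succ_smul, ← h, D.smul_d]

variable [GradedRing 𝒜]

/-- The image in `Z` of the annihilator of `ħ ^ k`. -/
def annImage (k : ℕ) : Submodule (RBar ħ)ᵐᵒᵖ Z where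
  carrier := {z | ∃ e, MulOpposite.op (ħ ^ k) • e = 0 ∧ D.π e = z}
  zero_mem' := ⟨0, smul_zero _, map_zero _⟩
  add_mem' := by
    rintro _ _ ⟨e, he, rfl⟩ ⟨f, hf, rfl⟩
    exact ⟨e + f, by rw [smul_add, he, hf, add_zero], map_add _ _ _⟩
  smul_mem' := by
    rintro a _ ⟨e, he, rfl⟩
    obtain ⟨r, rfl⟩ := exists_op_toBar 𝒜 a
    obtain ⟨s, hs⟩ := exists_mul_pow_eq (ħ := ħ) k r
    refine ⟨MulOpposite.op r • e, ?_, D.π_smul r e⟩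
    rw [smul_smul, ← MulOpposite.op_mul, hs, MulOpposite.op_mul, mul_smul, he, smul_zero]

theorem isHomogeneous_annImage (hε : ħ ∈ 𝒜 ε) (k : ℕ) : (D.annImage k).IsHomogeneous Z.deg := by
  refine isHomogeneous_iff.2 ?_
  rintro γ _ ⟨e, he, rfl⟩
  refine ⟨E.comp γ e, ?_, ?_⟩
  · rw [← comp_smul_of_mem E (δ := k • ε) (show MulOpposite.op (ħ ^ k) ∈ opGrading 𝒜 (k • ε) from
      SetLike.pow_mem_graded k hε), he, map_zero]
  · have := comp_addHom D.π 0 (fun γ e he => by rw [add_zero]; exact D.π_mem γ e he) γ e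
    rwa [add_zero, eq_comm] at this

variable (hε : ħ ∈ 𝒜 ε) (k : ℕ)

/-- The inclusion of the image of the annihilator of `ħ ^ k` into that of the annihilator of
`ħ ^ (k + 1)`, with its quotient. -/
abbrev annComplex : ShortComplex (GrMod (opGrading (barGrading 𝒜 ħ))) :=
  quotComplex (Z.sub (D.annImage (k + 1)) (D.isHomogeneous_annImage hε (k + 1))) _
    (isHomogeneous_comap (Z.subι (D.annImage (k + 1)) (D.isHomogeneous_annImage hε (k + 1)))
      (D.isHomogeneous_annImage hε k))

theorem annComplex_shortExact : (D.annComplex hε k).ShortExact := quotComplex_shortExact _ _ _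

/-- The class of `π e` for an element `e` annihilated by `ħ ^ (k + 1)`. -/
def annClass (e : E) (he : MulOpposite.op (ħ ^ (k + 1)) • e = 0) : (D.annComplex hε k).X₃ :=
  (D.annComplex hε k).g.lin ⟨D.π e, e, he, rfl⟩

variable {k}

theorem annClass_eq_zero_iff {e : E} (he : MulOpposite.op (ħ ^ (k + 1)) • e = 0) :
    D.annClass hε k e he = 0 ↔ ∃ f, MulOpposite.op (ħ ^ k) • f = 0 ∧ D.π f = D.π e :=
  Submodule.Quotient.mk_eq_zero _

theorem annClass_congr {e e' : E} (he : MulOpposite.op (ħ ^ (k + 1)) • e = 0)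
    (he' : MulOpposite.op (ħ ^ (k + 1)) • e' = 0)
    (h : MulOpposite.op (ħ ^ k) • e = MulOpposite.op (ħ ^ k) • e') :
    D.annClass hε k e he = D.annClass hε k e' he' :=
  (Submodule.Quotient.eq _).2 ⟨e - e', by rw [smul_sub, h, sub_self], map_sub _ _ _⟩

theorem annClass_add {e e' : E} (he : MulOpposite.op (ħ ^ (k + 1)) • e = 0)
    (he' : MulOpposite.op (ħ ^ (k + 1)) • e' = 0)
    (h : MulOpposite.op (ħ ^ (k + 1)) • (e + e') = 0) :
    D.annClass hε k (e + e') h = D.annClass hε k e he + D.annClass hε k e' he' := by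
  refine (congrArg (D.annComplex hε k).g.lin (Subtype.ext ?_)).trans (map_add _ _ _)
  exact map_add D.π e e'

theorem annClass_smul {e : E} (r : R) (he : MulOpposite.op (ħ ^ (k + 1)) • e = 0)
    (h : MulOpposite.op (ħ ^ (k + 1)) • MulOpposite.op r • e = 0) :
    D.annClass hε k (MulOpposite.op r • e) h =
      MulOpposite.op (toBar 𝒜 ħ r) • D.annClass hε k e he := by
  refine (congrArg (D.annComplex hε k).g.lin (Subtype.ext ?_)).trans (map_smul _ _ _)
  exact D.π_smul r e

theorem annClass_mem {e : E} (he : MulOpposite.op (ħ ^ (k + 1)) • e = 0) {γ : G}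
    (h : e ∈ E.deg γ) : D.annClass hε k e he ∈ (D.annComplex hε k).X₃.deg γ :=
  (D.annComplex hε k).g.map_mem (show _ ∈ Z.deg γ from D.π_mem γ e h)

/-- As `E` is noetherian, the annihilators of the powers of `ħ` become stationary at some `n`. If
`d y = e ħⁿ`, then `e ħⁿ⁺¹ = 0`, whence `e ħⁿ = 0`. -/
theorem exists_divisible_eq_zero (hE : E.IsGNoetherian) (hε : ħ ∈ 𝒜 ε) :
    ∃ n, ∀ y, D.Divisible n y → y = 0 := by
  let T : ℕ → Submodule Rᵐᵒᵖ E := fun n =>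
    { carrier := {e | MulOpposite.op (ħ ^ n) • e = 0}
      zero_mem' := smul_zero _
      add_mem' := fun {a b} ha hb => by
        change _ • (a + b) = 0
        rw [smul_add, ha, hb, add_zero]
      smul_mem' := fun a e he => by
        obtain ⟨s, hs⟩ := exists_mul_pow_eq (ħ := ħ) n a.unop
        change MulOpposite.op (ħ ^ n) • a • e = 0
        have : MulOpposite.op (ħ ^ n) * a = MulOpposite.op s * MulOpposite.op (ħ ^ n) :=
          congrArg MulOpposite.op hs
        rw [smul_smul, this, mul_smul, show MulOpposite.op (ħ ^ n) • e = 0 from he, smul_zero] }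
  have hmono : Monotone T := by
    refine monotone_nat_of_le_succ fun n e he => ?_
    change MulOpposite.op (ħ ^ (n + 1)) • e = 0
    rw [op_pow_succ_smul, show MulOpposite.op (ħ ^ n) • e = 0 from he, smul_zero]
  have hmem : ∀ e, e ∈ ⨆ n, T n ↔ ∃ n, e ∈ T n := fun e =>
    Submodule.mem_iSup_of_directed _ hmono.directed_le
  obtain ⟨s, hs⟩ := hE (⨆ n, T n) (isHomogeneous_iff.2 fun γ e he => by
    obtain ⟨n, he⟩ := (hmem e).1 he
    refine (hmem _).2 ⟨n, ?_⟩
    change MulOpposite.op (ħ ^ n) • E.comp γ e = 0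
    rw [← comp_smul_of_mem E (δ := n • ε) (show MulOpposite.op (ħ ^ n) ∈ opGrading 𝒜 (n • ε) from
      SetLike.pow_mem_graded n hε), show MulOpposite.op (ħ ^ n) • e = 0 from he, map_zero])
  have h1 : ∀ e ∈ s, ∃ n, e ∈ T n := fun e he => (hmem e).1 (hs ▸ Submodule.subset_span he)
  choose! m hm using h1
  have h2 : ⨆ n, T n ≤ T (s.sup m) := by
    rw [← hs, Submodule.span_le]
    exact fun e he => hmono (Finset.le_sup he) (hm e he)
  refine ⟨s.sup m, fun y ⟨e, he⟩ => D.d_injective ?_⟩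
  rw [map_zero, he]
  exact h2 ((hmem e).2 ⟨_, D.annihilated he⟩)

variable [hħ : Fact (SetLike.IsHomogeneousElem 𝒜 ħ)]

/-- Dividing `d y` by `ħ ^ k` identifies the quotients of the filtration of `Y` by divisibility
with those of the filtration of `Z` by annihilators, up to a twist. -/
theorem exists_divide {X : GrMod (opGrading (barGrading 𝒜 ħ))} (f : X ⟶ Y)
    (hf : ∀ y, D.Divisible k y ↔ ∃ x, f.lin x = y) :
    ∃ Φ : X ⟶ (resShift (barTwist 𝒜 ħ (k + 1)) (-((k + 1) • ε))).obj (D.annComplex hε k).X₃,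
      Function.Surjective Φ.lin ∧ ∀ x, Φ.lin x = 0 ↔ D.Divisible (k + 1) (f.lin x) := by
  have hX : ∀ x, D.Divisible k (f.lin x) := fun x => (hf _).2 ⟨x, rfl⟩
  choose e he using hX
  have key : ∀ (x : X) (e' : E) (h' : D.d (f.lin x) = MulOpposite.op (ħ ^ k) • e'),
      D.annClass hε k (e x) (D.annihilated (he x)) = D.annClass hε k e' (D.annihilated h') :=
    fun x e' h' => D.annClass_congr hε _ _ ((he x).symm.trans h')
  refine ⟨⟨{ toFun := fun x => D.annClass hε k (e x) (D.annihilated (he x))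
             map_add' := fun x y => ?_
             map_smul' := fun a x => ?_ }, fun {γ x} hx => ?_⟩, fun z => ?_, fun x => ?_⟩
  · refine (key (x + y) (e x + e y) ?_).trans (D.annClass_add hε _ _ _)
    rw [map_add, map_add, he, he, smul_add]
  · obtain ⟨r, rfl⟩ := exists_op_toBar 𝒜 a
    obtain ⟨r', hr'⟩ := hn.left_mul r
    obtain ⟨s, hs⟩ := exists_pow_mul_eq (ħ := ħ) k r'
    have h1 : D.d (f.lin (MulOpposite.op (toBar 𝒜 ħ r) • x)) =
        MulOpposite.op (ħ ^ k) • MulOpposite.op s • e x := by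
      rw [map_smul, D.d_smul r r' _ hr'.symm, he, smul_smul, smul_smul, ← MulOpposite.op_mul,
        ← MulOpposite.op_mul, hs]
    have h2 : s * ħ ^ (k + 1) = ħ ^ (k + 1) * r := by
      rw [pow_succ, ← mul_assoc, ← hs, mul_assoc, ← hr', mul_assoc]
    refine (key _ _ h1).trans ((D.annClass_smul hε s (D.annihilated (he x)) _).trans ?_)
    rw [← barTwist_hom (𝒜 := 𝒜) (k + 1) h2]
    rfl
  · have h1 : D.d (f.lin x) =
        MulOpposite.op (ħ ^ k) • E.comp (γ + -ε + -(k • ε)) (e x) := by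
      rw [← comp_smul_of_mem E (δ := k • ε) (show MulOpposite.op (ħ ^ k) ∈ opGrading 𝒜 (k • ε) from
        SetLike.pow_mem_graded k hε), ← he, neg_add_cancel_right,
        comp_same _ (D.d_mem γ _ (f.map_mem hx))]
    have h2 := D.annClass_mem hε (D.annihilated h1) (E.comp_mem (γ + -ε + -(k • ε)) (e x))
    rw [← key x _ h1] at h2
    rwa [show γ + -ε + -(k • ε) = -((k + 1) • ε) + γ by rw [succ_nsmul]; abel] at h2
  · obtain ⟨⟨_, e', h', rfl⟩, rfl⟩ := surjective_g (D.annComplex_shortExact hε k) z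
    obtain ⟨y, hy⟩ := D.exists_d (MulOpposite.op (ħ ^ k) • e') (by rw [← op_pow_succ_smul, h'])
    obtain ⟨x, rfl⟩ := (hf y).1 ⟨e', hy⟩
    exact ⟨x, key x e' hy⟩
  · refine (D.annClass_eq_zero_iff hε (D.annihilated (he x))).trans ⟨?_, ?_⟩
    · rintro ⟨e', h', h⟩
      obtain ⟨f', hf'⟩ := D.π_ker (e x - e') (by rw [map_sub, h, sub_self])
      refine ⟨f', ?_⟩
      rw [op_pow_succ_smul', ← hf', smul_sub, h', sub_zero, he]
    · rintro ⟨f', hf'⟩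
      rw [op_pow_succ_smul'] at hf'
      have h1 := (D.annClass_eq_zero_iff hε (D.annihilated hf')).2
        ⟨0, smul_zero _, by rw [map_zero, D.π_smul, toBar_self, MulOpposite.op_zero, zero_smul]⟩
      rw [← key x _ hf'] at h1
      exact (D.annClass_eq_zero_iff hε (D.annihilated (he x))).1 h1

/-- The elements `y` of `Y` with `d y` divisible by `ħ ^ k` form a decreasing filtration, reaching zero
at `n`. Each of its quotients is, up to a twist, a quotient of two submodules of `Z`; hence a
vanishing of Ext groups for all submodules of `Z` passes to each step of the filtration, here given
as the image of `f`. -/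
theorem extVanish_of_divisible (j : ℕ)
    (hZ : ∀ i ≤ j, ∀ (X : GrMod (opGrading (barGrading 𝒜 ħ))) (f : X ⟶ Z),
      Function.Injective f.lin → X.ExtVanish i) (hε : ħ ∈ 𝒜 ε) {n : ℕ}
    (hn : ∀ y, D.Divisible n y → y = 0) (m : ℕ) (k : ℕ) (hk : k + m = n)
    (X : GrMod (opGrading (barGrading 𝒜 ħ))) (f : X ⟶ Y) (hf : Function.Injective f.lin)
    (h : ∀ y, D.Divisible k y ↔ ∃ x, f.lin x = y) : X.ExtVanish j := by
  induction m generalizing k X with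
  | zero =>
    obtain rfl : k = n := hk
    refine extVanish_of_subsingleton (subsingleton_of_forall_eq 0 fun x => hf ?_) j
    rw [hn _ ((h _).2 ⟨x, rfl⟩), map_zero]
  | succ m ih =>
    obtain ⟨Φ, hΦ, hker⟩ := D.exists_divide hε f h
    refine extVanish_mid (kerComplex_shortExact Φ hΦ) ?_ ?_
    · refine ih (k + 1) (by lia) _ ((kerComplex Φ).f ≫ f) (hf.comp Subtype.val_injective)
        fun y => ?_
      constructor
      · intro hy
        obtain ⟨x, rfl⟩ := (h y).1 (by
          obtain ⟨e, he⟩ := hy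
          exact ⟨MulOpposite.op ħ • e, by rw [he, op_pow_succ_smul']⟩)
        exact ⟨⟨x, (hker x).2 hy⟩, rfl⟩
      · rintro ⟨⟨x, hx⟩, rfl⟩
        exact (hker x).1 hx
    · refine extVanish_of_semilinear (barTwist 𝒜 ħ (k + 1)) (-((k + 1) • ε)) (𝟙 _)
        Function.bijective_id ?_
      have hS := D.annComplex_shortExact hε k
      have hι := D.isHomogeneous_annImage hε (k + 1)
      have h2 : (D.annComplex hε k).X₂.ExtVanish j := hZ j le_rfl _ (Z.subι _ hι)
        Subtype.val_injective
      cases j with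
      | zero => exact extVanish_right_zero hS h2
      | succ j =>
        exact extVanish_right hS (hZ j (Nat.le_succ j) _ ((D.annComplex hε k).f ≫ Z.subι _ hι)
          (Subtype.val_injective.comp Subtype.val_injective)) h2

end Connecting

end GrMod

/-! ### The connecting map of reduction modulo `ħ` -/

namespace GrMod

open Abelian

variable {G : Type u} [AddCommGroup G] [DecidableEq G] {R : Type u} [Ring R]
  {𝒜 : G → AddSubgroup R} [GradedRing 𝒜] {ħ : R} [hn : IsRegularNormal ħ]
  [hħ : Fact (SetLike.IsHomogeneousElem 𝒜 ħ)]

/-- The extension classes of the sequences `0 → R(γ) → R(γ + ε) → (R / ħ R)(γ + ε) → 0` are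
compatible with right multiplications, up to the twist `r' ħ = ħ r`. -/
theorem barComplex_extClass_naturality {ε δ γ η γ' η' : G} (hε : ħ ∈ 𝒜 ε) (h : γ + ε = η)
    (h' : γ' + ε = η') (hη : η + δ = η') {r r' : R} (hr : r ∈ 𝒜 δ) (hr' : r' ∈ 𝒜 δ)
    (e : r' * ħ = ħ * r) :
    (barComplex_shortExact hε h).extClass.comp (Ext.mk₀ (rightMul 𝒜 γ γ' r')) (add_zero 1) =
      (Ext.mk₀ ((res (toBar 𝒜 ħ)).map (rightMul (barGrading 𝒜 ħ) η η' (toBar 𝒜 ħ r)))).comp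
        (barComplex_shortExact hε h').extClass (zero_add 1) := by
  have hγ : γ + δ = γ' := by
    rw [← add_left_inj ε, h', ← hη, ← h]; abel
  refine ShortComplex.ShortExact.extClass_naturality (barComplex_shortExact hε h)
    (barComplex_shortExact hε h') ⟨rightMul 𝒜 γ γ' r', rightMul 𝒜 η η' r,
      (res (toBar 𝒜 ħ)).map (rightMul (barGrading 𝒜 ħ) η η' (toBar 𝒜 ħ r)), ?_, ?_⟩
  · exact (rightMul_comp_of_add hγ h' hr' hε).trans
      ((congrArg (rightMul 𝒜 γ η') e).trans (rightMul_comp_of_add h hη hε hr).symm)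
  · refine hom_ext fun (x : R) => ?_
    refine Eq.trans (congrArg (toBar 𝒜 ħ) (rightMul_apply hη hr x)) ?_
    exact (map_mul (toBar 𝒜 ħ) x r).trans
      (rightMul_apply hη ((toBar 𝒜 ħ).map_mem hr) (toBar 𝒜 ħ x)).symm

section Maps

variable (M : GrMod 𝒜) (hM : ∀ x : M, ħ • x = 0 → x = 0) {ε : G} (hε : ħ ∈ 𝒜 ε) (j : ℕ)

/-- The connecting map from the graded Ext groups of `M / ħ M` over `R / ħ R` to those of `M`. -/
def barδ : (M.baseChange (toBar 𝒜 ħ)).uExt j →+ M.uExt (j + 1) :=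
  udesc fun η => (uof M (j + 1) (η + -ε)).comp
    (((barComplex_shortExact hε (neg_add_cancel_right η ε)).extClass.postcomp M rfl).comp
      (barComparison M hM j η).toAddMonoidHom)

theorem barδ_uof {γ η : G} (h : γ + ε = η)
    (x : Ext.{u} (M.baseChange (toBar 𝒜 ħ)) ((self (barGrading 𝒜 ħ)).shift η) j) :
    barδ M hM hε j (uof _ j η x) = uof M (j + 1) γ
      ((barComparison M hM j η x).comp (barComplex_shortExact hε h).extClass rfl) := by
  obtain rfl : γ = η + -ε := by rw [← h, add_neg_cancel_right]
  exact udesc_uof _ η x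

/-- The map on graded Ext groups induced by the projection `R ⟶ R / ħ R`. -/
def barReduce : M.uExt j →+ (M.baseChange (toBar 𝒜 ħ)).uExt j :=
  udesc fun η => (uof _ j η).comp ((barComparison M hM j η).symm.toAddMonoidHom.comp
    ((Ext.mk₀ (barπ 𝒜 ħ η)).postcomp M (add_zero j)))

theorem barReduce_uof (η : G) (x : Ext.{u} M ((self 𝒜).shift η) j) :
    barReduce M hM j (uof M j η x) = uof _ j η ((barComparison M hM j η).symm
      (x.comp (Ext.mk₀ (barπ 𝒜 ħ η)) (add_zero j))) :=
  udesc_uof _ η x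

theorem barδ_mem (γ : G) (y : (M.baseChange (toBar 𝒜 ħ)).uExt j)
    (hy : y ∈ ((M.baseChange (toBar 𝒜 ħ)).uExt j).deg γ) :
    barδ M hM hε j y ∈ (M.uExt (j + 1)).deg (γ + -ε) := by
  obtain ⟨x, rfl⟩ := mem_uExt_deg.1 hy
  rw [barδ_uof M hM hε j (neg_add_cancel_right γ ε)]
  exact uof_mem _ _ _ _

theorem barReduce_mem (γ : G) (e : M.uExt j) (he : e ∈ (M.uExt j).deg γ) :
    barReduce M hM j e ∈ ((M.baseChange (toBar 𝒜 ħ)).uExt j).deg γ := by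
  obtain ⟨x, rfl⟩ := mem_uExt_deg.1 he
  rw [barReduce_uof]
  exact uof_mem _ _ _ _

theorem barδ_smul (r r' : R) (y : (M.baseChange (toBar 𝒜 ħ)).uExt j) (h : r' * ħ = ħ * r) :
    barδ M hM hε j (MulOpposite.op (toBar 𝒜 ħ r) • y) = MulOpposite.op r' • barδ M hM hε j y := by
  have h1 : r' = conj 𝒜 ħ 1 r := mul_pow_cancel (ħ := ħ) 1 (by
    rw [conj_mul_pow, pow_one, h])
  subst h1
  clear h
  induction r using DirectSum.Decomposition.inductionOn 𝒜 with
  | zero => rw [map_zero, map_zero, MulOpposite.op_zero, MulOpposite.op_zero, zero_smul, zero_smul,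
      map_zero]
  | add a b ha hb => rw [map_add, map_add, MulOpposite.op_add, MulOpposite.op_add, add_smul,
      add_smul, map_add, ha, hb]
  | @homogeneous δ r =>
    induction y using uExt_induction with
    | zero => rw [smul_zero, map_zero, smul_zero]
    | add a b ha hb => rw [smul_add, map_add, map_add, ha, hb, smul_add]
    | of η x =>
      have hr : conj 𝒜 ħ 1 (r : R) ∈ 𝒜 δ := (conj 𝒜 ħ 1).map_mem r.2
      have he : conj 𝒜 ħ 1 (r : R) * ħ = ħ * r := by
        have := conj_mul_pow (𝒜 := 𝒜) (ħ := ħ) 1 r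
        rwa [pow_one] at this
      rw [op_smul_uof (a := toBar 𝒜 ħ r) rfl ((toBar 𝒜 ħ).map_mem r.2),
        barδ_uof M hM hε j (neg_add_cancel_right η ε),
        barδ_uof M hM hε j (show η + -ε + δ + ε = η + δ by abel), op_smul_uof rfl hr,
        barComparison_comp_mk₀, Ext.comp_assoc_of_third_deg_zero,
        barComplex_extClass_naturality hε _ (show η + -ε + δ + ε = η + δ by abel) rfl r.2 hr he,
        Ext.comp_assoc_of_second_deg_zero]

theorem barδ_injective (h : M.ExtVanish j) : Function.Injective (barδ M hM hε j) := by
  rw [injective_iff_map_eq_zero]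
  intro y hy
  have key : ∀ η, ∀ y ∈ ((M.baseChange (toBar 𝒜 ħ)).uExt j).deg η, barδ M hM hε j y = 0 →
      ∃ x, (0 : (M.baseChange (toBar 𝒜 ħ)).uExt j →+ (M.baseChange (toBar 𝒜 ħ)).uExt j) x = y := by
    intro η y hy h0
    obtain ⟨x, rfl⟩ := mem_uExt_deg.1 hy
    rw [barδ_uof M hM hε j (neg_add_cancel_right η ε), uof_eq_zero] at h0
    obtain ⟨z, hz⟩ := Ext.covariant_sequence_exact₃ M
      (barComplex_shortExact hε (neg_add_cancel_right η ε)) _ rfl h0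
    have h1 : barComparison M hM j η x = 0 := by rw [← hz, h η z, Ext.zero_comp]
    exact ⟨0, by
      rw [(map_eq_zero_iff _ (barComparison M hM j η).injective).1 h1, map_zero, map_zero]⟩
  obtain ⟨x, hx⟩ := mem_range_of_homogeneous _ (barδ M hM hε j) (-ε) (barδ_mem M hM hε j) key y hy
  exact hx.symm

theorem smul_barδ (y : (M.baseChange (toBar 𝒜 ħ)).uExt j) :
    MulOpposite.op ħ • barδ M hM hε j y = 0 := by
  induction y using uExt_induction with
  | zero => rw [map_zero, smul_zero]
  | add a b ha hb => rw [map_add, smul_add, ha, hb, add_zero]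
  | of η x =>
    rw [barδ_uof M hM hε j (neg_add_cancel_right η ε), op_smul_uof (neg_add_cancel_right η ε) hε,
      Ext.comp_assoc_of_third_deg_zero]
    have := (barComplex_shortExact hε (neg_add_cancel_right η ε)).extClass_comp
    rw [this, Ext.comp_zero, map_zero]

theorem exists_barδ_eq (e : M.uExt (j + 1)) (he : MulOpposite.op ħ • e = 0) :
    ∃ y, barδ M hM hε j y = e := by
  refine mem_range_of_homogeneous (barδ M hM hε j)
    (DistribSMul.toAddMonoidHom (M.uExt (j + 1)) (MulOpposite.op ħ)) ε (fun γ e he => ?_)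
    (fun γ e he h0 => ?_) e he
  · rw [add_comm γ]
    exact GrMod.smul_mem _ (show MulOpposite.op ħ ∈ opGrading 𝒜 ε from hε) he
  · obtain ⟨x, rfl⟩ := mem_uExt_deg.1 he
    have h1 := (op_smul_uof rfl hε x).symm.trans h0
    obtain ⟨z, hz⟩ := Ext.covariant_sequence_exact₁ M (barComplex_shortExact hε rfl) x
      (uof_eq_zero.1 h1) rfl
    refine ⟨uof _ j _ ((barComparison M hM j _).symm z), ?_⟩
    rw [barδ_uof M hM hε j rfl, AddEquiv.apply_symm_apply, hz]

theorem barReduce_smul (r : R) (e : M.uExt j) :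
    barReduce M hM j (MulOpposite.op r • e) =
      MulOpposite.op (toBar 𝒜 ħ r) • barReduce M hM j e := by
  refine map_smul_of_homogeneous (barReduce M hM j)
    (RingHom.op (toBar 𝒜 ħ).toRingHom).toAddMonoidHom ?_ (MulOpposite.op r) e
  rintro δ γ a ha _ ⟨x, rfl⟩
  obtain ⟨a, rfl⟩ := MulOpposite.op_surjective a
  replace ha : a ∈ 𝒜 δ := ha
  change barReduce M hM j (MulOpposite.op a • uof M j γ x) =
    MulOpposite.op (toBar 𝒜 ħ a) • barReduce M hM j (uof M j γ x)
  rw [op_smul_uof rfl ha, barReduce_uof, barReduce_uof,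
    op_smul_uof (a := toBar 𝒜 ħ a) rfl ((toBar 𝒜 ħ).map_mem ha)]
  congr 1
  rw [AddEquiv.symm_apply_eq, barComparison_comp_mk₀, AddEquiv.apply_symm_apply,
    Ext.comp_assoc_of_third_deg_zero, Ext.comp_assoc_of_third_deg_zero, Ext.mk₀_comp_mk₀,
    Ext.mk₀_comp_mk₀]
  congr 2
  refine hom_ext fun (x : R) => ?_
  refine Eq.trans (congrArg (toBar 𝒜 ħ) (rightMul_apply rfl ha x)) ?_
  exact (map_mul (toBar 𝒜 ħ) x a).trans
    (rightMul_apply rfl ((toBar 𝒜 ħ).map_mem ha) (toBar 𝒜 ħ x)).symm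

theorem exists_eq_smul_of_barReduce (e : M.uExt j) (he : barReduce M hM j e = 0) :
    ∃ f : M.uExt j, e = MulOpposite.op ħ • f := by
  obtain ⟨ε, hε⟩ := hħ.out
  refine (mem_range_of_homogeneous
    (DistribSMul.toAddMonoidHom (M.uExt j) (MulOpposite.op ħ)) (barReduce M hM j) 0
    (fun γ e he => by rw [add_zero]; exact barReduce_mem M hM j γ e he)
    (fun γ e he h0 => ?_) e he).imp fun f hf => hf.symm
  · obtain ⟨x, rfl⟩ := mem_uExt_deg.1 he
    rw [barReduce_uof, uof_eq_zero, map_eq_zero_iff _ (AddEquiv.injective _)] at h0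
    obtain ⟨y, rfl⟩ := Ext.covariant_sequence_exact₂ M
      (barComplex_shortExact hε (sub_add_cancel γ ε)) x h0
    exact ⟨uof M j (γ - ε) y, op_smul_uof (sub_add_cancel γ ε) hε y⟩

/-- The long exact sequence of reduction modulo `ħ`, around `Ext^{j+1}(M, R)`. -/
def barConnecting (h : M.ExtVanish j) : Connecting (ħ := ħ) ε (M.uExt (j + 1))
    ((M.baseChange (toBar 𝒜 ħ)).uExt j) ((M.baseChange (toBar 𝒜 ħ)).uExt (j + 1)) where
  d := barδ M hM hε j
  π := barReduce M hM (j + 1)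
  d_mem := barδ_mem M hM hε j
  d_smul := barδ_smul M hM hε j
  d_injective := barδ_injective M hM hε j h
  smul_d := smul_barδ M hM hε j
  exists_d := exists_barδ_eq M hM hε j
  π_mem := barReduce_mem M hM (j + 1)
  π_smul := barReduce_smul M hM (j + 1)
  π_ker := exists_eq_smul_of_barReduce M hM (j + 1)

end Maps

theorem finite_baseChange_bar (M : GrMod 𝒜) [hM : Module.Finite R M] :
    Module.Finite (RBar ħ) (M.baseChange (toBar 𝒜 ħ)) := by
  obtain ⟨s, hs⟩ := hM.fg_top
  classical
  refine ⟨⟨s.image fun m =>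
      (show M.baseChange (toBar 𝒜 ħ) from (baseChangeUnit (toBar 𝒜 ħ) M).lin m),
    baseChange_span (toBar 𝒜 ħ) M _ fun m => ?_⟩⟩
  have hm : m ∈ Submodule.span R (s : Set M) := hs ▸ Submodule.mem_top
  induction hm using Submodule.span_induction with
  | mem x h => exact Submodule.subset_span (Finset.mem_coe.2 (Finset.mem_image_of_mem _ h))
  | zero => rw [map_zero]; exact zero_mem _
  | add x y _ _ hx hy => rw [map_add]; exact add_mem hx hy
  | smul r x _ hx => rw [map_smul]; exact Submodule.smul_mem _ (toBar 𝒜 ħ r) hx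

/-- The exactness of `Ext^i(M, R) → Ext^i(M, R / ħ R) → Ext^{i+1}(M, R)`. -/
theorem extVanish_bar_of_extVanish (M : GrMod 𝒜) (hM : ∀ x : M, ħ • x = 0 → x = 0) {i : ℕ}
    (h : M.ExtVanish i) (h' : M.ExtVanish (i + 1)) :
    (M.baseChange (toBar 𝒜 ħ)).ExtVanish i := fun η x => by
  obtain ⟨ε, hε⟩ := hħ.out
  obtain ⟨z, hz⟩ := Ext.covariant_sequence_exact₃ M
    (barComplex_shortExact hε (neg_add_cancel_right η ε)) (barComparison M hM i η x) rfl (h' _ _)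
  have h1 : barComparison M hM i η x = 0 := by rw [← hz, h η z, Ext.zero_comp]
  exact (map_eq_zero_iff _ (barComparison M hM i η).injective).1 h1

/-- If `R / ħ R` satisfies the Auslander condition and `Ext^i(M, R) = 0` for `i ≤ j`, then the
long exact sequence embeds `Y = Ext^j(M / ħ M, R / ħ R)` in `Ext^{j+1}(M, R)`. The filtration of `Y`
by divisibility has subquotients of `Ext^{j+1}(M / ħ M, R / ħ R)` as quotients, so the Auslander
condition yields `Ext^j(Y, R / ħ R) = 0`, and this forces `Y = 0`. -/
theorem extVanish_bar (hl : IsLeftGNoetherian 𝒜) (hr : IsRightGNoetherian 𝒜)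
    (hA : IsGGorenstein (barGrading 𝒜 ħ)) (M : GrMod 𝒜) [Module.Finite R M]
    (hM : ∀ x : M, ħ • x = 0 → x = 0) {j : ℕ} (h : ∀ i ≤ j, M.ExtVanish i) :
    (M.baseChange (toBar 𝒜 ħ)).ExtVanish j := by
  obtain ⟨ε, hε⟩ := hħ.out
  have := finite_baseChange_bar (ħ := ħ) M
  let D := barConnecting M hM hε j (h j le_rfl)
  refine extVanish_of_uExt_extVanish hA (M.baseChange (toBar 𝒜 ħ))
    (fun i hi => extVanish_bar_of_extVanish M hM (h i hi.le) (h (i + 1) hi)) ?_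
  obtain ⟨n, hn⟩ := D.exists_divisible_eq_zero (isGNoetherian_uExt hl hr (j + 1) M) hε
  refine D.extVanish_of_divisible j (fun i hi X f hf => ?_) hε hn n 0 (zero_add n) _ (𝟙 _)
    Function.injective_id fun y => ⟨fun _ => ⟨y, rfl⟩, fun _ => ⟨D.d y, ?_⟩⟩
  · have h1 := (hA.left_auslander (M.baseChange (toBar 𝒜 ħ)) this).extVanish_sub
      (Nat.lt_succ_of_le hi) _ (isHomogeneous_range f)
    refine extVanish_of_iso (isoOfBijective ⟨LinearMap.rangeRestrict f.lin, fun hx => f.map_mem hx⟩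
      ⟨fun x y hxy => hf (congrArg Subtype.val hxy), LinearMap.surjective_rangeRestrict _⟩).symm h1
  · rw [pow_zero, MulOpposite.op_one, one_smul]

/-- Over an Auslander-Gorenstein quotient, `ħ` acts injectively on the first nonvanishing
`Ext^g(M, R)`. -/
theorem eq_zero_of_smul_eq_zero (hl : IsLeftGNoetherian 𝒜) (hr : IsRightGNoetherian 𝒜)
    (hA : IsGGorenstein (barGrading 𝒜 ħ)) (M : GrMod 𝒜) [Module.Finite R M]
    (hM : ∀ x : M, ħ • x = 0 → x = 0) {g : ℕ} (h : ∀ i < g, M.ExtVanish i) (e : M.uExt g)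
    (he : MulOpposite.op ħ • e = 0) : e = 0 := by
  obtain ⟨ε, hε⟩ := hħ.out
  cases g with
  | zero =>
    obtain ⟨x, hx⟩ := mem_range_of_homogeneous (0 : M.uExt 0 →+ M.uExt 0)
      (DistribSMul.toAddMonoidHom (M.uExt 0) (MulOpposite.op ħ)) ε (fun γ e he => by
        rw [add_comm γ]
        exact GrMod.smul_mem _ (show MulOpposite.op ħ ∈ opGrading 𝒜 ε from hε) he)
      (fun γ e he h0 => by
        obtain ⟨x, rfl⟩ := mem_uExt_deg.1 he
        have h1 := uof_eq_zero.1 ((op_smul_uof rfl hε x).symm.trans h0)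
        have := (barComplex_shortExact hε (γ := γ) rfl).mono_f
        have h2 : x = 0 := Ext.postcomp_mk₀_injective_of_mono M (rightMul 𝒜 γ (γ + ε) ħ)
          (h1.trans (map_zero _).symm)
        exact ⟨0, by rw [h2, map_zero, map_zero]⟩) e he
    exact hx.symm
  | succ j =>
    obtain ⟨y, rfl⟩ := exists_barδ_eq M hM hε j e he
    have := (extVanish_iff _ _).1
      (extVanish_bar hl hr hA M hM (j := j) fun i hi => h i (Nat.lt_succ_of_le hi))
    rw [Subsingleton.elim y 0, map_zero]

/-- The first nonvanishing `Ext^g(M, R)` is not torsion, since `ħ` acts injectively on it; so it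
survives in the localization. -/
theorem extVanish_of_hat (hl : IsLeftGNoetherian 𝒜) (hr : IsRightGNoetherian 𝒜)
    (hA : IsGGorenstein (barGrading 𝒜 ħ)) (M : GrMod 𝒜) [Module.Finite R M]
    (hM : ∀ x : M, ħ • x = 0 → x = 0) {n : ℕ∞}
    (h : ∀ i : ℕ, (i : ℕ∞) < n → (M.baseChange (toHat 𝒜 ħ)).ExtVanish i) (g : ℕ)
    (hg : (g : ℕ∞) < n) : M.ExtVanish g := by
  induction g using Nat.strong_induction_on with
  | _ g ih =>
    have hV : ∀ i < g, M.ExtVanish i := fun i hi =>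
      ih i hi (lt_trans (by exact_mod_cast hi) hg)
    refine (extVanish_iff M g).2 (subsingleton_of_forall_eq 0 fun e => ?_)
    obtain ⟨m, hm⟩ := exists_pow_smul_uExt_eq_zero hl M (h g hg) e
    induction m with
    | zero => rwa [pow_zero, MulOpposite.op_one, one_smul] at hm
    | succ m ihm =>
      rw [op_pow_succ_smul] at hm
      exact ihm (eq_zero_of_smul_eq_zero hl hr hA M hM hV _ hm)

end GrMod

end

theorem mainTheorem12 {G : Type u} [AddCommGroup G] [DecidableEq G] {R : Type u} [Ring R]
    (𝒜 : G → AddSubgroup R) [GradedRing 𝒜] (ħ : R)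
    [IsRegularNormal ħ] [Fact (SetLike.IsHomogeneousElem 𝒜 ħ)] (hunit : ¬ IsUnit ħ)
    (hleft : IsLeftGNoetherian 𝒜) (hright : IsRightGNoetherian 𝒜)
    (M : GrMod 𝒜) (hfin : Module.Finite R M) (htf : IsTorsionFree ħ M) :
    (ħ ∈ jacobsonG 𝒜 →
      (M.baseChange (toHat 𝒜 ħ)).grade ≥ M.grade ∧
        M.grade ≥ (M.baseChange (toBar 𝒜 ħ)).grade) ∧
    (IsGAuslanderGorenstein (barGrading 𝒜 ħ) →
      (M.baseChange (toHat 𝒜 ħ)).grade = M.grade ∧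
        M.grade ≤ (M.baseChange (toBar 𝒜 ħ)).grade) := by
  have hM : ∀ x : M, ħ • x = 0 → x = 0 := fun x hx => by
    have h1 : x ∈ torsionPart ħ M := ⟨1, by rwa [pow_one]⟩
    rw [htf] at h1
    exact h1
  have hhat : M.grade ≤ (M.baseChange (toHat 𝒜 ħ)).grade := (GrMod.le_grade_iff _ _).2 fun i hi =>
    GrMod.extVanish_hat hleft M ((GrMod.le_grade_iff M _).1 le_rfl i hi)
  refine ⟨fun hJ => ⟨hhat, (GrMod.le_grade_iff _ _).2 fun i hi =>
    GrMod.extVanish_of_bar hleft hright hJ M hM ((GrMod.le_grade_iff _ _).1 le_rfl i hi)⟩, fun hA =>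
    ⟨le_antisymm ((GrMod.le_grade_iff _ _).2 fun i hi => GrMod.extVanish_of_hat hleft hright
      hA.toIsGGorenstein M hM ((GrMod.le_grade_iff _ _).1 le_rfl) i hi) hhat,
      (GrMod.le_grade_iff _ _).2 fun i hi => ?_⟩⟩
  exact GrMod.extVanish_bar hleft hright hA.toIsGGorenstein M hM fun k hk =>
    (GrMod.le_grade_iff M _).1 le_rfl k (lt_of_le_of_lt (by exact_mod_cast hk) hi)
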